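/- All algebras are associative, unital and over $\mathbb{C}$. A differential calculus $(\Omega A,d)$ over an algebra $A$ is a differential graded algebra $\Omega A=\bigoplus_{n\ge 0}\Omega^nA$ (degree-one $d$, graded Leibniz rule, $d\circ d=0$) with $\Omega^0A=A$ and $\Omega^nA=A\,dA\wedge\cdots\wedge dA$ ($n$ factors $dA$). It is connected if $\ker d|_A=\mathbb{C}\cdot 1$, and has dimension $n$ if $\Omega^nA\neq 0$ and $\Omega^mA=0$ for all $m>n$. For a subalgebra $B\subseteq A$, the restriction of $\Omega A$ to $B$ is the calculus with $\Omega^nB=B\,dB\wedge\cdots\wedge dB\subseteq\Omega^nA$. Let $\mathcal{I}_kA$ be the space of right $A$-linear maps $\Omega^kA\to A$, with $(a\cdot\phi\cdot b)(\omega)=a\phi(b\omega)$ and, for $\phi\in\mathcal{I}_{n+m}A$, $\omega\in\Omega^nA$, $\omega'\in\Omega^mA$, $(\phi\cdot\omega)(\omega')=\phi(\omega\wedge\omega')$. A divergence is a linear map $\nabla:\mathcal{I}_1A\to A$ with $\nabla(\phi\cdot a)=\nabla(\phi)a+\phi(da)$; it extends to $\nabla_n:\mathcal{I}_{n+1}A\to\mathcal{I}_nA$,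 $\nabla_n(\phi)(\omega)=\nabla(\phi\cdot\omega)+(-1)^{n+1}\phi(d\omega)$ (with $\nabla_0=\nabla$ under $\mathcal{I}_0A\cong A$), and is flat if $\nabla\circ\nabla_1=0$. An $n$-dimensional calculus is integrable if there are a flat divergence $\nabla$, an algebra automorphism $\nu$ of $A$ and linear isomorphisms $\Theta_k:\Omega^kA\to\mathcal{I}_{n-k}A$, $0\le k\le n$, with $\Theta_k(a\omega b)=\nu(a)\cdot\Theta_k(\omega)\cdot b$ for all $a,b\in A$, and $\Theta_{k+1}\circ d=\nabla_{n-k-1}\circ\Theta_k$ for $0\le k<n$. For an algebra $A$ generated by a finite set, let $\mathcal{V}(n)$ be the span of all words of length at most $n$ in the generators; the Gelfand-Kirillov dimension of $A$ is $\inf\{\nu\mid \dim\mathcal{V}(n)\le n^\nu \text{ for } n\gg 0\}$ (independent of the generating set). A finitely generated algebra of integer Gelfand-Kirillov dimension $n$ is differentially smooth if it admits an $n$-dimensional connected integrable differential calculus. Let $N\ge 1$ be an integer, $q>0$ and $\kappa\in\mathbb{R}$, and put $[n]_q=\frac{1-q^n}{1-q}$ for $n\in\mathbb{Z}$ (read as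 $n$ if $q=1$). The quantum disc algebra $\mathcal{O}(D_{q,\kappa})$ is the $*$-algebra generated by $z,z^*$ with $z^*z-qzz^*=\kappa$. Its calculus $\Omega(D_{q,\kappa})$ is generated by $z,z^*$ and the one-forms $dz,dz^*$ subject to this relation, the relations $$z\,dz=q^{-1}dz\,z,\quad z^*dz=q\,dz\,z^*,\quad dz\wedge dz^*=-q^{-1}dz^*\wedge dz,\quad dz\wedge dz=0,$$ and their $*$-conjugates. The quantum cone algebra $\mathcal{O}(C^N_{q,\kappa})$ is the $*$-algebra generated by $a=a^*$, $b$, $b^*$ with relations $$ab=q^Nba+\kappa[N]_qb,\quad bb^*=\prod_{l=0}^{N-1}(q^{-l}a+\kappa[-l]_q),\quad b^*b=\prod_{l=1}^{N}(q^la+\kappa[l]_q),$$ embedded in $\mathcal{O}(D_{q,\kappa})$ by $a\mapsto zz^*$, $b\mapsto z^N$, and $\Omega(C^N_{q,\kappa})$ denotes the restriction of $\Omega(D_{q,\kappa})$ to $\mathcal{O}(C^N_{q,\kappa})$. **Theorem.** For all integers $N\ge 1$, all real $q>0$ and all real $\kappa\neq 0$, $\Omega(C^N_{q,\kappa})$ is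 a $2$-dimensional connected integrable differential calculus over $\mathcal{O}(C^N_{q,\kappa})$. Moreover $\mathcal{O}(C^N_{q,\kappa})$ is finitely generated of Gelfand-Kirillov dimension $2$, and hence it is differentially smooth. -/

import Mathlib

open scoped NNReal ENNReal

noncomputable section

namespace QuantumCone

/-! ### Differential calculi over an algebra -/

/-- Raw data of a differential calculus over `A`: an ambient algebra `E`, an algebra map
`ι : A → E` and a linear map `d`. The calculus itself is the graded subalgebra `⨁ Ωⁿ` of `E`,
where `Ωⁿ = A dA ∧ ⋯ ∧ dA` is `CalculusData.forms n`. -/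
structure CalculusData (A : Type) [Ring A] [Algebra ℂ A] where
  E : Type
  [ring : Ring E]
  [algebra : Algebra ℂ E]
  ι : A →ₐ[ℂ] E
  d : E →ₗ[ℂ] E

attribute [instance] CalculusData.ring CalculusData.algebra

namespace CalculusData

variable {A : Type} [Ring A] [Algebra ℂ A]

/-- `Ωⁿ = A dA ∧ ⋯ ∧ dA` (`n` factors `dA`): the span of all `a₀ da₁ ∧ ⋯ ∧ daₙ`. -/
def forms (Γ : CalculusData A) (n : ℕ) : Submodule ℂ Γ.E :=
  Submodule.span ℂ {x | ∃ (a : A) (l : List A), l.length = n ∧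
    x = Γ.ι a * (l.map fun b => Γ.d (Γ.ι b)).prod}

/-- Restriction along an algebra map `j : B → A` (an inclusion): `Ωⁿ B = B dB ∧ ⋯ ∧ dB ⊆ Ωⁿ A`. -/
def restrict (Γ : CalculusData A) {B : Type} [Ring B] [Algebra ℂ B] (j : B →ₐ[ℂ] A) :
    CalculusData B where
  E := Γ.E
  ι := Γ.ι.comp j
  d := Γ.d

end CalculusData

/-- A differential calculus over `A`: `Ω⁰ = A` (via the injective map `ι`), the sum of the `Ωⁿ` is
direct, `d` satisfies the graded Leibniz rule and `d ∘ d = 0`. That the product and `d`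
have degrees `0` and `1` is automatic, see `mul_mem_forms` and `d_mem_forms`. -/
structure DifferentialCalculus (A : Type) [Ring A] [Algebra ℂ A] extends CalculusData A where
  ι_injective : Function.Injective ι
  independent : iSupIndep toCalculusData.forms
  leibniz : ∀ m n : ℕ, ∀ x ∈ toCalculusData.forms m, ∀ y ∈ toCalculusData.forms n,
    d (x * y) = d x * y + (-1 : ℂ) ^ m • (x * d y)
  d_d : ∀ n : ℕ, ∀ x ∈ toCalculusData.forms n, d (d x) = 0

namespace DifferentialCalculus

variable {A : Type} [Ring A] [Algebra ℂ A] (Γ : DifferentialCalculus A)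

lemma ι_mem_forms (a : A) : Γ.ι a ∈ Γ.forms 0 :=
  Submodule.subset_span ⟨a, [], rfl, by simp⟩

lemma leibniz_ι (a b : A) :
    Γ.d (Γ.ι (a * b)) = Γ.d (Γ.ι a) * Γ.ι b + Γ.ι a * Γ.d (Γ.ι b) := by
  have := Γ.leibniz 0 0 _ (Γ.ι_mem_forms a) _ (Γ.ι_mem_forms b)
  simpa using this

lemma forms_ι_mul {n : ℕ} (a : A) {x : Γ.E} (hx : x ∈ Γ.forms n) :
    Γ.ι a * x ∈ Γ.forms n := by
  induction hx using Submodule.span_induction with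
  | mem x hx =>
    obtain ⟨b, l, hl, rfl⟩ := hx
    exact Submodule.subset_span ⟨a * b, l, hl, by rw [map_mul, mul_assoc]⟩
  | zero => simp
  | add x y _ _ hx hy => rw [mul_add]; exact add_mem hx hy
  | smul c x _ hx => rw [mul_smul_comm]; exact Submodule.smul_mem _ _ hx

lemma forms_mul_d {n : ℕ} (b : A) {x : Γ.E} (hx : x ∈ Γ.forms n) :
    x * Γ.d (Γ.ι b) ∈ Γ.forms (n + 1) := by
  induction hx using Submodule.span_induction with
  | mem x hx =>
    obtain ⟨a, l, hl, rfl⟩ := hx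
    exact Submodule.subset_span ⟨a, l ++ [b], by simp [hl], by simp [mul_assoc]⟩
  | zero => simp
  | add x y _ _ hx hy => rw [add_mul]; exact add_mem hx hy
  | smul c x _ hx => rw [smul_mul_assoc]; exact Submodule.smul_mem _ _ hx

lemma forms_mul_ι {n : ℕ} (b : A) {x : Γ.E} (hx : x ∈ Γ.forms n) :
    x * Γ.ι b ∈ Γ.forms n := by
  induction hx using Submodule.span_induction with
  | mem x hx =>
    obtain ⟨a, l, hl, rfl⟩ := hx
    induction l using List.reverseRecOn generalizing n b with
    | nil =>
      simp only [List.length_nil] at hl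
      subst hl
      simpa using Γ.ι_mem_forms (a * b)
    | append_singleton l c ih =>
      have h1 : Γ.d (Γ.ι c) * Γ.ι b = Γ.d (Γ.ι (c * b)) - Γ.ι c * Γ.d (Γ.ι b) := by
        rw [Γ.leibniz_ι]; abel
      have hn : n = l.length + 1 := by simpa using hl.symm
      subst hn
      simp only [List.map_append, List.map_cons, List.map_nil, List.prod_append,
        List.prod_cons, List.prod_nil, mul_one, mul_assoc]
      rw [h1, mul_sub, mul_sub]
      refine sub_mem ?_ ?_
      · rw [← mul_assoc]
        exact Γ.forms_mul_d _ (Submodule.subset_span ⟨a, l, rfl, rfl⟩)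
      · rw [← mul_assoc, ← mul_assoc]
        have := Γ.forms_mul_d b (ih (n := l.length) c rfl)
        simpa only [mul_assoc] using this
  | zero => simp
  | add x y _ _ hx hy => rw [add_mul]; exact add_mem hx hy
  | smul c x _ hx => rw [smul_mul_assoc]; exact Submodule.smul_mem _ _ hx

lemma mul_mem_forms {m n : ℕ} {x y : Γ.E} (hx : x ∈ Γ.forms m) (hy : y ∈ Γ.forms n) :
    x * y ∈ Γ.forms (m + n) := by
  induction hy using Submodule.span_induction with
  | mem y hy =>
    obtain ⟨a, l, hl, rfl⟩ := hy
    induction l using List.reverseRecOn generalizing n with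
    | nil =>
      simp only [List.length_nil] at hl
      subst hl
      simpa using Γ.forms_mul_ι a hx
    | append_singleton l c ih =>
      have hn : n = l.length + 1 := by simpa using hl.symm
      subst hn
      have := Γ.forms_mul_d c (ih (n := l.length) rfl)
      simpa [mul_assoc, add_assoc] using this
  | zero => simp
  | add y z _ _ hy hz => rw [mul_add]; exact add_mem hy hz
  | smul c y _ hy => rw [mul_smul_comm]; exact Submodule.smul_mem _ _ hy

lemma d_ι_one : Γ.d (Γ.ι 1) = 0 := by
  have := Γ.leibniz_ι 1 1
  simpa using this

lemma prod_d_mem_forms (l : List A) :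
    (l.map fun b => Γ.d (Γ.ι b)).prod ∈ Γ.forms l.length :=
  Submodule.subset_span ⟨1, l, rfl, by simp⟩

lemma d_ι_mem_forms (a : A) : Γ.d (Γ.ι a) ∈ Γ.forms 1 := by
  simpa using Γ.prod_d_mem_forms [a]

lemma d_prod_d (l : List A) : Γ.d (l.map fun b => Γ.d (Γ.ι b)).prod = 0 := by
  induction l with
  | nil => simpa using Γ.d_ι_one
  | cons a l ih =>
    simp only [List.map_cons, List.prod_cons]
    rw [Γ.leibniz 1 l.length _ (Γ.d_ι_mem_forms a) _ (Γ.prod_d_mem_forms l), ih,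
      Γ.d_d 0 _ (Γ.ι_mem_forms a)]
    simp

lemma d_mem_forms {n : ℕ} {x : Γ.E} (hx : x ∈ Γ.forms n) : Γ.d x ∈ Γ.forms (n + 1) := by
  induction hx using Submodule.span_induction with
  | mem x hx =>
    obtain ⟨a, l, hl, rfl⟩ := hx
    rw [Γ.leibniz 0 l.length _ (Γ.ι_mem_forms a) _ (Γ.prod_d_mem_forms l), Γ.d_prod_d]
    exact Submodule.subset_span ⟨1, a :: l, by simp [hl], by simp⟩
  | zero => simp
  | add x y _ _ hx hy => rw [map_add]; exact add_mem hx hy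
  | smul c x _ hx => rw [map_smul]; exact Submodule.smul_mem _ _ hx

variable {Γ}

/-- The left action `a ω` of `A` on `Ωⁿ`. -/
def lsmul {n : ℕ} (a : A) (ω : Γ.forms n) : Γ.forms n :=
  ⟨Γ.ι a * ω, Γ.forms_ι_mul a ω.2⟩

/-- The right action `ω a` of `A` on `Ωⁿ`. -/
def rsmul {n : ℕ} (ω : Γ.forms n) (a : A) : Γ.forms n :=
  ⟨ω * Γ.ι a, Γ.forms_mul_ι a ω.2⟩

/-- The product `ω ∧ η` of forms. -/
def wedge {m n : ℕ} (ω : Γ.forms m) (η : Γ.forms n) : Γ.forms (m + n) :=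
  ⟨ω * η, Γ.mul_mem_forms ω.2 η.2⟩

/-- The differential `Ωⁿ → Ωⁿ⁺¹`. -/
def dForm {n : ℕ} (ω : Γ.forms n) : Γ.forms (n + 1) :=
  ⟨Γ.d ω, Γ.d_mem_forms ω.2⟩

variable (Γ)

/-- The differential `A → Ω¹`. -/
def dAlg (a : A) : Γ.forms 1 := ⟨Γ.d (Γ.ι a), Γ.d_ι_mem_forms a⟩

/-- A calculus has dimension `n` if `Ωⁿ ≠ 0` and `Ωᵐ = 0` for all `m > n`. -/
def HasDimension (n : ℕ) : Prop :=
  Γ.forms n ≠ ⊥ ∧ ∀ m : ℕ, n < m → Γ.forms m = ⊥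

/-- A calculus is connected if the kernel of `d` on `A` is `ℂ · 1`. -/
def IsConnected : Prop :=
  ∀ a : A, Γ.d (Γ.ι a) = 0 ↔ ∃ c : ℂ, a = c • (1 : A)

/-! ### Integral forms, divergences and integrability -/

/-- Integral `n`-forms `ℐₙ A`: the right `A`-linear maps `Ωⁿ A → A`. -/
def integralForms (n : ℕ) : Submodule ℂ (Γ.forms n →ₗ[ℂ] A) where
  carrier := {φ | ∀ (ω : Γ.forms n) (a : A), φ (rsmul ω a) = φ ω * a}
  add_mem' hφ hψ ω a := by
    simp only [Set.mem_ofPred_eq] at hφ hψ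
    simp [hφ, hψ, add_mul]
  zero_mem' ω a := by simp
  smul_mem' c φ hφ ω a := by
    simp only [Set.mem_ofPred_eq] at hφ
    simp [hφ]

variable {Γ}

/-- The bimodule structure `(a · φ · b)(ω) = a φ(b ω)` of the integral forms. -/
def integralBismul {n : ℕ} (a : A) (φ : Γ.integralForms n) (b : A) : Γ.integralForms n where
  val :=
    { toFun := fun ω => a * φ.1 (lsmul b ω)
      map_add' := fun ω η => by
        have : lsmul b (ω + η) = lsmul b ω + lsmul b η := Subtype.ext (mul_add _ _ _)
        rw [this, map_add, mul_add]
      map_smul' := fun c ω => by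
        have : lsmul b (c • ω) = c • lsmul b ω := Subtype.ext (mul_smul_comm _ _ _)
        rw [this, map_smul, mul_smul_comm]; rfl }
  property := fun ω c => by
    have : lsmul b (rsmul ω c) = rsmul (lsmul b ω) c := Subtype.ext (mul_assoc _ _ _).symm
    change a * φ.1 (lsmul b (rsmul ω c)) = a * φ.1 (lsmul b ω) * c
    rw [this, φ.2, mul_assoc]

/-- The right action of forms on integral forms, `(φ · ω)(ω') = φ(ω ∧ ω')`. -/
def integralAct {m n : ℕ} (φ : Γ.integralForms (m + n)) (ω : Γ.forms m) :
    Γ.integralForms n where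
  val :=
    { toFun := fun η => φ.1 (wedge ω η)
      map_add' := fun η ξ => by
        have : wedge ω (η + ξ) = wedge ω η + wedge ω ξ := Subtype.ext (mul_add _ _ _)
        rw [this, map_add]
      map_smul' := fun c η => by
        have : wedge ω (c • η) = c • wedge ω η := Subtype.ext (mul_smul_comm _ _ _)
        rw [this, map_smul]; rfl }
  property := fun η c => by
    have : wedge ω (rsmul η c) = rsmul (wedge ω η) c := Subtype.ext (mul_assoc _ _ _).symm
    change φ.1 (wedge ω (rsmul η c)) = φ.1 (wedge ω η) * c
    rw [this, φ.2]

variable (Γ)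

/-- A divergence: a linear map `∇ : ℐ₁ A → A` with `∇(φ · a) = ∇(φ) a + φ(da)`. -/
structure Divergence where
  toLinearMap : Γ.integralForms 1 →ₗ[ℂ] A
  leibniz : ∀ (φ : Γ.integralForms 1) (a : A),
    toLinearMap (integralBismul 1 φ a) = toLinearMap φ * a + φ.1 (Γ.dAlg a)

variable {Γ}

/-- The extension `∇ₙ : ℐₙ₊₁ A → ℐₙ A`, `∇ₙ(φ)(ω) = ∇(φ · ω) + (-1)ⁿ⁺¹ φ(dω)`. -/
def Divergence.extend (D : Γ.Divergence) (n : ℕ) (φ : Γ.integralForms (n + 1)) :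
    Γ.integralForms n where
  val :=
    { toFun := fun ω =>
        D.toLinearMap (integralAct φ ω) + (-1 : ℂ) ^ (n + 1) • φ.1 (dForm ω)
      map_add' := fun ω η => by
        have h1 : integralAct φ (ω + η) = integralAct φ ω + integralAct φ η := by
          refine Subtype.ext (LinearMap.ext fun ξ => ?_)
          have : wedge (ω + η) ξ = wedge ω ξ + wedge η ξ := Subtype.ext (add_mul _ _ _)
          change φ.1 (wedge (ω + η) ξ) = φ.1 (wedge ω ξ) + φ.1 (wedge η ξ)
          rw [this, map_add]
        have h2 : dForm (ω + η) = dForm ω + dForm η := Subtype.ext (map_add _ _ _)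
        rw [h1, h2, map_add, map_add, smul_add]
        abel
      map_smul' := fun c ω => by
        have h1 : integralAct φ (c • ω) = c • integralAct φ ω := by
          refine Subtype.ext (LinearMap.ext fun ξ => ?_)
          have : wedge (c • ω) ξ = c • wedge ω ξ := Subtype.ext (smul_mul_assoc _ _ _)
          change φ.1 (wedge (c • ω) ξ) = c • φ.1 (wedge ω ξ)
          rw [this, map_smul]
        have h2 : dForm (c • ω) = c • dForm ω := Subtype.ext (map_smul _ _ _)
        rw [h1, h2, map_smul, map_smul, smul_comm, ← smul_add]; rfl }
  property := fun ω a => by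
    have h1 : integralAct φ (rsmul ω a) = integralBismul 1 (integralAct φ ω) a := by
      refine Subtype.ext (LinearMap.ext fun ξ => ?_)
      have : wedge (rsmul ω a) ξ = wedge ω (lsmul a ξ) := Subtype.ext (mul_assoc _ _ _)
      change φ.1 (wedge (rsmul ω a) ξ) = 1 * φ.1 (wedge ω (lsmul a ξ))
      rw [this, one_mul]
    have h2 : dForm (rsmul ω a) =
        rsmul (dForm ω) a + (-1 : ℂ) ^ n • wedge ω (Γ.dAlg a) :=
      Subtype.ext (Γ.leibniz n 0 _ ω.2 _ (Γ.ι_mem_forms a))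
    have h3 : (integralAct φ ω).1 (Γ.dAlg a) = φ.1 (wedge ω (Γ.dAlg a)) := rfl
    have h4 : (-1 : ℂ) ^ (n + 1) * (-1 : ℂ) ^ n = -1 := by
      rw [← pow_add, Odd.neg_one_pow ⟨n, by ring⟩]
    change D.toLinearMap (integralAct φ (rsmul ω a)) +
        (-1 : ℂ) ^ (n + 1) • φ.1 (dForm (rsmul ω a)) =
      (D.toLinearMap (integralAct φ ω) + (-1 : ℂ) ^ (n + 1) • φ.1 (dForm ω)) * a
    rw [h1, h2, D.leibniz, h3, map_add, map_smul, φ.2, smul_add, smul_smul, h4, add_mul,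
      smul_mul_assoc, neg_one_smul]
    abel

/-- A divergence is flat if `∇ ∘ ∇₁ = 0`. -/
def Divergence.IsFlat (D : Γ.Divergence) : Prop :=
  ∀ φ : Γ.integralForms 2, D.toLinearMap (D.extend 1 φ) = 0

variable (Γ)

/-- Integrability of an `n`-dimensional calculus: there are a complex of integral forms, an
automorphism `ν` of `A` and bimodule isomorphisms `Θₖ : Ωᵏ → ^ν ℐₙ₋ₖ` (indexed here by the pairs
`(k, m)` with `k + m = n`) which intertwine `d` with the maps `∇ₘ`. The algebra `A` at the end of
the complex of integral forms is `ℐ₀`, via `φ ↦ φ(1)`, which turns `∇` into `∇₀`. -/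
def IsIntegrable (n : ℕ) : Prop :=
  Γ.HasDimension n ∧
  ∃ (D : Γ.Divergence) (ν : A ≃ₐ[ℂ] A)
    (Θ : ∀ k m : ℕ, k + m = n → (Γ.forms k ≃ₗ[ℂ] Γ.integralForms m)),
    D.IsFlat ∧
    (∀ (k m : ℕ) (h : k + m = n) (a b : A) (ω : Γ.forms k),
      Θ k m h (lsmul a (rsmul ω b)) = integralBismul (ν a) (Θ k m h ω) b) ∧
    (∀ (k m : ℕ) (h : k + 1 + m = n) (h' : k + (m + 1) = n) (ω : Γ.forms k),
      Θ (k + 1) m h (dForm ω) = D.extend m (Θ k (m + 1) h' ω))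

end DifferentialCalculus

/-! ### Gelfand-Kirillov dimension and differential smoothness -/

section Growth

variable {A : Type} [Ring A] [Algebra ℂ A]

/-- `𝒱(n)`: the span of all words of length at most `n` (including the empty word `1`) in `S`. -/
def wordSpan (S : Finset A) (n : ℕ) : Submodule ℂ A :=
  Submodule.span ℂ {x | ∃ l : List A, l.length ≤ n ∧ (∀ y ∈ l, y ∈ S) ∧ x = l.prod}

/-- `inf {ν | dim 𝒱(n) ≤ n ^ ν for n ≫ 0}`, equal to `∞` if there is no such `ν`. -/
def growthExponent (S : Finset A) : ℝ≥0∞ :=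
  sInf {r : ℝ≥0∞ | ∃ ν : ℝ≥0, r = ν ∧
    ∀ᶠ n : ℕ in Filter.atTop, (Module.finrank ℂ (wordSpan S n) : ℝ) ≤ (n : ℝ) ^ (ν : ℝ)}

variable (A)

/-- `A` is affine (finitely generated) of Gelfand-Kirillov dimension `r`, computed from any finite
generating set. -/
def IsAffineOfGKDim (r : ℝ≥0∞) : Prop :=
  Algebra.FiniteType ℂ A ∧
  ∀ S : Finset A, Algebra.adjoin ℂ (S : Set A) = ⊤ → growthExponent S = r

/-- An affine algebra of integer Gelfand-Kirillov dimension `n` is differentially smooth if it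
admits an `n`-dimensional connected integrable differential calculus. -/
def IsDifferentiallySmooth : Prop :=
  ∃ n : ℕ, IsAffineOfGKDim A n ∧
    ∃ Γ : DifferentialCalculus A, Γ.HasDimension n ∧ Γ.IsConnected ∧ Γ.IsIntegrable n

end Growth

/-! ### The quantum disc, its calculus, and the quantum cones -/

/-- The `q`-integer `[n]_q = (1 - qⁿ) / (1 - q)`, with its limit value `n` at `q = 1`. -/
def qInt (q : ℝ) (n : ℤ) : ℝ := if q = 1 then n else (1 - q ^ n) / (1 - q)

lemma qInt_zero (q : ℝ) : qInt q 0 = 0 := by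
  simp [qInt]

lemma qInt_add_one {q : ℝ} (hq : q ≠ 0) (n : ℤ) : qInt q (n + 1) = qInt q n + q ^ n := by
  unfold qInt
  split_ifs with h
  · subst h; push_cast; simp
  · have : 1 - q ≠ 0 := sub_ne_zero.mpr (Ne.symm h)
    rw [zpow_add_one₀ hq]
    field_simp
    ring

/-- Generators of the coordinate algebra of the quantum disc; `zs` stands for `z*`. -/
inductive DiscGen
  | z
  | zs

/-- The relation `z* z - q z z* = κ`. -/
inductive DiscRel (q κ : ℝ) : FreeAlgebra ℂ DiscGen → FreeAlgebra ℂ DiscGen → Prop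
  | zs_z : DiscRel q κ
      (FreeAlgebra.ι ℂ DiscGen.zs * FreeAlgebra.ι ℂ DiscGen.z)
      ((q : ℂ) • (FreeAlgebra.ι ℂ DiscGen.z * FreeAlgebra.ι ℂ DiscGen.zs) +
        algebraMap ℂ _ (κ : ℂ))

/-- The coordinate algebra `𝒪(D_{q,κ})` of the quantum disc. -/
def Disc (q κ : ℝ) : Type := RingQuot (DiscRel q κ)

instance (q κ : ℝ) : Ring (Disc q κ) := inferInstanceAs (Ring (RingQuot _))
instance (q κ : ℝ) : Algebra ℂ (Disc q κ) := inferInstanceAs (Algebra ℂ (RingQuot _))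

namespace Disc

variable (q κ : ℝ)

def z : Disc q κ := RingQuot.mkAlgHom ℂ (DiscRel q κ) (FreeAlgebra.ι ℂ DiscGen.z)
def zs : Disc q κ := RingQuot.mkAlgHom ℂ (DiscRel q κ) (FreeAlgebra.ι ℂ DiscGen.zs)

lemma zs_mul_z : zs q κ * z q κ = (q : ℂ) • (z q κ * zs q κ) + algebraMap ℂ _ (κ : ℂ) := by
  have := RingQuot.mkAlgHom_rel ℂ (DiscRel.zs_z (q := q) (κ := κ))
  rw [map_mul, map_add, map_smul, map_mul, AlgHom.commutes] at this
  exact this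

end Disc

/-- Generators of the algebra of forms on the quantum disc: `z`, `z*`, `dz`, `dz*`. -/
inductive FormGen
  | z
  | zs
  | dz
  | dzs

/-- Relations of the algebra of forms on the quantum disc: the relation of the disc and
`z dz = q⁻¹ dz z`, `z* dz = q dz z*`, `dz ∧ dz* = -q⁻¹ dz* ∧ dz`, `dz ∧ dz = 0`
together with the `*`-conjugates of these. -/
inductive FormRel (q κ : ℝ) : FreeAlgebra ℂ FormGen → FreeAlgebra ℂ FormGen → Prop
  | zs_z : FormRel q κ
      (FreeAlgebra.ι ℂ FormGen.zs * FreeAlgebra.ι ℂ FormGen.z)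
      ((q : ℂ) • (FreeAlgebra.ι ℂ FormGen.z * FreeAlgebra.ι ℂ FormGen.zs) +
        algebraMap ℂ _ (κ : ℂ))
  | z_dz : FormRel q κ
      (FreeAlgebra.ι ℂ FormGen.z * FreeAlgebra.ι ℂ FormGen.dz)
      ((q : ℂ)⁻¹ • (FreeAlgebra.ι ℂ FormGen.dz * FreeAlgebra.ι ℂ FormGen.z))
  | dzs_zs : FormRel q κ
      (FreeAlgebra.ι ℂ FormGen.dzs * FreeAlgebra.ι ℂ FormGen.zs)
      ((q : ℂ)⁻¹ • (FreeAlgebra.ι ℂ FormGen.zs * FreeAlgebra.ι ℂ FormGen.dzs))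
  | zs_dz : FormRel q κ
      (FreeAlgebra.ι ℂ FormGen.zs * FreeAlgebra.ι ℂ FormGen.dz)
      ((q : ℂ) • (FreeAlgebra.ι ℂ FormGen.dz * FreeAlgebra.ι ℂ FormGen.zs))
  | dzs_z : FormRel q κ
      (FreeAlgebra.ι ℂ FormGen.dzs * FreeAlgebra.ι ℂ FormGen.z)
      ((q : ℂ) • (FreeAlgebra.ι ℂ FormGen.z * FreeAlgebra.ι ℂ FormGen.dzs))
  | dz_dzs : FormRel q κ
      (FreeAlgebra.ι ℂ FormGen.dz * FreeAlgebra.ι ℂ FormGen.dzs)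
      (-(q : ℂ)⁻¹ • (FreeAlgebra.ι ℂ FormGen.dzs * FreeAlgebra.ι ℂ FormGen.dz))
  | dz_dz : FormRel q κ
      (FreeAlgebra.ι ℂ FormGen.dz * FreeAlgebra.ι ℂ FormGen.dz) 0
  | dzs_dzs : FormRel q κ
      (FreeAlgebra.ι ℂ FormGen.dzs * FreeAlgebra.ι ℂ FormGen.dzs) 0

/-- The algebra underlying the differential calculus `Ω(D_{q,κ})` on the quantum disc. -/
def DiscForms (q κ : ℝ) : Type := RingQuot (FormRel q κ)

instance (q κ : ℝ) : Ring (DiscForms q κ) := inferInstanceAs (Ring (RingQuot _))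
instance (q κ : ℝ) : Algebra ℂ (DiscForms q κ) := inferInstanceAs (Algebra ℂ (RingQuot _))

namespace DiscForms

variable (q κ : ℝ)

/-- The quotient map, sending each generator to its class. -/
def gen (x : FormGen) : DiscForms q κ :=
  RingQuot.mkAlgHom ℂ (FormRel q κ) (FreeAlgebra.ι ℂ x)

abbrev z : DiscForms q κ := gen q κ FormGen.z
abbrev zs : DiscForms q κ := gen q κ FormGen.zs
abbrev dz : DiscForms q κ := gen q κ FormGen.dz
abbrev dzs : DiscForms q κ := gen q κ FormGen.dzs

lemma zs_mul_z : zs q κ * z q κ = (q : ℂ) • (z q κ * zs q κ) + algebraMap ℂ _ (κ : ℂ) := by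
  have := RingQuot.mkAlgHom_rel ℂ (FormRel.zs_z (q := q) (κ := κ))
  rw [map_mul, map_add, map_smul, map_mul, AlgHom.commutes] at this
  exact this

lemma z_mul_dz : z q κ * dz q κ = (q : ℂ)⁻¹ • (dz q κ * z q κ) := by
  have := RingQuot.mkAlgHom_rel ℂ (FormRel.z_dz (q := q) (κ := κ))
  rw [map_mul, map_smul, map_mul] at this
  exact this

lemma dzs_mul_zs : dzs q κ * zs q κ = (q : ℂ)⁻¹ • (zs q κ * dzs q κ) := by
  have := RingQuot.mkAlgHom_rel ℂ (FormRel.dzs_zs (q := q) (κ := κ))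
  rw [map_mul, map_smul, map_mul] at this
  exact this

lemma zs_mul_dz : zs q κ * dz q κ = (q : ℂ) • (dz q κ * zs q κ) := by
  have := RingQuot.mkAlgHom_rel ℂ (FormRel.zs_dz (q := q) (κ := κ))
  rw [map_mul, map_smul, map_mul] at this
  exact this

lemma dzs_mul_z : dzs q κ * z q κ = (q : ℂ) • (z q κ * dzs q κ) := by
  have := RingQuot.mkAlgHom_rel ℂ (FormRel.dzs_z (q := q) (κ := κ))
  rw [map_mul, map_smul, map_mul] at this
  exact this

lemma dz_mul_dzs : dz q κ * dzs q κ = -(q : ℂ)⁻¹ • (dzs q κ * dz q κ) := by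
  have := RingQuot.mkAlgHom_rel ℂ (FormRel.dz_dzs (q := q) (κ := κ))
  rw [map_mul, map_smul, map_mul] at this
  exact this

lemma dz_mul_dz : dz q κ * dz q κ = 0 := by
  have := RingQuot.mkAlgHom_rel ℂ (FormRel.dz_dz (q := q) (κ := κ))
  rw [map_mul, map_zero] at this
  exact this

lemma dzs_mul_dzs : dzs q κ * dzs q κ = 0 := by
  have := RingQuot.mkAlgHom_rel ℂ (FormRel.dzs_dzs (q := q) (κ := κ))
  rw [map_mul, map_zero] at this
  exact this

/-- Values of `leibnizHom` on generators. -/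
def leibnizGen : FormGen → Matrix (Fin 2) (Fin 2) (DiscForms q κ)
  | FormGen.z => !![z q κ, dz q κ; 0, z q κ]
  | FormGen.zs => !![zs q κ, dzs q κ; 0, zs q κ]
  | FormGen.dz => !![-dz q κ, 0; 0, dz q κ]
  | FormGen.dzs => !![-dzs q κ, 0; 0, dzs q κ]

variable {q}

/-- The algebra map `x ↦ !![±x, dx; 0, x]` (with `±x = (-1)ⁿ x` for an `n`-form `x`). That it is
multiplicative is the graded Leibniz rule for its upper right entry. -/
def leibnizHom (hq : 0 < q) : DiscForms q κ →ₐ[ℂ] Matrix (Fin 2) (Fin 2) (DiscForms q κ) :=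
  RingQuot.liftAlgHom ℂ ⟨FreeAlgebra.lift ℂ (leibnizGen q κ), by
    have hq' : (q : ℂ) ≠ 0 := by exact_mod_cast hq.ne'
    intro x y h
    cases h <;>
    simp only [map_mul, map_add, map_smul, map_zero, FreeAlgebra.lift_ι_apply, leibnizGen,
      AlgHom.commutes] <;>
    ext i j <;> fin_cases i <;> fin_cases j <;>
    simp [Matrix.mul_apply, Fin.sum_univ_two, Matrix.algebraMap_matrix_apply, zs_mul_z, z_mul_dz,
      dzs_mul_zs, zs_mul_dz, dzs_mul_z, dz_mul_dzs, dz_mul_dz, dzs_mul_dzs, smul_smul, hq',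
      add_comm]⟩

/-- The differential on the forms of the quantum disc: `z ↦ dz`, `z* ↦ dz*`, `dz ↦ 0`, `dz* ↦ 0`,
extended by the graded Leibniz rule. -/
def d (hq : 0 < q) : DiscForms q κ →ₗ[ℂ] DiscForms q κ where
  toFun x := leibnizHom κ hq x 0 1
  map_add' x y := by simp
  map_smul' c x := by simp

lemma leibnizHom_gen (hq : 0 < q) (x : FormGen) :
    leibnizHom κ hq (gen q κ x) = leibnizGen q κ x := by
  unfold leibnizHom gen
  erw [RingQuot.liftAlgHom_mkAlgHom_apply]
  simp

lemma d_z (hq : 0 < q) : d κ hq (z q κ) = dz q κ := by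
  simp [d, leibnizHom_gen, leibnizGen]

lemma d_zs (hq : 0 < q) : d κ hq (zs q κ) = dzs q κ := by
  simp [d, leibnizHom_gen, leibnizGen]

variable (q)

/-- The map `𝒪(D_{q,κ}) → Ω(D_{q,κ})`. -/
def ofDisc : Disc q κ →ₐ[ℂ] DiscForms q κ :=
  RingQuot.liftAlgHom ℂ ⟨FreeAlgebra.lift ℂ (fun
    | DiscGen.z => z q κ
    | DiscGen.zs => zs q κ), by
    intro x y h
    cases h
    simp only [map_mul, map_add, map_smul, FreeAlgebra.lift_ι_apply, AlgHom.commutes]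
    exact zs_mul_z q κ⟩

end DiscForms

/-- The calculus `Ω(D_{q,κ})` on the quantum disc. -/
def discCalculus {q : ℝ} (κ : ℝ) (hq : 0 < q) : CalculusData (Disc q κ) where
  E := DiscForms q κ
  ι := DiscForms.ofDisc q κ
  d := DiscForms.d κ hq

/-- Generators of the coordinate algebra of the quantum cone; `bs` stands for `b*`. -/
inductive ConeGen
  | a
  | b
  | bs

/-- The relations of the quantum cone: `a b = q^N b a + κ [N]_q b` with its `*`-conjugate,
`b b* = ∏_{l=0}^{N-1} (q^{-l} a + κ [-l]_q)` and `b* b = ∏_{l=1}^{N} (q^l a + κ [l]_q)`. -/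
inductive ConeRel (N : ℕ) (q κ : ℝ) : FreeAlgebra ℂ ConeGen → FreeAlgebra ℂ ConeGen → Prop
  | a_b : ConeRel N q κ
      (FreeAlgebra.ι ℂ ConeGen.a * FreeAlgebra.ι ℂ ConeGen.b)
      ((q : ℂ) ^ N • (FreeAlgebra.ι ℂ ConeGen.b * FreeAlgebra.ι ℂ ConeGen.a) +
        ((κ * qInt q N : ℝ) : ℂ) • FreeAlgebra.ι ℂ ConeGen.b)
  | bs_a : ConeRel N q κ
      (FreeAlgebra.ι ℂ ConeGen.bs * FreeAlgebra.ι ℂ ConeGen.a)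
      ((q : ℂ) ^ N • (FreeAlgebra.ι ℂ ConeGen.a * FreeAlgebra.ι ℂ ConeGen.bs) +
        ((κ * qInt q N : ℝ) : ℂ) • FreeAlgebra.ι ℂ ConeGen.bs)
  | b_bs : ConeRel N q κ
      (FreeAlgebra.ι ℂ ConeGen.b * FreeAlgebra.ι ℂ ConeGen.bs)
      ((List.range N).map fun l : ℕ =>
        (q : ℂ) ^ (-(l : ℤ)) • FreeAlgebra.ι ℂ ConeGen.a +
          algebraMap ℂ (FreeAlgebra ℂ ConeGen) ((κ * qInt q (-(l : ℤ)) : ℝ) : ℂ)).prod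
  | bs_b : ConeRel N q κ
      (FreeAlgebra.ι ℂ ConeGen.bs * FreeAlgebra.ι ℂ ConeGen.b)
      ((List.range N).map fun l : ℕ =>
        (q : ℂ) ^ (l + 1) • FreeAlgebra.ι ℂ ConeGen.a +
          algebraMap ℂ (FreeAlgebra ℂ ConeGen) ((κ * qInt q ((l : ℤ) + 1) : ℝ) : ℂ)).prod

/-- The coordinate algebra `𝒪(C^N_{q,κ})` of the quantum cone. -/
def Cone (N : ℕ) (q κ : ℝ) : Type := RingQuot (ConeRel N q κ)

instance (N : ℕ) (q κ : ℝ) : Ring (Cone N q κ) := inferInstanceAs (Ring (RingQuot _))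
instance (N : ℕ) (q κ : ℝ) : Algebra ℂ (Cone N q κ) := inferInstanceAs (Algebra ℂ (RingQuot _))

namespace Disc

variable (q κ : ℝ)

/-- The element `q^n z z* + κ [n]_q` of the quantum disc. -/
def shift (n : ℤ) : Disc q κ :=
  (q : ℂ) ^ n • (z q κ * zs q κ) + algebraMap ℂ _ ((κ * qInt q n : ℝ) : ℂ)

variable {q}

lemma shift_zero : shift q κ 0 = z q κ * zs q κ := by
  simp [shift, qInt_zero]

lemma shift_one (hq : 0 < q) : shift q κ 1 = zs q κ * z q κ := by
  have h := qInt_add_one hq.ne' 0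
  rw [qInt_zero, zpow_zero, zero_add, zero_add] at h
  simp [shift, h, zs_mul_z]

lemma shift_mul_z (hq : 0 < q) (n : ℤ) :
    shift q κ n * z q κ = z q κ * shift q κ (n + 1) := by
  have hq' : (q : ℂ) ≠ 0 := by exact_mod_cast hq.ne'
  unfold shift
  rw [qInt_add_one hq.ne', zpow_add_one₀ hq', add_mul, mul_add, smul_mul_assoc, mul_assoc,
    zs_mul_z]
  simp only [Algebra.algebraMap_eq_smul_one, smul_mul_assoc, mul_smul_comm, one_mul, mul_one,
    mul_add]
  push_cast
  module

lemma zs_mul_shift (hq : 0 < q) (n : ℤ) :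
    zs q κ * shift q κ n = shift q κ (n + 1) * zs q κ := by
  have hq' : (q : ℂ) ≠ 0 := by exact_mod_cast hq.ne'
  unfold shift
  rw [qInt_add_one hq.ne', zpow_add_one₀ hq', add_mul, mul_add, mul_smul_comm, ← mul_assoc,
    zs_mul_z]
  simp only [Algebra.algebraMap_eq_smul_one, smul_mul_assoc, mul_smul_comm, one_mul, mul_one,
    add_mul]
  push_cast
  module

lemma shift_mul_z_pow (hq : 0 < q) (n : ℤ) (N : ℕ) :
    shift q κ n * z q κ ^ N = z q κ ^ N * shift q κ (n + N) := by
  induction N with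
  | zero => simp
  | succ N ih =>
    rw [pow_succ, ← mul_assoc, ih, mul_assoc, shift_mul_z κ hq, ← mul_assoc]
    push_cast
    rw [add_assoc]

lemma zs_pow_mul_shift (hq : 0 < q) (n : ℤ) (N : ℕ) :
    zs q κ ^ N * shift q κ n = shift q κ (n + N) * zs q κ ^ N := by
  induction N with
  | zero => simp
  | succ N ih =>
    rw [pow_succ', mul_assoc, ih, ← mul_assoc, zs_mul_shift κ hq, mul_assoc]
    push_cast
    rw [add_assoc]

lemma z_pow_mul_zs_pow (hq : 0 < q) (N : ℕ) :
    z q κ ^ N * zs q κ ^ N = ((List.range N).map fun l : ℕ => shift q κ (-(l : ℤ))).prod := by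
  induction N with
  | zero => simp
  | succ N ih =>
    have h := zs_pow_mul_shift κ hq (-(N : ℤ)) N
    rw [neg_add_cancel, shift_zero] at h
    rw [List.range_succ, List.map_append, List.prod_append, ← ih, pow_succ, pow_succ', mul_assoc,
      ← mul_assoc (z q κ), ← h]
    simp [mul_assoc]

lemma zs_pow_mul_z_pow (hq : 0 < q) (N : ℕ) :
    zs q κ ^ N * z q κ ^ N = ((List.range N).map fun l : ℕ => shift q κ ((l : ℤ) + 1)).prod := by
  induction N with
  | zero => simp
  | succ N ih =>
    have h := shift_mul_z_pow κ hq 1 N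
    rw [shift_one κ hq] at h
    rw [List.range_succ, List.map_append, List.prod_append, ← ih, pow_succ, pow_succ', mul_assoc,
      ← mul_assoc (zs q κ), h]
    simp [mul_assoc, add_comm]

end Disc

/-- The `*`-inclusion `𝒪(C^N_{q,κ}) → 𝒪(D_{q,κ})`, `a ↦ z z*`, `b ↦ z^N`, `b* ↦ z*^N`. -/
def coneToDisc (N : ℕ) {q : ℝ} (κ : ℝ) (hq : 0 < q) : Cone N q κ →ₐ[ℂ] Disc q κ :=
  RingQuot.liftAlgHom ℂ ⟨FreeAlgebra.lift ℂ (fun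
    | ConeGen.a => Disc.z q κ * Disc.zs q κ
    | ConeGen.b => Disc.z q κ ^ N
    | ConeGen.bs => Disc.zs q κ ^ N), by
    intro x y h
    cases h
    · have h := Disc.shift_mul_z_pow κ hq 0 N
      rw [Disc.shift_zero] at h
      simp only [map_mul, map_add, map_smul, FreeAlgebra.lift_ι_apply]
      rw [h]
      simp [Disc.shift, mul_add, Algebra.algebraMap_eq_smul_one]
    · have h := Disc.zs_pow_mul_shift κ hq 0 N
      rw [Disc.shift_zero] at h
      simp only [map_mul, map_add, map_smul, FreeAlgebra.lift_ι_apply]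
      rw [h]
      simp [Disc.shift, add_mul, Algebra.algebraMap_eq_smul_one, mul_assoc]
    · rw [map_mul, FreeAlgebra.lift_ι_apply, FreeAlgebra.lift_ι_apply,
        Disc.z_pow_mul_zs_pow κ hq, map_list_prod, List.map_map]
      congr 2
      funext l
      simp only [Function.comp_apply, map_add, map_smul, AlgHom.commutes,
        FreeAlgebra.lift_ι_apply, Disc.shift]
    · rw [map_mul, FreeAlgebra.lift_ι_apply, FreeAlgebra.lift_ι_apply,
        Disc.zs_pow_mul_z_pow κ hq, map_list_prod, List.map_map]
      congr 2
      funext l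
      simp only [Function.comp_apply, map_add, map_smul, AlgHom.commutes,
        FreeAlgebra.lift_ι_apply, Disc.shift]
      norm_cast⟩

/-- The calculus `Ω(C^N_{q,κ})`: the restriction of `Ω(D_{q,κ})` to the quantum cone algebra. -/
def coneCalculus (N : ℕ) {q : ℝ} (κ : ℝ) (hq : 0 < q) : CalculusData (Cone N q κ) :=
  (discCalculus κ hq).restrict (coneToDisc N κ hq)

end QuantumCone

end

/-
The cone is the algebra of invariants of the disc for the `N`-th roots of unity acting by
`z ↦ u z`, and `Ω(D)` is free over the disc on `1`, `dz`, `dz*`, `dz ∧ dz*`. The key point is that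
`Ω(C)` is the whole space of invariant forms in positive degree as well. The normal element
`w = z* z - z z* = (q - 1) z z* + κ` and the products `z^m z*^m` are polynomials in `z z*` which are
coprime because `κ ≠ 0`. The resulting partitions of unity generate `Ω¹(C)` and `Ω²(C)` from the
invariant forms `dz w z*`, `dz z^(N-1)` and their conjugates, and make the grading of the disc by
`ℤ/N` strong.

Writing `w df` in terms of the commutators `[z*, f]` and `[f, z]` shows that the kernel of `d` is
central, hence scalar. Since `Ω²(C)` is free of rank one on the two-form `dz ∧ dz*`, up to a
twist, and the strong grading makes the pairing `Ω¹ × Ω¹ → Ω²` perfect, every right linear map into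
the algebra is the wedge product with a form, and `d` itself becomes a flat divergence. Growth is
read off the monomials `z^i z*^j` from above and `a^i b^k` from below.
-/

noncomputable section

namespace QuantumCone

open Polynomial

/-! ### Algebras given by generators and relations -/

section Adjoin

variable {R A : Type*} [CommSemiring R]

lemma adjoin_range_mkAlgHom_ι {X : Type*} (r : FreeAlgebra R X → FreeAlgebra R X → Prop) :
    Algebra.adjoin R (Set.range fun x => RingQuot.mkAlgHom R r (FreeAlgebra.ι R x)) = ⊤ := by
  rw [Set.range_comp' (RingQuot.mkAlgHom R r), ← AlgHom.map_adjoin,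
    FreeAlgebra.adjoin_range_ι, Algebra.map_top,
    (AlgHom.range_eq_top _).2 (RingQuot.mkAlgHom_surjective R r)]

variable [Semiring A] [Algebra R A] {s : Set A}

lemma induction_of_adjoin_eq_top (hs : Algebra.adjoin R s = ⊤) {motive : A → Prop}
    (mem : ∀ x ∈ s, motive x) (algebraMap : ∀ c, motive (algebraMap R A c))
    (add : ∀ x y, motive x → motive y → motive (x + y))
    (mul : ∀ x y, motive x → motive y → motive (x * y)) (x : A) : motive x :=
  Algebra.adjoin_induction mem algebraMap (fun x y _ _ => add x y) (fun x y _ _ => mul x y)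
    (hs ▸ Algebra.mem_top : x ∈ Algebra.adjoin R s)

lemma submodule_eq_top_of_mul_mem (hs : Algebra.adjoin R s = ⊤) {M : Submodule R A}
    (one_mem : 1 ∈ M) (mul_mem : ∀ x ∈ s, ∀ y ∈ M, x * y ∈ M) : M = ⊤ := by
  have stable (x : A) : ∀ y ∈ M, x * y ∈ M := by
    induction x using induction_of_adjoin_eq_top hs with
    | mem x hx => exact mul_mem x hx
    | algebraMap c => exact fun y hy => by simpa [← Algebra.smul_def] using M.smul_mem c hy
    | add x x' hx hx' => exact fun y hy => add_mul x x' y ▸ M.add_mem (hx y hy) (hx' y hy)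
    | mul x x' hx hx' => exact fun y hy => mul_assoc x x' y ▸ hx _ (hx' y hy)
  exact eq_top_iff.2 fun x _ => mul_one x ▸ stable x 1 one_mem

end Adjoin

/-! ### Normal forms in algebras with a weight decomposition -/

/-- `b ^ k` for `k ≥ 0` and `b' ^ (-k)` for `k < 0`: in a `ℤ`-graded algebra, the monomial of
degree `k` in elements `b` and `b'` of degrees `1` and `-1`. -/
def signedPow {A : Type*} [Monoid A] (b b' : A) : ℤ → A
  | Int.ofNat n => b ^ n
  | Int.negSucc n => b' ^ (n + 1)

section SignedPow

variable {A : Type*} [Monoid A] (b b' : A)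

lemma signedPow_natCast (n : ℕ) : signedPow b b' n = b ^ n := rfl

lemma signedPow_negSucc (n : ℕ) : signedPow b b' (Int.negSucc n) = b' ^ (n + 1) := rfl

@[simp] lemma signedPow_zero : signedPow b b' 0 = 1 := pow_zero b

lemma signedPow_neg_natCast (n : ℕ) : signedPow b b' (-(n : ℤ)) = b' ^ n := by
  cases n with
  | zero => simp
  | succ n => exact signedPow_negSucc b b' n

@[simp] lemma signedPow_one : signedPow b b' 1 = b := pow_one b

@[simp] lemma signedPow_neg_one : signedPow b b' (-1) = b' := pow_one b'

lemma signedPow_pow (N : ℕ) (k : ℤ) :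
    signedPow (b ^ N) (b' ^ N) k = signedPow b b' (N * k) := by
  obtain ⟨n, rfl | rfl⟩ := k.eq_nat_or_neg
  · rw [signedPow_natCast, ← pow_mul, ← Nat.cast_mul, signedPow_natCast]
  · rw [signedPow_neg_natCast, ← pow_mul, mul_neg, ← Nat.cast_mul, signedPow_neg_natCast]

lemma map_signedPow {C F : Type*} [Monoid C] [FunLike F A C] [MonoidHomClass F A C] (φ : F)
    (k : ℤ) : φ (signedPow b b' k) = signedPow (φ b) (φ b') k := by
  cases k <;> simp [signedPow]

end SignedPow

section NormalForm

variable {A : Type*} [Ring A] [Algebra ℂ A]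

/-- The linear map sending a family `(pₖ)` of polynomials to `∑ₖ pₖ(a) bₖ`, where `bₖ` is the
signed power of `b` and `b'`. -/
def normalForm (a b b' : A) : (ℤ →₀ ℂ[X]) →ₗ[ℂ] A :=
  Finsupp.lsum ℂ fun k => LinearMap.mulRight ℂ (signedPow b b' k) ∘ₗ (aeval a).toLinearMap

@[simp] lemma normalForm_single (a b b' : A) (k : ℤ) (p : ℂ[X]) :
    normalForm a b b' (Finsupp.single k p) = aeval a p * signedPow b b' k := by
  simp [normalForm]

lemma aeval_mul_signedPow_mem_range_normalForm (a b b' : A) (k : ℤ) (p : ℂ[X]) :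
    aeval a p * signedPow b b' k ∈ LinearMap.range (normalForm a b b') :=
  ⟨Finsupp.single k p, normalForm_single a b b' k p⟩

lemma mul_aeval_of_mul_eq {a b : A} {u : ℂ[X]} (h : b * a = aeval a u * b) (p : ℂ[X]) :
    b * aeval a p = aeval a (p.comp u) * b := by
  have hpow (n : ℕ) : b * a ^ n = aeval a u ^ n * b :=
    ((show SemiconjBy b a (aeval a u) from h).pow_right n).eq
  induction p using Polynomial.induction_on' with
  | add p r hp hr => simp only [map_add, add_comp, mul_add, add_mul, hp, hr]
  | monomial n c => simp [aeval_monomial, monomial_comp, Algebra.algebraMap_eq_smul_one, hpow]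

lemma mul_mem_range_normalForm {a b b' x y : A}
    (hx : ∀ (k : ℤ) (p : ℂ[X]),
      x * (aeval a p * signedPow b b' k) ∈ LinearMap.range (normalForm a b b'))
    (hy : y ∈ LinearMap.range (normalForm a b b')) :
    x * y ∈ LinearMap.range (normalForm a b b') := by
  obtain ⟨t, rfl⟩ := hy
  induction t using Finsupp.induction_linear with
  | zero => simp
  | add f g hf hg => rw [map_add, mul_add]; exact add_mem hf hg
  | single k p => rw [normalForm_single]; exact hx k p

lemma mul_aeval_mul_signedPow_mem_range_normalForm {a b b' : A} {u r : ℂ[X]}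
    (hu : b * a = aeval a u * b) (hr : b * b' = aeval a r) (k : ℤ) (p : ℂ[X]) :
    b * (aeval a p * signedPow b b' k) ∈ LinearMap.range (normalForm a b b') := by
  rw [← mul_assoc, mul_aeval_of_mul_eq hu, mul_assoc]
  rcases k with n | n
  · rw [Int.ofNat_eq_natCast, signedPow_natCast, ← pow_succ', ← signedPow_natCast b b']
    exact aeval_mul_signedPow_mem_range_normalForm a b b' _ _
  · rw [signedPow_negSucc, pow_succ', ← mul_assoc b, hr, ← mul_assoc, ← map_mul]
    rcases n with - | n
    · simpa using aeval_mul_signedPow_mem_range_normalForm a b b' 0 (p.comp u * r)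
    · exact aeval_mul_signedPow_mem_range_normalForm a b b' (Int.negSucc n) _

lemma mul_aeval_mul_signedPow_mem_range_normalForm_left {a b b' : A} {v s : ℂ[X]}
    (hv : b' * a = aeval a v * b') (hs : b' * b = aeval a s) (k : ℤ) (p : ℂ[X]) :
    b' * (aeval a p * signedPow b b' k) ∈ LinearMap.range (normalForm a b b') := by
  rw [← mul_assoc, mul_aeval_of_mul_eq hv, mul_assoc]
  rcases k with (- | n) | n
  · have := aeval_mul_signedPow_mem_range_normalForm a b b' (Int.negSucc 0) (p.comp v)
    rw [signedPow_negSucc, pow_one] at this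
    simpa using this
  · rw [Int.ofNat_eq_natCast, signedPow_natCast, pow_succ', ← mul_assoc b', hs, ← mul_assoc,
      ← map_mul]
    exact aeval_mul_signedPow_mem_range_normalForm a b b' (n : ℤ) _
  · rw [signedPow_negSucc, ← pow_succ', ← signedPow_negSucc b b']
    exact aeval_mul_signedPow_mem_range_normalForm a b b' _ _

lemma normalForm_surjective {a b b' : A} {u v r s : ℂ[X]} (hu : b * a = aeval a u * b)
    (hv : b' * a = aeval a v * b') (hr : b * b' = aeval a r) (hs : b' * b = aeval a s)
    (hgen : Algebra.adjoin ℂ {a, b, b'} = ⊤) :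
    Function.Surjective (normalForm a b b') := by
  refine LinearMap.range_eq_top.1 (submodule_eq_top_of_mul_mem hgen ?_ ?_)
  · simpa using aeval_mul_signedPow_mem_range_normalForm a b b' 0 1
  · rintro x hx y hy
    refine mul_mem_range_normalForm (fun k p => ?_) hy
    obtain rfl | rfl | rfl := hx
    · rw [← mul_assoc, show x * aeval x p = aeval x (X * p) by rw [map_mul, aeval_X]]
      exact aeval_mul_signedPow_mem_range_normalForm x b b' k _
    · exact mul_aeval_mul_signedPow_mem_range_normalForm hu hr k p
    · exact mul_aeval_mul_signedPow_mem_range_normalForm_left hv hs k p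

end NormalForm

/-! ### `q`-integers -/

section QInt

variable {q : ℝ}

lemma qInt_one (hq : q ≠ 0) : qInt q 1 = 1 := by
  simpa [qInt_zero] using qInt_add_one hq 0

lemma zpow_sub_one_eq_mul_qInt (n : ℤ) : q ^ n - 1 = (q - 1) * qInt q n := by
  unfold qInt
  split_ifs with h
  · simp [h]
  · have : 1 - q ≠ 0 := sub_ne_zero.2 (Ne.symm h)
    field_simp
    ring

lemma qInt_add (hq : q ≠ 0) (m n : ℤ) : qInt q (m + n) = q ^ m * qInt q n + qInt q m := by
  unfold qInt
  split_ifs with h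
  · simp [h, add_comm]
  · have : 1 - q ≠ 0 := sub_ne_zero.2 (Ne.symm h)
    rw [zpow_add₀ hq]
    field_simp
    ring

lemma qInt_injective (hq : 0 < q) : Function.Injective (qInt q) := by
  intro m n h
  unfold qInt at h
  split_ifs at h with h1
  · exact_mod_cast h
  · exact zpow_right_injective₀ hq h1 (by
      linarith [(div_left_inj' (sub_ne_zero.2 (Ne.symm h1))).1 h])

end QInt

/-! ### The quantum disc algebra -/

namespace Disc

variable {q κ : ℝ}

section Lift

variable {C : Type*} [Ring C] [Algebra ℂ C] (u v : C)

/-- The universal property of the quantum disc algebra. -/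
def lift (h : v * u = (q : ℂ) • (u * v) + algebraMap ℂ C (κ : ℂ)) : Disc q κ →ₐ[ℂ] C :=
  RingQuot.liftAlgHom ℂ ⟨FreeAlgebra.lift ℂ (fun
    | DiscGen.z => u
    | DiscGen.zs => v), by
    rintro _ _ ⟨⟩
    simpa only [map_mul, map_add, map_smul, FreeAlgebra.lift_ι_apply, AlgHom.commutes] using h⟩

variable (h : v * u = (q : ℂ) • (u * v) + algebraMap ℂ C (κ : ℂ))

@[simp] lemma lift_z : lift u v h (z q κ) = u :=
  (RingQuot.liftAlgHom_mkAlgHom_apply ..).trans (FreeAlgebra.lift_ι_apply ..)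

@[simp] lemma lift_zs : lift u v h (zs q κ) = v :=
  (RingQuot.liftAlgHom_mkAlgHom_apply ..).trans (FreeAlgebra.lift_ι_apply ..)

end Lift

variable (q κ) in
lemma adjoin_eq_top : Algebra.adjoin ℂ {z q κ, zs q κ} = ⊤ := by
  refine top_le_iff.1 ((adjoin_range_mkAlgHom_ι (DiscRel q κ)).ge.trans (Algebra.adjoin_mono ?_))
  rintro _ ⟨_ | _, rfl⟩
  exacts [Or.inl rfl, Or.inr rfl]

lemma induction_on {motive : Disc q κ → Prop} (f : Disc q κ) (z : motive (z q κ))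
    (zs : motive (zs q κ)) (algebraMap : ∀ c, motive (algebraMap ℂ _ c))
    (add : ∀ f g, motive f → motive g → motive (f + g))
    (mul : ∀ f g, motive f → motive g → motive (f * g)) : motive f :=
  induction_of_adjoin_eq_top (adjoin_eq_top q κ) (by rintro _ (rfl | rfl) <;> assumption)
    algebraMap add mul f

lemma algHom_ext {C : Type*} [Semiring C] [Algebra ℂ C] {F G : Disc q κ →ₐ[ℂ] C}
    (hz : F (z q κ) = G (z q κ)) (hzs : F (zs q κ) = G (zs q κ)) : F = G :=
  AlgHom.ext_of_adjoin_eq_top (adjoin_eq_top q κ) (by rintro _ (rfl | rfl) <;> assumption)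

variable (q κ) in
/-- The element `x = z z*`. -/
def x : Disc q κ := z q κ * zs q κ

variable (q κ) in
/-- The polynomial `q^n X + κ [n]_q`, whose value at `x` is `shift q κ n`. -/
def shiftPoly (n : ℤ) : ℂ[X] := C ((q : ℂ) ^ n) * X + C ((κ * qInt q n : ℝ) : ℂ)

lemma aeval_shiftPoly (n : ℤ) : aeval (x q κ) (shiftPoly q κ n) = shift q κ n := by
  simp [shiftPoly, shift, x, Algebra.smul_def]

@[simp] lemma shiftPoly_zero : shiftPoly q κ 0 = X := by
  simp [shiftPoly, qInt_zero]

lemma shiftPoly_one_add (hq : q ≠ 0) (n : ℤ) :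
    shiftPoly q κ (1 + n) = (q : ℂ) • shiftPoly q κ n + C (κ : ℂ) := by
  simp only [shiftPoly, qInt_add hq, qInt_one hq, zpow_add₀ (Complex.ofReal_ne_zero.2 hq),
    zpow_one, smul_eq_C_mul]
  push_cast
  simp only [C_mul, C_add, C_1]
  ring

lemma shiftPoly_ne_zero (hq : q ≠ 0) (n : ℤ) : shiftPoly q κ n ≠ 0 := by
  intro h
  have : (q : ℂ) ^ n = 0 := by simpa [shiftPoly] using congrArg (coeff · 1) h
  exact zpow_ne_zero n (Complex.ofReal_ne_zero.2 hq) this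

lemma signedPow_mul_x (hq : 0 < q) (k : ℤ) :
    signedPow (z q κ) (zs q κ) k * x q κ =
      aeval (x q κ) (shiftPoly q κ (-k)) * signedPow (z q κ) (zs q κ) k := by
  rw [aeval_shiftPoly, x, ← shift_zero]
  obtain ⟨n, rfl | rfl⟩ := k.eq_nat_or_neg
  · rw [signedPow_natCast, shift_mul_z_pow κ hq, neg_add_cancel]
  · rw [signedPow_neg_natCast, zs_pow_mul_shift κ hq, neg_neg, zero_add]

lemma z_mul_x (hq : 0 < q) : z q κ * x q κ = aeval (x q κ) (shiftPoly q κ (-1)) * z q κ := by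
  simpa using signedPow_mul_x hq 1

lemma zs_mul_x (hq : 0 < q) : zs q κ * x q κ = aeval (x q κ) (shiftPoly q κ 1) * zs q κ := by
  simpa using signedPow_mul_x hq (-1)

lemma zs_mul_z_eq_aeval (hq : 0 < q) : zs q κ * z q κ = aeval (x q κ) (shiftPoly q κ 1) := by
  rw [aeval_shiftPoly, shift_one κ hq]

variable (q κ) in
/-- The normal form map `(pₖ) ↦ ∑ₖ pₖ(x) zₖ` of the quantum disc. -/
abbrev nf : (ℤ →₀ ℂ[X]) →ₗ[ℂ] Disc q κ := normalForm (x q κ) (z q κ) (zs q κ)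

lemma nf_surjective (hq : 0 < q) : Function.Surjective (nf q κ) := by
  refine normalForm_surjective (z_mul_x hq) (zs_mul_x hq) (r := X) (by simp [x])
    (zs_mul_z_eq_aeval hq) (top_le_iff.1 ?_)
  rw [← adjoin_eq_top q κ]
  exact Algebra.adjoin_mono (Set.subset_insert _ _)

/-! ### Linear independence of the normal form -/

/-- The universal weight representation of the disc on sequences of polynomials: `z` is the shift
`(f n) ↦ (f (n + 1))`, `z*` the weighted shift `(f n) ↦ (S₁₋ₙ f (n - 1))`, where `Sₙ` is
`shiftPoly q κ n`. At index `0` the element `x` acts as multiplication by `X`. -/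
def rep (κ : ℝ) (hq : q ≠ 0) : Disc q κ →ₐ[ℂ] Module.End ℂ (ℤ → ℂ[X]) :=
  lift (LinearMap.pi fun n => LinearMap.proj (n + 1))
    (LinearMap.pi fun n => LinearMap.mulLeft ℂ (shiftPoly q κ (1 - n)) ∘ₗ LinearMap.proj (n - 1))
    (LinearMap.ext fun f => funext fun n => by
      have h := shiftPoly_one_add (κ := κ) hq (-n)
      rw [← sub_eq_add_neg] at h
      simp [h, add_mul, ← smul_eq_C_mul])

section Rep

variable (hq : q ≠ 0) (f : ℤ → ℂ[X])

lemma rep_z_apply (n : ℤ) : rep κ hq (z q κ) f n = f (n + 1) := by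
  simp [rep]

lemma rep_zs_apply (n : ℤ) : rep κ hq (zs q κ) f n = shiftPoly q κ (1 - n) * f (n - 1) := by
  simp [rep]

lemma rep_z_pow_apply_zero (m : ℕ) : rep κ hq (z q κ ^ m) f 0 = f m := by
  induction m generalizing f with
  | zero => simp
  | succ m ih => rw [pow_succ, map_mul, Module.End.mul_apply, ih, rep_z_apply, Nat.cast_succ]

lemma rep_aeval_x_apply_zero (p : ℂ[X]) : rep κ hq (aeval (x q κ) p) f 0 = p * f 0 := by
  have hx (f : ℤ → ℂ[X]) : rep κ hq (x q κ) f 0 = X * f 0 := by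
    rw [x, map_mul, Module.End.mul_apply, rep_z_apply, rep_zs_apply]
    simp
  induction p using Polynomial.induction_on generalizing f with
  | C c => simp [Module.algebraMap_end_apply, smul_eq_C_mul]
  | add p r hp hr => simp [hp, hr, add_mul]
  | monomial m c ih =>
    rw [pow_succ', mul_left_comm, map_mul, aeval_X, map_mul, Module.End.mul_apply, hx, ih,
      ← mul_assoc]

end Rep

lemma exists_rep_zs_pow_apply_zero (hq : q ≠ 0) (m : ℕ) :
    ∃ c : ℂ[X], c ≠ 0 ∧ ∀ f : ℤ → ℂ[X], rep κ hq (zs q κ ^ m) f 0 = c * f (-m) := by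
  induction m with
  | zero => exact ⟨1, one_ne_zero, by simp⟩
  | succ m ih =>
    obtain ⟨c, hc, h⟩ := ih
    refine ⟨c * shiftPoly q κ (1 - -m), mul_ne_zero hc (shiftPoly_ne_zero hq _), fun f => ?_⟩
    rw [pow_succ, map_mul, Module.End.mul_apply, h, rep_zs_apply, mul_assoc, Nat.cast_succ,
      neg_add, ← sub_eq_add_neg]

lemma exists_rep_signedPow_apply_zero (hq : q ≠ 0) (k : ℤ) :
    ∃ c : ℂ[X], c ≠ 0 ∧
      ∀ f : ℤ → ℂ[X], rep κ hq (signedPow (z q κ) (zs q κ) k) f 0 = c * f k := by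
  obtain ⟨m, rfl | rfl⟩ := k.eq_nat_or_neg
  · exact ⟨1, one_ne_zero, fun f => by rw [signedPow_natCast, rep_z_pow_apply_zero, one_mul]⟩
  · rw [signedPow_neg_natCast]
    exact exists_rep_zs_pow_apply_zero hq m

lemma nf_injective (hq : q ≠ 0) : Function.Injective (nf q κ) := by
  choose c hc h using exists_rep_signedPow_apply_zero (κ := κ) hq
  have key (t : ℤ →₀ ℂ[X]) (k : ℤ) : rep κ hq (nf q κ t) (Pi.single k 1) 0 = t k * c k := by
    induction t using Finsupp.induction_linear with
    | zero => simp
    | add f g hf hg => simp [hf, hg, add_mul]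
    | single l p =>
      rw [normalForm_single, map_mul, Module.End.mul_apply, rep_aeval_x_apply_zero, h,
        Pi.single_apply, Finsupp.single_apply]
      split_ifs with hl <;> simp [hl]
  refine (injective_iff_map_eq_zero _).2 fun t ht => Finsupp.ext fun k => ?_
  have := key t k
  rw [ht, map_zero] at this
  exact (mul_eq_zero.1 this.symm).resolve_right (hc k)

lemma nontrivial (hq : q ≠ 0) : Nontrivial (Disc q κ) :=
  (nf_injective hq).nontrivial

/-- The coefficient `pₖ` of the normal form `∑ₖ pₖ(x) zₖ`. -/
def coeff (κ : ℝ) (hq : 0 < q) (k : ℤ) : Disc q κ →ₗ[ℂ] ℂ[X] :=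
  Finsupp.lapply k ∘ₗ
    (LinearEquiv.ofBijective (nf q κ) ⟨nf_injective hq.ne', nf_surjective hq⟩).symm

section Coeff

variable (hq : 0 < q)

lemma coeff_nf (t : ℤ →₀ ℂ[X]) (k : ℤ) : coeff κ hq k (nf q κ t) = t k := by
  have h : (LinearEquiv.ofBijective (nf q κ) ⟨nf_injective hq.ne', nf_surjective hq⟩).symm
      (nf q κ t) = t := (LinearEquiv.symm_apply_eq _).2 rfl
  exact DFunLike.congr_fun h k

lemma coeff_aeval_mul_signedPow (p : ℂ[X]) (k l : ℤ) :
    coeff κ hq k (aeval (x q κ) p * signedPow (z q κ) (zs q κ) l) = if l = k then p else 0 := by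
  rw [← normalForm_single, coeff_nf, Finsupp.single_apply]

include hq in
lemma linearMap_ext {V : Type*} [AddCommMonoid V] [Module ℂ V] {F G : Disc q κ →ₗ[ℂ] V}
    (h : ∀ (p : ℂ[X]) (k : ℤ), F (aeval (x q κ) p * signedPow (z q κ) (zs q κ) k) =
      G (aeval (x q κ) p * signedPow (z q κ) (zs q κ) k)) : F = G := by
  refine LinearMap.ext fun f => ?_
  obtain ⟨t, rfl⟩ := nf_surjective hq f
  induction t using Finsupp.induction_linear with
  | zero => simp
  | add f g hf hg => simp [hf, hg]
  | single k p => simpa using h p k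

lemma coeff_x_mul (f : Disc q κ) (k : ℤ) : coeff κ hq k (x q κ * f) = X * coeff κ hq k f := by
  refine LinearMap.congr_fun (linearMap_ext hq (F := coeff κ hq k ∘ₗ LinearMap.mulLeft ℂ _)
    (G := LinearMap.mulLeft ℂ X ∘ₗ coeff κ hq k) fun p l => ?_) f
  have h : x q κ * aeval (x q κ) p = aeval (x q κ) (X * p) := by rw [map_mul, aeval_X]
  rw [LinearMap.comp_apply, LinearMap.mulLeft_apply, ← mul_assoc, h, LinearMap.comp_apply,
    LinearMap.mulLeft_apply, coeff_aeval_mul_signedPow, coeff_aeval_mul_signedPow, mul_ite,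
    mul_zero]

lemma coeff_mul_x (f : Disc q κ) (k : ℤ) :
    coeff κ hq k (f * x q κ) = shiftPoly q κ (-k) * coeff κ hq k f := by
  refine LinearMap.congr_fun (linearMap_ext hq (F := coeff κ hq k ∘ₗ LinearMap.mulRight ℂ _)
    (G := LinearMap.mulLeft ℂ (shiftPoly q κ (-k)) ∘ₗ coeff κ hq k) fun p l => ?_) f
  rw [LinearMap.comp_apply, LinearMap.mulRight_apply, mul_assoc, signedPow_mul_x hq,
    ← mul_assoc, ← map_mul, coeff_aeval_mul_signedPow, LinearMap.comp_apply,
    LinearMap.mulLeft_apply, coeff_aeval_mul_signedPow]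
  split_ifs with h <;> simp [h, mul_comm]

lemma eq_aeval_of_coeff_eq_zero {f : Disc q κ} (h : ∀ k ≠ 0, coeff κ hq k f = 0) :
    f = aeval (x q κ) (coeff κ hq 0 f) := by
  obtain ⟨t, rfl⟩ := nf_surjective hq f
  simp only [coeff_nf] at h ⊢
  obtain ⟨p, rfl⟩ : ∃ p, t = Finsupp.single 0 p := by
    refine ⟨t 0, Finsupp.ext fun k => ?_⟩
    rw [Finsupp.single_apply]
    split_ifs with hk
    · rw [hk]
    · exact h k (Ne.symm hk)
  simp

end Coeff

/-! ### The centre -/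

lemma eval_shiftPoly_qInt (hq : q ≠ 0) (m n : ℤ) :
    (shiftPoly q κ m).eval ((κ * qInt q n : ℝ) : ℂ) = ((κ * qInt q (m + n) : ℝ) : ℂ) := by
  simp only [shiftPoly, qInt_add hq, eval_add, eval_mul, eval_C, eval_X]
  push_cast
  ring

lemma eq_C_of_comp_shiftPoly (hq : 0 < q) (hκ : κ ≠ 0) {p : ℂ[X]}
    (hp : p.comp (shiftPoly q κ (-1)) = p) : p = C (p.eval 0) := by
  have heval (n : ℕ) : p.eval ((κ * qInt q (-n) : ℝ) : ℂ) = p.eval 0 := by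
    induction n with
    | zero => simp [qInt_zero]
    | succ n ih =>
      rw [← ih, Nat.cast_succ, neg_add_rev, ← eval_shiftPoly_qInt hq.ne', ← eval_comp, hp]
  refine eq_of_infinite_eval_eq _ _ ((Set.infinite_range_of_injective
    (f := fun n : ℕ => ((κ * qInt q (-n) : ℝ) : ℂ)) fun m n h => ?_).mono ?_)
  · simpa [hκ, (qInt_injective hq).eq_iff] using h
  · rintro _ ⟨n, rfl⟩
    simpa using heval n

lemma exists_eq_algebraMap_of_commute (hq : 0 < q) (hκ : κ ≠ 0) {f : Disc q κ}
    (hz : Commute (z q κ) f) (hzs : Commute (zs q κ) f) : ∃ c : ℂ, f = algebraMap ℂ _ c := by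
  have hcoeff (k : ℤ) (hk : k ≠ 0) : coeff κ hq k f = 0 := by
    have hx : x q κ * f = f * x q κ := hz.mul_left hzs
    have hX : X - shiftPoly q κ (-k) ≠ 0 := fun h => hk <| by
      have := congrArg (eval 0) h
      simpa [shiftPoly, hκ, (qInt_injective hq).eq_iff' (qInt_zero q)] using this
    refine (mul_eq_zero.1 ?_).resolve_left hX
    rw [sub_mul, ← coeff_x_mul, ← coeff_mul_x, hx, sub_self]
  obtain ⟨p, rfl⟩ : ∃ p, f = aeval (x q κ) p := ⟨_, eq_aeval_of_coeff_eq_zero hq hcoeff⟩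
  have hp : p.comp (shiftPoly q κ (-1)) = p := by
    have h := (mul_aeval_of_mul_eq (z_mul_x hq) p).symm.trans hz.eq
    rw [← signedPow_one (z q κ) (zs q κ)] at h
    simpa only [coeff_aeval_mul_signedPow, if_true] using congrArg (coeff κ hq 1) h
  exact ⟨p.eval 0, by rw [eq_C_of_comp_shiftPoly hq hκ hp]; simp⟩

end Disc

namespace Disc

variable {q κ : ℝ}

/-! ### The circle action and its weights -/

/-- The endomorphism `z ↦ u z`, `z* ↦ u⁻¹ z*`. -/
def scaleHom (u : ℂˣ) : Disc q κ →ₐ[ℂ] Disc q κ :=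
  lift ((u : ℂ) • z q κ) ((↑u⁻¹ : ℂ) • zs q κ) (by simp [zs_mul_z, smul_smul])

lemma scaleHom_comp_scaleHom (u v : ℂˣ) :
    (scaleHom u).comp (scaleHom v) = scaleHom (q := q) (κ := κ) (u * v) :=
  algHom_ext (by simp [scaleHom, smul_smul, mul_comm]) (by simp [scaleHom, smul_smul, mul_comm])

lemma scaleHom_one : scaleHom 1 = AlgHom.id ℂ (Disc q κ) :=
  algHom_ext (by simp [scaleHom]) (by simp [scaleHom])

/-- The action of the torus `ℂˣ` on the quantum disc by the automorphisms `z ↦ u z`,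
`z* ↦ u⁻¹ z*`. -/
def scale (u : ℂˣ) : Disc q κ ≃ₐ[ℂ] Disc q κ :=
  AlgEquiv.ofAlgHom (scaleHom u) (scaleHom u⁻¹)
    (by rw [scaleHom_comp_scaleHom, mul_inv_cancel, scaleHom_one])
    (by rw [scaleHom_comp_scaleHom, inv_mul_cancel, scaleHom_one])

section Scale

variable (u v : ℂˣ)

@[simp] lemma scale_z : scale u (z q κ) = (u : ℂ) • z q κ := lift_z ..

@[simp] lemma scale_zs : scale u (zs q κ) = (↑u⁻¹ : ℂ) • zs q κ := lift_zs ..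

@[simp] lemma scale_one (f : Disc q κ) : scale 1 f = f := DFunLike.congr_fun scaleHom_one f

lemma scale_comm (f : Disc q κ) : scale u (scale v f) = scale v (scale u f) := by
  have h : (scaleHom u).comp (scaleHom v) = (scaleHom v).comp (scaleHom (q := q) (κ := κ) u) := by
    rw [scaleHom_comp_scaleHom, scaleHom_comp_scaleHom, mul_comm]
  exact DFunLike.congr_fun h f

@[simp] lemma scale_aeval_x (p : ℂ[X]) : scale u (aeval (x q κ) p) = aeval (x q κ) p := by
  rw [← aeval_algHom_apply]
  simp [x, smul_smul]

lemma scale_signedPow (k : ℤ) :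
    scale u (signedPow (z q κ) (zs q κ) k) = (↑(u ^ k) : ℂ) • signedPow (z q κ) (zs q κ) k := by
  obtain ⟨n, rfl | rfl⟩ := k.eq_nat_or_neg
  · simp [signedPow_natCast, _root_.smul_pow]
  · simp [signedPow_neg_natCast, _root_.smul_pow]

lemma coeff_scale (hq : 0 < q) (f : Disc q κ) (k : ℤ) :
    coeff κ hq k (scale u f) = (↑(u ^ k) : ℂ) • coeff κ hq k f := by
  refine LinearMap.congr_fun (linearMap_ext hq (F := coeff κ hq k ∘ₗ (scale u).toLinearMap)
    (G := (↑(u ^ k) : ℂ) • coeff κ hq k) fun p l => ?_) f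
  simp only [LinearMap.comp_apply, AlgEquiv.toLinearMap_apply, map_mul, scale_aeval_x,
    scale_signedPow, mul_smul_comm, map_smul, LinearMap.smul_apply, coeff_aeval_mul_signedPow]
  split_ifs with h <;> simp [h]

end Scale

/-- The component of weight `k` for the action of the `N`-th roots of unity by `z ↦ u z`,
`z* ↦ u⁻¹ z*`. It depends on `k` modulo `N` only. -/
def weight (q κ : ℝ) (N : ℕ) (k : ℤ) : Submodule ℂ (Disc q κ) where
  carrier := {f | ∀ u : ℂˣ, u ^ N = 1 → scale u f = (↑(u ^ k) : ℂ) • f}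
  add_mem' hf hg u hu := by rw [map_add, hf u hu, hg u hu, smul_add]
  zero_mem' u _ := by simp
  smul_mem' c f hf u hu := by rw [map_smul, hf u hu, smul_comm]

section Weight

variable {N : ℕ} {j k l : ℤ} {f g : Disc q κ}

lemma mul_mem_weight (hf : f ∈ weight q κ N j) (hg : g ∈ weight q κ N k) (hl : j + k = l) :
    f * g ∈ weight q κ N l := fun u hu => by
  rw [map_mul, hf u hu, hg u hu, smul_mul_smul_comm, ← hl, zpow_add, Units.val_mul]

lemma weight_eq_of_modEq (h : j ≡ k [ZMOD N]) : weight q κ N j = weight q κ N k := by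
  ext f
  refine forall₂_congr fun u hu => ?_
  obtain ⟨l, hl⟩ := h.dvd
  rw [sub_eq_iff_eq_add'.1 hl, zpow_add, zpow_mul, zpow_natCast, hu, one_zpow, mul_one]

lemma aeval_x_mem_weight (p : ℂ[X]) : aeval (x q κ) p ∈ weight q κ N 0 := fun u _ => by
  simp

lemma signedPow_mem_weight (k : ℤ) : signedPow (z q κ) (zs q κ) k ∈ weight q κ N k :=
  fun u _ => scale_signedPow u k

lemma z_pow_mem_weight (n : ℕ) : z q κ ^ n ∈ weight q κ N n := signedPow_mem_weight (n : ℤ)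

lemma zs_pow_mem_weight (n : ℕ) : zs q κ ^ n ∈ weight q κ N (-n) := by
  simpa only [signedPow_neg_natCast] using signedPow_mem_weight (-n : ℤ)

lemma z_mem_weight : z q κ ∈ weight q κ N 1 := by
  simpa using z_pow_mem_weight (q := q) (κ := κ) (N := N) 1

lemma zs_mem_weight : zs q κ ∈ weight q κ N (-1) := by
  simpa using zs_pow_mem_weight (q := q) (κ := κ) (N := N) 1

lemma z_pow_sub_one_mem_weight (hN : 0 < N) : z q κ ^ (N - 1) ∈ weight q κ N (-1) := by
  rw [weight_eq_of_modEq (k := ((N - 1 : ℕ) : ℤ))]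
  · exact z_pow_mem_weight _
  · exact Int.modEq_iff_dvd.2 ⟨1, by push_cast [Nat.cast_sub hN]; ring⟩

lemma zs_pow_sub_one_mem_weight (hN : 0 < N) : zs q κ ^ (N - 1) ∈ weight q κ N 1 := by
  rw [weight_eq_of_modEq (k := -((N - 1 : ℕ) : ℤ))]
  · exact zs_pow_mem_weight _
  · exact Int.modEq_iff_dvd.2 ⟨-1, by push_cast [Nat.cast_sub hN]; ring⟩

lemma scale_mem_weight (u : ℂˣ) (hf : f ∈ weight q κ N k) : scale u f ∈ weight q κ N k :=
  fun v hv => by rw [scale_comm, hf v hv, map_smul]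

lemma coeff_eq_zero_of_mem_weight (hq : 0 < q) (hN : N ≠ 0) (hf : f ∈ weight q κ N j)
    (hk : ¬ j ≡ k [ZMOD N]) : coeff κ hq k f = 0 := by
  obtain ⟨u, hu⟩ : ∃ u : ℂˣ, IsPrimitiveRoot u N :=
    ⟨_, (Complex.isPrimitiveRoot_exp N hN).isUnit_unit hN⟩
  have h := coeff_scale u hq f k
  rw [hf u hu.pow_eq_one, map_smul, ← sub_eq_zero, ← sub_smul] at h
  refine (smul_eq_zero.1 h).resolve_left fun h => hk ?_
  rw [sub_eq_zero, Units.val_inj, ← mul_inv_eq_one, ← zpow_sub, hu.zpow_eq_one_iff_dvd] at h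
  exact (Int.modEq_iff_dvd.2 h).symm

end Weight

/-! ### The twist and the normal element -/

/-- The automorphism `σ : z ↦ q⁻¹ z`, `z* ↦ q z*`, for which `f dz = dz σ(f)` and
`f dz* = dz* σ(f)` in the forms on the quantum disc. -/
def twist (κ : ℝ) (hq : 0 < q) : Disc q κ ≃ₐ[ℂ] Disc q κ :=
  scale (Units.mk0 (q : ℂ) (Complex.ofReal_ne_zero.2 hq.ne'))⁻¹

section Twist

variable (hq : 0 < q)

@[simp] lemma twist_z : twist κ hq (z q κ) = (q : ℂ)⁻¹ • z q κ := by
  simp [twist]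

@[simp] lemma twist_zs : twist κ hq (zs q κ) = (q : ℂ) • zs q κ := by
  simp [twist]

@[simp] lemma twist_aeval_x (p : ℂ[X]) : twist κ hq (aeval (x q κ) p) = aeval (x q κ) p :=
  scale_aeval_x _ p

@[simp] lemma twist_x : twist κ hq (x q κ) = x q κ := by
  simpa using twist_aeval_x (κ := κ) hq X

variable {N : ℕ} {k : ℤ} {f : Disc q κ}

lemma twist_mem_weight (hf : f ∈ weight q κ N k) : twist κ hq f ∈ weight q κ N k :=
  scale_mem_weight _ hf

lemma twist_symm_mem_weight (hf : f ∈ weight q κ N k) : (twist κ hq).symm f ∈ weight q κ N k :=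
  scale_mem_weight _ hf

end Twist

/-- The polynomial whose value at `x` is the normal element. -/
def normalPoly (q κ : ℝ) : ℂ[X] := C ((q : ℂ) - 1) * X + C (κ : ℂ)

/-- The normal element `z* z - z z* = (q - 1) x + κ`, which commutes with `z` and `z*` up to the
twist. -/
def normalElt (q κ : ℝ) : Disc q κ := aeval (x q κ) (normalPoly q κ)

lemma normalElt_eq : normalElt q κ = zs q κ * z q κ - z q κ * zs q κ := by
  simp only [normalElt, normalPoly, map_add, map_mul, aeval_C, aeval_X, zs_mul_z, x,
    Algebra.algebraMap_eq_smul_one, smul_mul_assoc, one_mul]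
  module

lemma normalPoly_comp_shiftPoly (n : ℤ) :
    (normalPoly q κ).comp (shiftPoly q κ n) = (q : ℂ) ^ n • normalPoly q κ := by
  have h : (q : ℂ) ^ n = (q - 1) * (qInt q n : ℂ) + 1 := by
    rw [← sub_eq_iff_eq_add]
    exact_mod_cast zpow_sub_one_eq_mul_qInt n
  simp only [normalPoly, shiftPoly, add_comp, mul_comp, C_comp, X_comp, smul_eq_C_mul, h]
  push_cast
  simp only [C_mul, C_add, C_sub, C_1]
  ring

lemma mul_normalElt (hq : 0 < q) (f : Disc q κ) :
    f * normalElt q κ = normalElt q κ * twist κ hq f := by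
  induction f using induction_on with
  | z =>
    rw [normalElt, mul_aeval_of_mul_eq (z_mul_x hq), normalPoly_comp_shiftPoly, zpow_neg_one,
      map_smul, smul_mul_assoc, twist_z, mul_smul_comm]
  | zs =>
    rw [normalElt, mul_aeval_of_mul_eq (zs_mul_x hq), normalPoly_comp_shiftPoly, zpow_one,
      map_smul, smul_mul_assoc, twist_zs, mul_smul_comm]
  | algebraMap c => rw [AlgEquiv.commutes, Algebra.commutes]
  | add f g hf hg => rw [map_add, add_mul, mul_add, hf, hg]
  | mul f g hf hg => rw [map_mul, mul_assoc, hg, ← mul_assoc, hf, mul_assoc]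

@[simp] lemma twist_normalElt (hq : 0 < q) : twist κ hq (normalElt q κ) = normalElt q κ :=
  twist_aeval_x hq _

lemma normalElt_mem_weight {N : ℕ} : normalElt q κ ∈ weight q κ N 0 :=
  aeval_x_mem_weight _

/-! ### Partitions of unity -/

lemma isCoprime_of_C_mul_add_C_mul_eq_C {F : Type*} [Field F] {p r : F[X]} {a b c : F}
    (hc : c ≠ 0) (h : C a * p + C b * r = C c) : IsCoprime p r :=
  ⟨C (c⁻¹ * a), C (c⁻¹ * b), by
    rw [C_mul, C_mul, mul_assoc, mul_assoc, ← mul_add, h, ← C_mul, inv_mul_cancel₀ hc, C_1]⟩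

lemma isCoprime_shiftPoly (hq : 0 < q) (hκ : κ ≠ 0) {m n : ℤ} (hmn : m ≠ n) :
    IsCoprime (shiftPoly q κ m) (shiftPoly q κ n) := by
  have hqInt : q ^ n * qInt q m - q ^ m * qInt q n = qInt q m - qInt q n := by
    have h := qInt_add hq.ne' m n
    rw [add_comm, qInt_add hq.ne'] at h
    linarith
  refine isCoprime_of_C_mul_add_C_mul_eq_C (a := (q : ℂ) ^ n) (b := -(q : ℂ) ^ m)
    (c := ((κ * (qInt q m - qInt q n) : ℝ) : ℂ)) ?_ ?_
  · exact_mod_cast mul_ne_zero hκ (sub_ne_zero.2 ((qInt_injective hq).ne hmn))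
  · rw [← hqInt, shiftPoly, shiftPoly]
    push_cast
    simp only [C_mul, C_sub, C_neg]
    ring

lemma isCoprime_normalPoly_shiftPoly (hκ : κ ≠ 0) (n : ℤ) :
    IsCoprime (normalPoly q κ) (shiftPoly q κ n) := by
  refine isCoprime_of_C_mul_add_C_mul_eq_C (a := (q : ℂ) ^ n) (b := -((q : ℂ) - 1))
    (c := (κ : ℂ)) (Complex.ofReal_ne_zero.2 hκ) ?_
  have h : (q : ℂ) ^ n = (q - 1) * (qInt q n : ℂ) + 1 := by
    rw [← sub_eq_iff_eq_add]
    exact_mod_cast zpow_sub_one_eq_mul_qInt n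
  simp only [normalPoly, shiftPoly, h]
  push_cast
  simp only [C_mul, C_add, C_sub, C_neg, C_1]
  ring

lemma isCoprime_normalPoly_mul_shiftPoly_prod (hq : 0 < q) (hκ : κ ≠ 0) {m : ℤ} {e : ℕ → ℤ}
    (he : ∀ l, m ≠ e l) (M : ℕ) :
    IsCoprime (normalPoly q κ * shiftPoly q κ m)
      ((List.range M).map fun l => shiftPoly q κ (e l)).prod := by
  refine List.prod_induction _ (fun _ _ => IsCoprime.mul_right) isCoprime_one_right ?_
  simp only [List.mem_map, forall_exists_index, and_imp, forall_apply_eq_imp_iff₂]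
  exact fun l _ =>
    (isCoprime_normalPoly_shiftPoly hκ _).mul_left (isCoprime_shiftPoly hq hκ (he l))

lemma exists_normalElt_mul_z_mul_zs_add (hq : 0 < q) (hκ : κ ≠ 0) (M : ℕ) :
    ∃ r s : ℂ[X], normalElt q κ * z q κ * (zs q κ * aeval (x q κ) r) +
      zs q κ ^ M * (z q κ ^ M * aeval (x q κ) s) = 1 := by
  obtain ⟨r, s, h⟩ := isCoprime_normalPoly_mul_shiftPoly_prod hq hκ (m := 0)
    (e := fun l => (l : ℤ) + 1) (fun l => by omega) M
  have hprod : zs q κ ^ M * z q κ ^ M =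
      aeval (x q κ) ((List.range M).map fun l : ℕ => shiftPoly q κ ((l : ℤ) + 1)).prod := by
    simp only [zs_pow_mul_z_pow κ hq, map_list_prod, List.map_map, Function.comp_def,
      aeval_shiftPoly]
  refine ⟨r, s, ?_⟩
  rw [← mul_assoc, ← mul_assoc, hprod, mul_assoc (normalElt q κ), ← shift_zero, normalElt,
    ← aeval_shiftPoly, ← map_mul, ← map_mul, ← map_mul, ← map_add, mul_comm _ r, mul_comm _ s, h,
    map_one]

lemma exists_normalElt_mul_zs_mul_z_add (hq : 0 < q) (hκ : κ ≠ 0) (M : ℕ) :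
    ∃ r s : ℂ[X], normalElt q κ * zs q κ * (z q κ * aeval (x q κ) r) +
      z q κ ^ M * (zs q κ ^ M * aeval (x q κ) s) = 1 := by
  obtain ⟨r, s, h⟩ := isCoprime_normalPoly_mul_shiftPoly_prod hq hκ (m := 1)
    (e := fun l => -(l : ℤ)) (fun l => by omega) M
  have hprod : z q κ ^ M * zs q κ ^ M =
      aeval (x q κ) ((List.range M).map fun l : ℕ => shiftPoly q κ (-(l : ℤ))).prod := by
    simp only [z_pow_mul_zs_pow κ hq, map_list_prod, List.map_map, Function.comp_def,
      aeval_shiftPoly]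
  refine ⟨r, s, ?_⟩
  rw [← mul_assoc, ← mul_assoc, hprod, mul_assoc (normalElt q κ), zs_mul_z_eq_aeval hq, normalElt,
    ← map_mul, ← map_mul, ← map_mul, ← map_add, mul_comm _ r, mul_comm _ s, h, map_one]

variable {N : ℕ}

lemma exists_normalElt_mul_z_mul_add_zs_pow_mul (hq : 0 < q) (hκ : κ ≠ 0) (hN : 0 < N) :
    ∃ f ∈ weight q κ N (-1), ∃ g ∈ weight q κ N (-1),
      normalElt q κ * z q κ * f + zs q κ ^ (N - 1) * g = 1 := by
  obtain ⟨r, s, h⟩ := exists_normalElt_mul_z_mul_zs_add hq hκ (N - 1)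
  exact ⟨_, mul_mem_weight zs_mem_weight (aeval_x_mem_weight r) (add_zero _),
    _, mul_mem_weight (z_pow_sub_one_mem_weight hN) (aeval_x_mem_weight s) (add_zero _), h⟩

lemma exists_normalElt_mul_zs_mul_add_z_pow_mul (hq : 0 < q) (hκ : κ ≠ 0) (hN : 0 < N) :
    ∃ f ∈ weight q κ N 1, ∃ g ∈ weight q κ N 1,
      normalElt q κ * zs q κ * f + z q κ ^ (N - 1) * g = 1 := by
  obtain ⟨r, s, h⟩ := exists_normalElt_mul_zs_mul_z_add hq hκ (N - 1)
  exact ⟨_, mul_mem_weight z_mem_weight (aeval_x_mem_weight r) (add_zero _),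
    _, mul_mem_weight (zs_pow_sub_one_mem_weight hN) (aeval_x_mem_weight s) (add_zero _), h⟩

lemma one_mem_weight_one_mul_weight_neg_one (hq : 0 < q) (hκ : κ ≠ 0) (hN : 0 < N) :
    1 ∈ weight q κ N 1 * weight q κ N (-1) := by
  obtain ⟨f, hf, g, hg, h⟩ := exists_normalElt_mul_z_mul_add_zs_pow_mul hq hκ hN
  rw [← h]
  exact add_mem
    (Submodule.mul_mem_mul (mul_mem_weight normalElt_mem_weight z_mem_weight (zero_add _)) hf)
    (Submodule.mul_mem_mul (zs_pow_sub_one_mem_weight hN) hg)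

lemma one_mem_weight_neg_one_mul_weight_one (hq : 0 < q) (hκ : κ ≠ 0) (hN : 0 < N) :
    1 ∈ weight q κ N (-1) * weight q κ N 1 := by
  obtain ⟨f, hf, g, hg, h⟩ := exists_normalElt_mul_zs_mul_add_z_pow_mul hq hκ hN
  rw [← h]
  exact add_mem
    (Submodule.mul_mem_mul (mul_mem_weight normalElt_mem_weight zs_mem_weight (zero_add _)) hf)
    (Submodule.mul_mem_mul (z_pow_sub_one_mem_weight hN) hg)

end Disc

/-! ### The quantum cone as an algebra of invariants -/

namespace Cone

section Relations

variable (N : ℕ) (q κ : ℝ)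

/-- The generator `a = a*` of the quantum cone. -/
def a : Cone N q κ := RingQuot.mkAlgHom ℂ (ConeRel N q κ) (FreeAlgebra.ι ℂ ConeGen.a)

/-- The generator `b` of the quantum cone. -/
def b : Cone N q κ := RingQuot.mkAlgHom ℂ (ConeRel N q κ) (FreeAlgebra.ι ℂ ConeGen.b)

/-- The generator `b*` of the quantum cone. -/
def bs : Cone N q κ := RingQuot.mkAlgHom ℂ (ConeRel N q κ) (FreeAlgebra.ι ℂ ConeGen.bs)

lemma adjoin_eq_top : Algebra.adjoin ℂ {a N q κ, b N q κ, bs N q κ} = ⊤ := by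
  refine top_le_iff.1 ((adjoin_range_mkAlgHom_ι (ConeRel N q κ)).ge.trans (Algebra.adjoin_mono ?_))
  rintro _ ⟨_ | _ | _, rfl⟩
  exacts [Or.inl rfl, Or.inr (Or.inl rfl), Or.inr (Or.inr rfl)]

lemma a_mul_b : a N q κ * b N q κ =
    (q : ℂ) ^ N • (b N q κ * a N q κ) + ((κ * qInt q N : ℝ) : ℂ) • b N q κ := by
  have h := RingQuot.mkAlgHom_rel ℂ (ConeRel.a_b (N := N) (q := q) (κ := κ))
  rwa [map_mul, map_add, map_smul, map_smul, map_mul] at h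

lemma bs_mul_a : bs N q κ * a N q κ =
    (q : ℂ) ^ N • (a N q κ * bs N q κ) + ((κ * qInt q N : ℝ) : ℂ) • bs N q κ := by
  have h := RingQuot.mkAlgHom_rel ℂ (ConeRel.bs_a (N := N) (q := q) (κ := κ))
  rwa [map_mul, map_add, map_smul, map_smul, map_mul] at h

lemma aeval_a_shiftPoly (n : ℤ) : aeval (a N q κ) (Disc.shiftPoly q κ n) =
    (q : ℂ) ^ n • a N q κ + algebraMap ℂ _ ((κ * qInt q n : ℝ) : ℂ) := by
  rw [Disc.shiftPoly, map_add, map_mul, aeval_C, aeval_X, aeval_C, Algebra.smul_def]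

lemma b_mul_bs : b N q κ * bs N q κ = aeval (a N q κ)
    ((List.range N).map fun l : ℕ => Disc.shiftPoly q κ (-(l : ℤ))).prod := by
  have h := RingQuot.mkAlgHom_rel ℂ (ConeRel.b_bs (N := N) (q := q) (κ := κ))
  simp only [map_mul, map_list_prod, List.map_map, Function.comp_def, map_add, map_smul,
    AlgHom.commutes] at h
  simp only [map_list_prod, List.map_map, Function.comp_def, aeval_a_shiftPoly]
  exact h

lemma bs_mul_b : bs N q κ * b N q κ = aeval (a N q κ)
    ((List.range N).map fun l : ℕ => Disc.shiftPoly q κ ((l + 1 : ℕ) : ℤ)).prod := by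
  have h := RingQuot.mkAlgHom_rel ℂ (ConeRel.bs_b (N := N) (q := q) (κ := κ))
  simp only [map_mul, map_list_prod, List.map_map, Function.comp_def, map_add, map_smul,
    AlgHom.commutes] at h
  simp only [map_list_prod, List.map_map, Function.comp_def, aeval_a_shiftPoly,
    Nat.cast_add, Nat.cast_one]
  exact h

/-- The normal form map `(pₖ) ↦ ∑ₖ pₖ(a) bₖ` of the quantum cone. -/
abbrev nf : (ℤ →₀ ℂ[X]) →ₗ[ℂ] Cone N q κ := normalForm (a N q κ) (b N q κ) (bs N q κ)

end Relations

variable {N : ℕ} {q κ : ℝ}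

lemma b_mul_a (hq : q ≠ 0) :
    b N q κ * a N q κ = aeval (a N q κ) (Disc.shiftPoly q κ (-N)) * b N q κ := by
  have hq' : (q : ℂ) ≠ 0 := Complex.ofReal_ne_zero.2 hq
  have hqInt : (q : ℂ) ^ (-N : ℤ) * (qInt q N : ℂ) = -(qInt q (-N) : ℂ) := by
    have h := qInt_add hq (-N) N
    rw [neg_add_cancel, qInt_zero] at h
    exact_mod_cast eq_neg_of_add_eq_zero_left h.symm
  rw [aeval_a_shiftPoly, add_mul, smul_mul_assoc, a_mul_b, Algebra.algebraMap_eq_smul_one,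
    smul_mul_assoc, one_mul, smul_add, smul_smul, smul_smul, ← zpow_natCast, ← zpow_add₀ hq',
    neg_add_cancel, zpow_zero, one_smul, add_assoc, ← add_smul]
  push_cast
  rw [mul_left_comm, hqInt, mul_neg, neg_add_cancel, zero_smul, add_zero]

lemma nf_surjective (hq : q ≠ 0) : Function.Surjective (nf N q κ) := by
  refine normalForm_surjective (b_mul_a hq) (v := Disc.shiftPoly q κ N) ?_
    (b_mul_bs N q κ) (bs_mul_b N q κ) (adjoin_eq_top N q κ)
  rw [bs_mul_a, aeval_a_shiftPoly, add_mul, smul_mul_assoc, zpow_natCast, ← Algebra.smul_def]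

variable (hq : 0 < q)

@[simp] lemma coneToDisc_a : coneToDisc N κ hq (a N q κ) = Disc.x q κ :=
  (RingQuot.liftAlgHom_mkAlgHom_apply ..).trans (FreeAlgebra.lift_ι_apply ..)

@[simp] lemma coneToDisc_b : coneToDisc N κ hq (b N q κ) = Disc.z q κ ^ N :=
  (RingQuot.liftAlgHom_mkAlgHom_apply ..).trans (FreeAlgebra.lift_ι_apply ..)

@[simp] lemma coneToDisc_bs : coneToDisc N κ hq (bs N q κ) = Disc.zs q κ ^ N :=
  (RingQuot.liftAlgHom_mkAlgHom_apply ..).trans (FreeAlgebra.lift_ι_apply ..)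

lemma coneToDisc_nf (t : ℤ →₀ ℂ[X]) :
    coneToDisc N κ hq (nf N q κ t) = Disc.nf q κ (t.mapDomain (N * ·)) := by
  induction t using Finsupp.induction_linear with
  | zero => simp
  | add f g hf hg => simp only [map_add, hf, hg, Finsupp.mapDomain_add]
  | single k p =>
    rw [Finsupp.mapDomain_single, normalForm_single, normalForm_single, map_mul, map_signedPow,
      coneToDisc_b, coneToDisc_bs, signedPow_pow, ← aeval_algHom_apply, coneToDisc_a]

lemma coneToDisc_mem_weight_zero (f : Cone N q κ) :
    coneToDisc N κ hq f ∈ Disc.weight q κ N 0 := by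
  induction f using induction_of_adjoin_eq_top (adjoin_eq_top N q κ) with
  | mem f hf =>
    obtain rfl | rfl | rfl := hf
    · simpa using Disc.aeval_x_mem_weight (q := q) (κ := κ) (N := N) X
    · rw [coneToDisc_b, ← Disc.weight_eq_of_modEq (j := N) (Int.modEq_zero_iff_dvd.2 dvd_rfl)]
      exact Disc.z_pow_mem_weight N
    · rw [coneToDisc_bs, ← Disc.weight_eq_of_modEq (j := -N)
        (Int.modEq_zero_iff_dvd.2 (dvd_neg.2 dvd_rfl))]
      exact Disc.zs_pow_mem_weight N
  | algebraMap c => simpa using Disc.aeval_x_mem_weight (q := q) (κ := κ) (N := N) (C c)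
  | add f g hf hg => rw [map_add]; exact add_mem hf hg
  | mul f g hf hg => rw [map_mul]; exact Disc.mul_mem_weight hf hg (add_zero 0)

section Pos

variable (hN : 0 < N)

include hN

lemma natCast_mul_injective : Function.Injective ((N : ℤ) * ·) :=
  mul_right_injective₀ (Nat.cast_ne_zero.2 hN.ne')

lemma coneToDisc_comp_nf_injective : Function.Injective (coneToDisc N κ hq ∘ nf N q κ) := by
  intro s t h
  rw [Function.comp_apply, Function.comp_apply, coneToDisc_nf, coneToDisc_nf] at h
  exact Finsupp.mapDomain_injective (natCast_mul_injective hN) (Disc.nf_injective hq.ne' h)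

lemma coneToDisc_injective : Function.Injective (coneToDisc N κ hq) :=
  (coneToDisc_comp_nf_injective hq hN).of_comp_right (nf_surjective hq.ne')

include hq in
lemma nf_injective : Function.Injective (nf N q κ) :=
  (coneToDisc_comp_nf_injective hq hN).of_comp

lemma range_coneToDisc : LinearMap.range (coneToDisc N κ hq).toLinearMap =
    Disc.weight q κ N 0 := by
  refine le_antisymm ?_ fun f hf => ?_
  · rintro _ ⟨f, rfl⟩
    exact coneToDisc_mem_weight_zero hq f
  · obtain ⟨t, rfl⟩ := Disc.nf_surjective hq f
    refine ⟨nf N q κ (t.comapDomain _ (natCast_mul_injective hN).injOn), ?_⟩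
    rw [AlgHom.toLinearMap_apply, coneToDisc_nf,
      Finsupp.mapDomain_comapDomain _ (natCast_mul_injective hN)]
    intro k hk
    by_contra hNk
    refine Finsupp.mem_support_iff.1 hk ?_
    rw [← Disc.coeff_nf hq]
    refine Disc.coeff_eq_zero_of_mem_weight hq hN.ne' hf fun h => hNk ?_
    obtain ⟨l, hl⟩ := Int.modEq_zero_iff_dvd.1 h.symm
    exact ⟨l, hl.symm⟩

end Pos

end Cone

/-! ### The differential graded algebra of forms on the quantum disc -/

namespace DiscForms

section Generators

variable (q κ : ℝ)

lemma adjoin_eq_top : Algebra.adjoin ℂ {z q κ, zs q κ, dz q κ, dzs q κ} = ⊤ := by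
  refine top_le_iff.1 ((adjoin_range_mkAlgHom_ι (FormRel q κ)).ge.trans (Algebra.adjoin_mono ?_))
  rintro _ ⟨_ | _ | _ | _, rfl⟩
  exacts [Or.inl rfl, Or.inr (Or.inl rfl), Or.inr (Or.inr (Or.inl rfl)),
    Or.inr (Or.inr (Or.inr rfl))]

@[simp] lemma ofDisc_z : ofDisc q κ (Disc.z q κ) = z q κ :=
  (RingQuot.liftAlgHom_mkAlgHom_apply ..).trans (FreeAlgebra.lift_ι_apply ..)

@[simp] lemma ofDisc_zs : ofDisc q κ (Disc.zs q κ) = zs q κ :=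
  (RingQuot.liftAlgHom_mkAlgHom_apply ..).trans (FreeAlgebra.lift_ι_apply ..)

end Generators

variable {q κ : ℝ}

lemma induction_on {motive : DiscForms q κ → Prop} (ω : DiscForms q κ) (z : motive (z q κ))
    (zs : motive (zs q κ)) (dz : motive (dz q κ)) (dzs : motive (dzs q κ))
    (algebraMap : ∀ c, motive (algebraMap ℂ _ c))
    (add : ∀ ω η, motive ω → motive η → motive (ω + η))
    (mul : ∀ ω η, motive ω → motive η → motive (ω * η)) : motive ω :=
  induction_of_adjoin_eq_top (adjoin_eq_top q κ)
    (by rintro _ (rfl | rfl | rfl | rfl) <;> assumption) algebraMap add mul ω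

lemma algHom_ext {C : Type*} [Semiring C] [Algebra ℂ C] {F G : DiscForms q κ →ₐ[ℂ] C}
    (hz : F (z q κ) = G (z q κ)) (hzs : F (zs q κ) = G (zs q κ))
    (hdz : F (dz q κ) = G (dz q κ)) (hdzs : F (dzs q κ) = G (dzs q κ)) : F = G :=
  AlgHom.ext_of_adjoin_eq_top (adjoin_eq_top q κ)
    (by rintro _ (rfl | rfl | rfl | rfl) <;> assumption)

section Commutation

variable (hq : 0 < q) (f : Disc q κ)

lemma ofDisc_mul_eq_mul_ofDisc_twist {ω : DiscForms q κ}
    (hz : z q κ * ω = (q : ℂ)⁻¹ • (ω * z q κ)) (hzs : zs q κ * ω = (q : ℂ) • (ω * zs q κ)) :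
    ofDisc q κ f * ω = ω * ofDisc q κ (Disc.twist κ hq f) := by
  induction f using Disc.induction_on with
  | z => simp [hz]
  | zs => simp [hzs, -Complex.coe_smul]
  | algebraMap c => simp [Algebra.commutes]
  | add f g hf hg => simp only [map_add, add_mul, mul_add, hf, hg]
  | mul f g hf hg => rw [map_mul, mul_assoc, hg, ← mul_assoc, hf, mul_assoc, map_mul, map_mul]

lemma ofDisc_mul_dz : ofDisc q κ f * dz q κ = dz q κ * ofDisc q κ (Disc.twist κ hq f) :=
  ofDisc_mul_eq_mul_ofDisc_twist hq f (z_mul_dz q κ) (zs_mul_dz q κ)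

lemma ofDisc_mul_dzs : ofDisc q κ f * dzs q κ = dzs q κ * ofDisc q κ (Disc.twist κ hq f) := by
  have hq' : (q : ℂ) ≠ 0 := Complex.ofReal_ne_zero.2 hq.ne'
  exact ofDisc_mul_eq_mul_ofDisc_twist hq f
    (by rw [dzs_mul_z, inv_smul_smul₀ hq']) (by rw [dzs_mul_zs, smul_inv_smul₀ hq'])

lemma dzs_mul_dz (hq : q ≠ 0) : dzs q κ * dz q κ = -(q : ℂ) • (dz q κ * dzs q κ) := by
  rw [dz_mul_dzs, smul_smul, neg_mul_neg, mul_inv_cancel₀ (Complex.ofReal_ne_zero.2 hq), one_smul]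

end Commutation

section Lift

variable {C : Type*} [Ring C] [Algebra ℂ C] (hq : 0 < q) (F : Disc q κ →ₐ[ℂ] C) (u v : C)

/-- The universal property of the algebra of forms: `dz` and `dz*` can be sent to elements which
anticommute up to `q`, have square zero and commute with functions up to the twist. -/
def lift (hu : ∀ f, F f * u = u * F (Disc.twist κ hq f))
    (hv : ∀ f, F f * v = v * F (Disc.twist κ hq f)) (huv : u * v = -(q : ℂ)⁻¹ • (v * u))
    (huu : u * u = 0) (hvv : v * v = 0) : DiscForms q κ →ₐ[ℂ] C :=
  RingQuot.liftAlgHom ℂ ⟨FreeAlgebra.lift ℂ (fun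
    | FormGen.z => F (Disc.z q κ)
    | FormGen.zs => F (Disc.zs q κ)
    | FormGen.dz => u
    | FormGen.dzs => v), by
    have hq' : (q : ℂ) ≠ 0 := Complex.ofReal_ne_zero.2 hq.ne'
    rintro _ _ ⟨⟩ <;>
    simp only [map_mul, map_add, map_smul, map_zero, FreeAlgebra.lift_ι_apply, AlgHom.commutes]
    · simpa [-Complex.coe_smul] using congrArg F (Disc.zs_mul_z q κ)
    · simp [hu]
    · simp [hv, smul_smul, hq', -Complex.coe_smul]
    · simp [hu, -Complex.coe_smul]
    · simp [hv, smul_smul, hq']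
    · exact huv
    · exact huu
    · exact hvv⟩

variable (hu : ∀ f, F f * u = u * F (Disc.twist κ hq f))
  (hv : ∀ f, F f * v = v * F (Disc.twist κ hq f)) (huv : u * v = -(q : ℂ)⁻¹ • (v * u))
  (huu : u * u = 0) (hvv : v * v = 0)

@[simp] lemma lift_dz : lift hq F u v hu hv huv huu hvv (dz q κ) = u :=
  (RingQuot.liftAlgHom_mkAlgHom_apply ..).trans (FreeAlgebra.lift_ι_apply ..)

@[simp] lemma lift_dzs : lift hq F u v hu hv huv huu hvv (dzs q κ) = v :=
  (RingQuot.liftAlgHom_mkAlgHom_apply ..).trans (FreeAlgebra.lift_ι_apply ..)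

lemma lift_comp_ofDisc : (lift hq F u v hu hv huv huu hvv).comp (ofDisc q κ) = F := by
  refine Disc.algHom_ext ?_ ?_ <;> rw [AlgHom.comp_apply]
  · rw [ofDisc_z]
    exact (RingQuot.liftAlgHom_mkAlgHom_apply ..).trans (FreeAlgebra.lift_ι_apply ..)
  · rw [ofDisc_zs]
    exact (RingQuot.liftAlgHom_mkAlgHom_apply ..).trans (FreeAlgebra.lift_ι_apply ..)

@[simp] lemma lift_ofDisc (f : Disc q κ) :
    lift hq F u v hu hv huv huu hvv (ofDisc q κ f) = F f :=
  DFunLike.congr_fun (lift_comp_ofDisc hq F u v hu hv huv huu hvv) f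

end Lift

/-- The automorphism of the algebra of forms which is `scale u` on functions and commutes with the
differential up to the factor `t`. Its eigenvalues detect both the circle weight and the degree of
a form. -/
def dilate (hq : 0 < q) (u : ℂˣ) (t : ℂ) : DiscForms q κ →ₐ[ℂ] DiscForms q κ :=
  lift hq ((ofDisc q κ).comp (Disc.scale u).toAlgHom) ((t * u) • dz q κ) ((t * ↑u⁻¹) • dzs q κ)
    (fun f => by simp [ofDisc_mul_dz hq, Disc.twist, Disc.scale_comm u])
    (fun f => by simp [ofDisc_mul_dzs hq, Disc.twist, Disc.scale_comm u])
    (by rw [smul_mul_smul_comm, smul_mul_smul_comm, dz_mul_dzs, smul_comm, mul_comm (t * ↑u)])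
    (by rw [smul_mul_smul_comm, dz_mul_dz, smul_zero])
    (by rw [smul_mul_smul_comm, dzs_mul_dzs, smul_zero])

section Dilate

variable (hq : 0 < q) (u v : ℂˣ) (s t : ℂ)

@[simp] lemma dilate_ofDisc (f : Disc q κ) :
    dilate hq u t (ofDisc q κ f) = ofDisc q κ (Disc.scale u f) := by
  simp [dilate]

@[simp] lemma dilate_z : dilate hq u t (z q κ) = (u : ℂ) • z q κ := by
  simpa using dilate_ofDisc hq u t (Disc.z q κ)

@[simp] lemma dilate_zs : dilate hq u t (zs q κ) = (↑u⁻¹ : ℂ) • zs q κ := by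
  simpa using dilate_ofDisc hq u t (Disc.zs q κ)

@[simp] lemma dilate_dz : dilate hq u t (dz q κ) = (t * u) • dz q κ := by
  simp [dilate]

@[simp] lemma dilate_dzs : dilate hq u t (dzs q κ) = (t * ↑u⁻¹) • dzs q κ := by
  simp [dilate]

lemma dilate_comm (ω : DiscForms q κ) :
    dilate hq u s (dilate hq v t ω) = dilate hq v t (dilate hq u s ω) := by
  have h : (dilate hq u s).comp (dilate hq v t) =
      (dilate hq v t).comp (dilate hq u s : DiscForms q κ →ₐ[ℂ] _) :=
    algHom_ext (by simp [smul_smul, mul_comm]) (by simp [smul_smul, mul_comm])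
      (by simp [smul_smul, mul_comm]) (by simp [smul_smul, mul_comm])
  exact DFunLike.congr_fun h ω

end Dilate

section Differential

variable (hq : 0 < q)

@[simp] lemma d_dz : d κ hq (dz q κ) = 0 := by
  simp [d, leibnizHom_gen, leibnizGen]

@[simp] lemma d_dzs : d κ hq (dzs q κ) = 0 := by
  simp [d, leibnizHom_gen, leibnizGen]

lemma leibnizHom_apply (ω : DiscForms q κ) :
    leibnizHom κ hq ω = !![dilate hq 1 (-1) ω, d κ hq ω; 0, ω] := by
  have hd (ω : DiscForms q κ) : leibnizHom κ hq ω 0 1 = d κ hq ω := rfl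
  have key : leibnizHom κ hq ω 0 0 = dilate hq 1 (-1) ω ∧ leibnizHom κ hq ω 1 0 = 0 ∧
      leibnizHom κ hq ω 1 1 = ω := by
    induction ω using induction_on with
    | algebraMap c => simp [Matrix.algebraMap_matrix_apply]
    | add ω η hω hη => simp [hω, hη]
    | mul ω η hω hη => simp [Matrix.mul_apply, hω, hη]
    | _ => simp [leibnizHom_gen, leibnizGen]
  ext i j
  fin_cases i <;> fin_cases j <;> simp [key, hd]

lemma d_mul (ω η : DiscForms q κ) :
    d κ hq (ω * η) = dilate hq 1 (-1) ω * d κ hq η + d κ hq ω * η := by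
  have h := congrFun₂ (map_mul (leibnizHom κ hq) ω η) 0 1
  simpa [leibnizHom_apply, Matrix.mul_apply] using h

@[simp] lemma d_algebraMap (c : ℂ) : d κ hq (algebraMap ℂ _ c) = 0 := by
  simp [d, Matrix.algebraMap_matrix_apply]

lemma dilate_d (u : ℂˣ) (t : ℂ) (ω : DiscForms q κ) :
    dilate hq u t (d κ hq ω) = t • d κ hq (dilate hq u t ω) := by
  induction ω using induction_on with
  | z => simp [d_z, smul_smul]
  | zs => simp [d_zs, smul_smul]
  | add ω η hω hη => simp only [map_add, smul_add, hω, hη]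
  | mul ω η hω hη =>
    rw [d_mul, map_add, map_mul, map_mul, hω, hη, map_mul, d_mul, dilate_comm hq u 1, smul_add,
      mul_smul_comm, smul_mul_assoc]
  | _ => simp

lemma d_d (ω : DiscForms q κ) : d κ hq (d κ hq ω) = 0 := by
  induction ω using induction_on with
  | z => simp [d_z]
  | zs => simp [d_zs]
  | add ω η hω hη => rw [map_add, map_add, hω, hη, add_zero]
  | mul ω η hω hη =>
    rw [d_mul, map_add, d_mul, d_mul, hω, hη, dilate_d, mul_zero, zero_mul, neg_one_smul]
    simp
  | _ => simp

lemma d_ofDisc_mul (f g : Disc q κ) : d κ hq (ofDisc q κ (f * g)) =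
    ofDisc q κ f * d κ hq (ofDisc q κ g) + d κ hq (ofDisc q κ f) * ofDisc q κ g := by
  rw [map_mul, d_mul, dilate_ofDisc, Disc.scale_one]

end Differential
end DiscForms

/-! ### Coordinates of forms -/

namespace DiscForms

variable {q κ : ℝ}

/-- The one-form `dz f + dz* g`. -/
def oneForm : Disc q κ × Disc q κ →ₗ[ℂ] DiscForms q κ :=
  (LinearMap.mulLeft ℂ (dz q κ) ∘ₗ (ofDisc q κ).toLinearMap).coprod
    (LinearMap.mulLeft ℂ (dzs q κ) ∘ₗ (ofDisc q κ).toLinearMap)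

lemma oneForm_apply (f g : Disc q κ) :
    oneForm (f, g) = dz q κ * ofDisc q κ f + dzs q κ * ofDisc q κ g := rfl

/-- The two-form `(dz ∧ dz*) f`. -/
def twoForm : Disc q κ →ₗ[ℂ] DiscForms q κ :=
  LinearMap.mulLeft ℂ (dz q κ * dzs q κ) ∘ₗ (ofDisc q κ).toLinearMap

lemma twoForm_apply (f : Disc q κ) : twoForm f = dz q κ * dzs q κ * ofDisc q κ f := rfl

section Mul

variable (f g h f' g' : Disc q κ)

lemma oneForm_mul_ofDisc : oneForm (f, g) * ofDisc q κ h = oneForm (f * h, g * h) := by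
  simp only [oneForm_apply, add_mul, mul_assoc, map_mul]

lemma twoForm_mul_ofDisc : twoForm f * ofDisc q κ h = twoForm (f * h) := by
  rw [twoForm_apply, twoForm_apply, mul_assoc, map_mul]

lemma dz_mul_oneForm : dz q κ * oneForm (f, g) = twoForm g := by
  rw [oneForm_apply, mul_add, ← mul_assoc, ← mul_assoc, dz_mul_dz, zero_mul, zero_add,
    twoForm_apply]

lemma dz_mul_twoForm : dz q κ * twoForm f = 0 := by
  rw [twoForm_apply, ← mul_assoc, ← mul_assoc, dz_mul_dz, zero_mul, zero_mul]

variable (hq : 0 < q)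

include hq in
lemma dzs_mul_oneForm : dzs q κ * oneForm (f, g) = twoForm (-(q : ℂ) • f) := by
  rw [oneForm_apply, mul_add, ← mul_assoc, ← mul_assoc, dzs_mul_dzs, zero_mul, add_zero,
    dzs_mul_dz hq.ne', map_smul, twoForm_apply, smul_mul_assoc]

include hq in
lemma dzs_mul_twoForm : dzs q κ * twoForm f = 0 := by
  rw [twoForm_apply, ← mul_assoc, ← mul_assoc, dzs_mul_dz hq.ne', smul_mul_assoc, mul_assoc,
    dzs_mul_dzs, mul_zero, smul_zero, zero_mul]

lemma ofDisc_mul_oneForm : ofDisc q κ h * oneForm (f, g) =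
    oneForm (Disc.twist κ hq h * f, Disc.twist κ hq h * g) := by
  simp only [oneForm_apply, mul_add, ← mul_assoc, ofDisc_mul_dz hq, ofDisc_mul_dzs hq, map_mul]

lemma ofDisc_mul_twoForm : ofDisc q κ h * twoForm f =
    twoForm (Disc.twist κ hq (Disc.twist κ hq h) * f) := by
  simp only [twoForm_apply, ← mul_assoc, ofDisc_mul_dz hq, map_mul]
  rw [mul_assoc (dz q κ), ofDisc_mul_dzs hq, ← mul_assoc]

lemma oneForm_mul_oneForm : oneForm (f, g) * oneForm (f', g') =
    twoForm (Disc.twist κ hq f * g' - (q : ℂ) • (Disc.twist κ hq g * f')) := by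
  rw [oneForm_apply f, add_mul, mul_assoc, mul_assoc, ofDisc_mul_oneForm _ _ _ hq,
    ofDisc_mul_oneForm _ _ _ hq, dz_mul_oneForm, dzs_mul_oneForm _ _ hq, ← map_add, neg_smul,
    ← sub_eq_add_neg]

end Mul

variable (q κ) in
/-- The coordinates of forms with respect to `1`, `dz`, `dz*` and `dz ∧ dz*`. -/
abbrev Coords : Type := Disc q κ × (Disc q κ × Disc q κ) × Disc q κ

/-- The form `f + dz g + dz* h + (dz ∧ dz*) k` with coordinates `(f, (g, h), k)`. -/
def ofCoords : Coords q κ →ₗ[ℂ] DiscForms q κ :=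
  (ofDisc q κ).toLinearMap.coprod (oneForm.coprod twoForm)

lemma ofCoords_apply (f : Disc q κ) (θ : Disc q κ × Disc q κ) (k : Disc q κ) :
    ofCoords (f, θ, k) = ofDisc q κ f + (oneForm θ + twoForm k) := rfl

section Coords

variable (hq : 0 < q)

lemma ofDisc_mul_ofCoords (f : Disc q κ) (c : Coords q κ) :
    ofDisc q κ f * ofCoords c = ofCoords (f * c.1,
      (Disc.twist κ hq f * c.2.1.1, Disc.twist κ hq f * c.2.1.2),
      Disc.twist κ hq (Disc.twist κ hq f) * c.2.2) := by
  obtain ⟨g, ⟨h, k⟩, l⟩ := c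
  rw [ofCoords_apply, mul_add, mul_add, ← map_mul, ofDisc_mul_oneForm _ _ _ hq,
    ofDisc_mul_twoForm _ _ hq, ofCoords_apply]

lemma dz_mul_ofCoords (c : Coords q κ) :
    dz q κ * ofCoords c = ofCoords (0, (c.1, 0), c.2.1.2) := by
  obtain ⟨f, ⟨g, h⟩, k⟩ := c
  rw [ofCoords_apply, mul_add, mul_add, dz_mul_oneForm, dz_mul_twoForm, ofCoords_apply,
    oneForm_apply]
  simp

include hq in
lemma dzs_mul_ofCoords (c : Coords q κ) :
    dzs q κ * ofCoords c = ofCoords (0, (0, c.1), -(q : ℂ) • c.2.1.1) := by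
  obtain ⟨f, ⟨g, h⟩, k⟩ := c
  rw [ofCoords_apply, mul_add, mul_add, dzs_mul_oneForm _ _ hq, dzs_mul_twoForm _ hq,
    ofCoords_apply, oneForm_apply]
  simp

include hq in
lemma ofCoords_surjective : Function.Surjective (ofCoords (q := q) (κ := κ)) := by
  refine LinearMap.range_eq_top.1 (submodule_eq_top_of_mul_mem (adjoin_eq_top q κ)
    ⟨(1, 0, 0), by simp [ofCoords_apply]⟩ ?_)
  rintro _ hω _ ⟨c, rfl⟩
  obtain rfl | rfl | rfl | rfl := hω
  · rw [← ofDisc_z, ofDisc_mul_ofCoords hq]; exact ⟨_, rfl⟩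
  · rw [← ofDisc_zs, ofDisc_mul_ofCoords hq]; exact ⟨_, rfl⟩
  · rw [dz_mul_ofCoords]; exact ⟨_, rfl⟩
  · rw [dzs_mul_ofCoords hq]; exact ⟨_, rfl⟩

end Coords

/-- The action of functions on the coordinates of forms. -/
def coordsFun (κ : ℝ) (hq : 0 < q) :
    Disc q κ →ₐ[ℂ] Module.End ℂ (Coords q κ) :=
  AlgHom.ofLinearMap
    { toFun f := (LinearMap.mulLeft ℂ f).prodMap
        (((LinearMap.mulLeft ℂ (Disc.twist κ hq f)).prodMap
          (LinearMap.mulLeft ℂ (Disc.twist κ hq f))).prodMap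
            (LinearMap.mulLeft ℂ (Disc.twist κ hq (Disc.twist κ hq f))))
      map_add' _ _ := by ext <;> simp [add_mul]
      map_smul' _ _ := by ext <;> simp }
    (by ext <;> simp) fun _ _ => by ext <;> simp

/-- The action of `dz` on the coordinates of forms. -/
def coordsDz : Module.End ℂ (Coords q κ) where
  toFun c := (0, (c.1, 0), c.2.1.2)
  map_add' _ _ := by simp
  map_smul' _ _ := by simp

/-- The action of `dz*` on the coordinates of forms. -/
def coordsDzs : Module.End ℂ (Coords q κ) where
  toFun c := (0, (0, c.1), -(q : ℂ) • c.2.1.1)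
  map_add' _ _ := by simp
  map_smul' r _ := by simp [smul_comm r]

/-- The left multiplication of forms, in coordinates. -/
def coordsLmul (κ : ℝ) (hq : 0 < q) :
    DiscForms q κ →ₐ[ℂ] Module.End ℂ (Coords q κ) :=
  lift hq (coordsFun κ hq) coordsDz coordsDzs
    (fun f => by ext <;> simp [coordsFun, coordsDz])
    (fun f => by ext <;> simp [coordsFun, coordsDzs])
    (by
      have hq' : (q : ℂ) ≠ 0 := Complex.ofReal_ne_zero.2 hq.ne'
      ext <;> simp [coordsDz, coordsDzs, smul_smul, hq', -Complex.coe_smul])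
    (by ext <;> simp [coordsDz])
    (by ext <;> simp [coordsDzs])

lemma coordsLmul_ofCoords (hq : 0 < q) (c : Coords q κ) :
    coordsLmul κ hq (ofCoords c) (1, 0, 0) = c := by
  obtain ⟨f, ⟨g, h⟩, k⟩ := c
  simp [ofCoords_apply, oneForm_apply, twoForm_apply, coordsLmul, coordsFun, coordsDz, coordsDzs]

lemma ofCoords_injective (hq : 0 < q) : Function.Injective (ofCoords (q := q) (κ := κ)) :=
  fun c c' h => by rw [← coordsLmul_ofCoords hq c, h, coordsLmul_ofCoords]

lemma ofDisc_injective (hq : 0 < q) : Function.Injective (ofDisc q κ) := fun f g h => by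
  have := @ofCoords_injective q κ hq (f, 0, 0) (g, 0, 0) (by simp [ofCoords_apply, h])
  exact congrArg Prod.fst this

lemma oneForm_injective (hq : 0 < q) : Function.Injective (oneForm (q := q) (κ := κ)) :=
  fun θ η h => by
    have := @ofCoords_injective q κ hq (0, θ, 0) (0, η, 0) (by simp [ofCoords_apply, h])
    exact congrArg (Prod.fst ∘ Prod.snd) this

lemma twoForm_injective (hq : 0 < q) : Function.Injective (twoForm (q := q) (κ := κ)) :=
  fun f g h => by
    have := @ofCoords_injective q κ hq (0, 0, f) (0, 0, g) (by simp [ofCoords_apply, h])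
    exact congrArg (Prod.snd ∘ Prod.snd) this

/-! ### Invariant forms -/

section Invariants

/-- The forms of degree `n` which are invariant under the `N`-th roots of unity. Instead of the
degree, the definition records the eigenvalue `t ^ n` of the dilation by `t`. -/
def invariants (κ : ℝ) (hq : 0 < q) (N n : ℕ) : Submodule ℂ (DiscForms q κ) where
  carrier := {ω | ∀ (u : ℂˣ) (t : ℂ), u ^ N = 1 → dilate hq u t ω = t ^ n • ω}
  add_mem' hω hη u t hu := by rw [map_add, hω u t hu, hη u t hu, smul_add]
  zero_mem' u t _ := by simp
  smul_mem' c ω hω u t hu := by rw [map_smul, hω u t hu, smul_comm]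

variable {hq : 0 < q} {N m n : ℕ} {ω η : DiscForms q κ}

lemma mul_mem_invariants (hω : ω ∈ invariants κ hq N m) (hη : η ∈ invariants κ hq N n) :
    ω * η ∈ invariants κ hq N (m + n) := fun u t hu => by
  rw [map_mul, hω u t hu, hη u t hu, smul_mul_smul_comm, pow_add]

lemma d_mem_invariants (hω : ω ∈ invariants κ hq N n) :
    d κ hq ω ∈ invariants κ hq N (n + 1) := fun u t hu => by
  rw [dilate_d, hω u t hu, map_smul, smul_smul, pow_succ']

lemma d_mul_of_mem_invariants (hω : ω ∈ invariants κ hq N n) (η : DiscForms q κ) :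
    d κ hq (ω * η) = d κ hq ω * η + (-1 : ℂ) ^ n • (ω * d κ hq η) := by
  rw [d_mul, hω 1 (-1) (one_pow N), smul_mul_assoc, add_comm]

lemma two_pow_injective : Function.Injective fun n : ℕ => (2 : ℂ) ^ n := fun m n h =>
  Nat.pow_right_injective le_rfl (Nat.cast_injective (R := ℂ) (by simpa using h))

lemma iSupIndep_invariants : iSupIndep (invariants κ hq N) :=
  ((Module.End.eigenspaces_iSupIndep (dilate hq 1 2).toLinearMap).comp two_pow_injective).mono
    fun _ _ hω => Module.End.mem_eigenspace_iff.2 (hω 1 2 (one_pow N))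

lemma ofDisc_mem_invariants {f : Disc q κ} (hf : f ∈ Disc.weight q κ N 0) :
    ofDisc q κ f ∈ invariants κ hq N 0 := fun u t hu => by
  rw [dilate_ofDisc, hf u hu, zpow_zero, pow_zero, Units.val_one, one_smul, one_smul]

lemma dilate_ofCoords (u : ℂˣ) (t : ℂ) (f g h k : Disc q κ) :
    dilate hq u t (ofCoords (f, (g, h), k)) = ofCoords (Disc.scale u f,
      ((t * u) • Disc.scale u g, (t * ↑u⁻¹) • Disc.scale u h), t ^ 2 • Disc.scale u k) := by
  simp [ofCoords_apply, oneForm_apply, twoForm_apply, smul_smul, pow_two, mul_mul_mul_comm t]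

lemma ofCoords_mem_invariants_iff {f g h k : Disc q κ} :
    ofCoords (f, (g, h), k) ∈ invariants κ hq N n ↔ ∀ (u : ℂˣ) (t : ℂ), u ^ N = 1 →
      Disc.scale u f = t ^ n • f ∧ ((t * u) • Disc.scale u g = t ^ n • g ∧
        (t * ↑u⁻¹) • Disc.scale u h = t ^ n • h) ∧ t ^ 2 • Disc.scale u k = t ^ n • k := by
  refine forall₃_congr fun u t _ => ?_
  rw [dilate_ofCoords, ← ofCoords.map_smul, (ofCoords_injective hq).eq_iff]
  simp only [Prod.smul_mk, Prod.mk.injEq]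

lemma eq_zero_of_two_pow_smul_eq {V : Type*} [AddCommGroup V] [Module ℂ V] {v : V}
    (h : (2 : ℂ) ^ m • v = (2 : ℂ) ^ n • v) (hmn : m ≠ n) : v = 0 := by
  rw [← sub_eq_zero, ← sub_smul] at h
  exact (smul_eq_zero.1 h).resolve_left (sub_ne_zero.2 fun h => hmn (two_pow_injective h))

variable (κ hq N) in
lemma invariants_one : invariants κ hq N 1 =
    ((Disc.weight q κ N (-1)).prod (Disc.weight q κ N 1)).map oneForm := by
  ext ω
  rw [Submodule.mem_map]
  refine ⟨fun hω => ?_, ?_⟩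
  · obtain ⟨⟨f, ⟨g, h⟩, k⟩, rfl⟩ := ofCoords_surjective hq ω
    rw [ofCoords_mem_invariants_iff] at hω
    obtain ⟨hf, -, hk⟩ := hω 1 2 (one_pow N)
    obtain rfl : f = 0 := eq_zero_of_two_pow_smul_eq (m := 0) (n := 1) (by simpa using hf) (by simp)
    obtain rfl : k = 0 := eq_zero_of_two_pow_smul_eq (m := 2) (n := 1) (by simpa using hk) (by simp)
    refine ⟨(g, h), ⟨fun u hu => ?_, fun u hu => ?_⟩, by simp [ofCoords_apply]⟩
    · obtain ⟨-, ⟨hg, -⟩, -⟩ := hω u 1 hu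
      rw [zpow_neg_one, Units.val_inv_eq_inv_val, eq_inv_smul_iff₀ u.ne_zero]
      simpa using hg
    · obtain ⟨-, ⟨-, hh⟩, -⟩ := hω u 1 hu
      rw [zpow_one, ← inv_smul_eq_iff₀ u.ne_zero]
      simpa using hh
  · rintro ⟨⟨g, h⟩, ⟨hg, hh⟩, rfl⟩
    rw [show oneForm (g, h) = ofCoords (0, (g, h), 0) by simp [ofCoords_apply],
      ofCoords_mem_invariants_iff]
    intro u t hu
    refine ⟨by simp, ⟨?_, ?_⟩, by simp⟩
    · rw [hg u hu, smul_smul]; simp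
    · rw [hh u hu, smul_smul]; simp

variable (κ hq N) in
lemma invariants_two :
    invariants κ hq N 2 = (Disc.weight q κ N 0).map twoForm := by
  ext ω
  rw [Submodule.mem_map]
  refine ⟨fun hω => ?_, ?_⟩
  · obtain ⟨⟨f, ⟨g, h⟩, k⟩, rfl⟩ := ofCoords_surjective hq ω
    rw [ofCoords_mem_invariants_iff] at hω
    obtain ⟨hf, ⟨hg, hh⟩, -⟩ := hω 1 2 (one_pow N)
    obtain rfl : f = 0 := eq_zero_of_two_pow_smul_eq (m := 0) (n := 2) (by simpa using hf) (by simp)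
    obtain rfl : g = 0 := eq_zero_of_two_pow_smul_eq (m := 1) (n := 2) (by simpa using hg) (by simp)
    obtain rfl : h = 0 := eq_zero_of_two_pow_smul_eq (m := 1) (n := 2) (by simpa using hh) (by simp)
    refine ⟨k, fun u hu => ?_, by simp [ofCoords_apply, oneForm_apply]⟩
    simpa using (hω u 1 hu).2.2
  · rintro ⟨k, hk, rfl⟩
    rw [show twoForm k = ofCoords (0, (0, 0), k) by simp [ofCoords_apply, oneForm_apply]]
    refine ofCoords_mem_invariants_iff.2 fun u t hu => ?_
    simp [hk u hu]

variable (κ hq N) in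
lemma invariants_eq_bot (hn : 2 < n) : invariants κ hq N n = ⊥ := by
  refine (Submodule.eq_bot_iff _).2 fun ω hω => ?_
  obtain ⟨⟨f, ⟨g, h⟩, k⟩, rfl⟩ := ofCoords_surjective hq ω
  rw [ofCoords_mem_invariants_iff] at hω
  obtain ⟨hf, ⟨hg, hh⟩, hk⟩ := hω 1 2 (one_pow N)
  obtain rfl : f = 0 := eq_zero_of_two_pow_smul_eq (m := 0) (n := n) (by simpa using hf) (by lia)
  obtain rfl : g = 0 := eq_zero_of_two_pow_smul_eq (m := 1) (n := n) (by simpa using hg) (by lia)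
  obtain rfl : h = 0 := eq_zero_of_two_pow_smul_eq (m := 1) (n := n) (by simpa using hh) (by lia)
  obtain rfl : k = 0 := eq_zero_of_two_pow_smul_eq (m := 2) (n := n) (by simpa using hk) (by lia)
  exact map_zero ofCoords

end Invariants

end DiscForms

namespace DiscForms

variable {q κ : ℝ}

section Differential

variable (hq : 0 < q)

lemma d_ofDisc_z : d κ hq (ofDisc q κ (Disc.z q κ)) = oneForm (1, 0) := by
  simp [oneForm_apply, d_z]

lemma d_ofDisc_zs : d κ hq (ofDisc q κ (Disc.zs q κ)) = oneForm (0, 1) := by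
  simp [oneForm_apply, d_zs]

lemma ofDisc_normalElt_mul_d (f : Disc q κ) :
    ofDisc q κ (Disc.normalElt q κ) * d κ hq (ofDisc q κ f) =
      oneForm (Disc.zs q κ * f - f * Disc.zs q κ, f * Disc.z q κ - Disc.z q κ * f) := by
  induction f using Disc.induction_on with
  | z =>
    rw [d_ofDisc_z, ofDisc_mul_oneForm _ _ _ hq, Disc.twist_normalElt, Disc.normalElt_eq, mul_one,
      mul_zero, sub_self]
  | zs =>
    rw [d_ofDisc_zs, ofDisc_mul_oneForm _ _ _ hq, Disc.twist_normalElt, Disc.normalElt_eq, mul_one,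
      mul_zero, sub_self]
  | algebraMap c => simp [Algebra.commutes, oneForm_apply]
  | add f g hf hg =>
    rw [map_add, map_add, mul_add, hf, hg, ← map_add, Prod.mk_add_mk]
    congr 2 <;> noncomm_ring
  | mul f g hf hg =>
    have hn := Disc.mul_normalElt hq ((Disc.twist κ hq).symm f)
    rw [AlgEquiv.apply_symm_apply] at hn
    rw [d_ofDisc_mul, mul_add, ← mul_assoc, ← map_mul, ← hn, map_mul, mul_assoc, hg, ← mul_assoc,
      hf, ofDisc_mul_oneForm _ _ _ hq, oneForm_mul_ofDisc, AlgEquiv.apply_symm_apply, ← map_add,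
      Prod.mk_add_mk]
    congr 2 <;> noncomm_ring

lemma exists_eq_algebraMap_of_d_eq_zero (hκ : κ ≠ 0) {f : Disc q κ}
    (hf : d κ hq (ofDisc q κ f) = 0) : ∃ c : ℂ, f = algebraMap ℂ _ c := by
  have h := ofDisc_normalElt_mul_d hq f
  rw [hf, mul_zero, ← map_zero oneForm, (oneForm_injective hq).eq_iff, eq_comm, Prod.mk_eq_zero,
    sub_eq_zero, sub_eq_zero] at h
  exact Disc.exists_eq_algebraMap_of_commute hq hκ h.2.symm h.1

lemma d_ofDisc_pow_succ {f : Disc q κ} {c : ℂ}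
    (h : ofDisc q κ f * d κ hq (ofDisc q κ f) = c • (d κ hq (ofDisc q κ f) * ofDisc q κ f))
    (n : ℕ) : d κ hq (ofDisc q κ (f ^ (n + 1))) =
      (∑ i ∈ Finset.range (n + 1), c ^ i) • (d κ hq (ofDisc q κ f) * ofDisc q κ (f ^ n)) := by
  induction n with
  | zero => simp
  | succ n ih =>
    rw [pow_succ' f, d_ofDisc_mul, ih, mul_smul_comm, ← mul_assoc, h, smul_mul_assoc, mul_assoc,
      ← map_mul, ← pow_succ', smul_smul, geom_sum_succ (n := n + 1), add_smul, one_smul, mul_comm c]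

lemma geom_sum_ofReal_ne_zero {r : ℝ} (hr : 0 < r) (n : ℕ) :
    ∑ i ∈ Finset.range (n + 1), (r : ℂ) ^ i ≠ 0 := by
  exact_mod_cast (Finset.sum_pos (fun i _ => pow_pos hr i) Finset.nonempty_range_add_one).ne'

lemma exists_d_z_pow {N : ℕ} (hN : 0 < N) : ∃ c : ℂ, c ≠ 0 ∧
    d κ hq (ofDisc q κ (Disc.z q κ ^ N)) = c • oneForm (Disc.z q κ ^ (N - 1), 0) := by
  obtain ⟨n, rfl⟩ := Nat.exists_eq_add_one.2 hN
  refine ⟨_, geom_sum_ofReal_ne_zero (inv_pos.2 hq) n, ?_⟩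
  rw [d_ofDisc_pow_succ hq (c := (q⁻¹ : ℝ)), d_ofDisc_z, oneForm_mul_ofDisc, one_mul, zero_mul,
    Nat.add_sub_cancel]
  rw [d_ofDisc_z, ofDisc_mul_oneForm _ _ _ hq, oneForm_mul_ofDisc, ← map_smul, Disc.twist_z]
  simp

lemma exists_d_zs_pow {N : ℕ} (hN : 0 < N) : ∃ c : ℂ, c ≠ 0 ∧
    d κ hq (ofDisc q κ (Disc.zs q κ ^ N)) = c • oneForm (0, Disc.zs q κ ^ (N - 1)) := by
  obtain ⟨n, rfl⟩ := Nat.exists_eq_add_one.2 hN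
  refine ⟨_, geom_sum_ofReal_ne_zero hq n, ?_⟩
  rw [d_ofDisc_pow_succ hq (c := q), d_ofDisc_zs, oneForm_mul_ofDisc, one_mul, zero_mul,
    Nat.add_sub_cancel]
  rw [d_ofDisc_zs, ofDisc_mul_oneForm _ _ _ hq, oneForm_mul_ofDisc, ← map_smul, Disc.twist_zs]
  simp

lemma d_ofDisc_x : d κ hq (ofDisc q κ (Disc.x q κ)) =
    oneForm (Disc.zs q κ, (q : ℂ)⁻¹ • Disc.z q κ) := by
  rw [Disc.x, d_ofDisc_mul, d_ofDisc_z, d_ofDisc_zs, ofDisc_mul_oneForm _ _ _ hq,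
    oneForm_mul_ofDisc, ← map_add, Disc.twist_z]
  simp

lemma d_x_mul_sub_x_mul_d_x :
    d κ hq (ofDisc q κ (Disc.x q κ)) * ofDisc q κ (Disc.zs q κ * Disc.z q κ) -
      ofDisc q κ (Disc.x q κ) * d κ hq (ofDisc q κ (Disc.x q κ)) =
    (1 + (q : ℂ)) • oneForm (Disc.normalElt q κ * Disc.zs q κ, 0) := by
  have h := Disc.mul_normalElt hq (Disc.zs q κ)
  rw [Disc.twist_zs, mul_smul_comm] at h
  have h₁ : Disc.zs q κ * (Disc.zs q κ * Disc.z q κ) - Disc.x q κ * Disc.zs q κ =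
      (1 + (q : ℂ)) • (Disc.normalElt q κ * Disc.zs q κ) := by
    rw [add_smul, one_smul, ← h, Disc.normalElt_eq, Disc.x]
    noncomm_ring
  rw [d_ofDisc_x, oneForm_mul_ofDisc, ofDisc_mul_oneForm _ _ _ hq, Disc.twist_x, ← map_sub,
    Prod.mk_sub_mk, h₁, ← map_smul, Prod.smul_mk, smul_zero, smul_mul_assoc, mul_smul_comm,
    Disc.x, mul_assoc, sub_self]

lemma mul_d_x_sub_d_x_mul :
    ofDisc q κ (Disc.zs q κ * Disc.z q κ) * d κ hq (ofDisc q κ (Disc.x q κ)) -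
      d κ hq (ofDisc q κ (Disc.x q κ)) * ofDisc q κ (Disc.x q κ) =
    ((q : ℂ)⁻¹ * (1 + (q : ℂ)⁻¹)) • oneForm (0, Disc.normalElt q κ * Disc.z q κ) := by
  have h := Disc.mul_normalElt hq (Disc.z q κ)
  rw [Disc.twist_z, mul_smul_comm] at h
  have h₂ : Disc.zs q κ * Disc.z q κ * Disc.z q κ - Disc.z q κ * Disc.x q κ =
      (1 + (q : ℂ)⁻¹) • (Disc.normalElt q κ * Disc.z q κ) := by
    rw [add_smul, one_smul, ← h, Disc.normalElt_eq, Disc.x]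
    noncomm_ring
  have ht : Disc.twist κ hq (Disc.zs q κ * Disc.z q κ) = Disc.zs q κ * Disc.z q κ := by
    rw [Disc.zs_mul_z_eq_aeval hq, Disc.twist_aeval_x]
  rw [d_ofDisc_x, oneForm_mul_ofDisc, ofDisc_mul_oneForm _ _ _ hq, ht, ← map_sub, ← map_smul,
    Prod.mk_sub_mk, mul_smul_comm, smul_mul_assoc, ← smul_sub, h₂, Prod.smul_mk, smul_zero,
    smul_smul, Disc.x, mul_assoc, sub_self]

end Differential

end DiscForms

/-! ### The calculus over the quantum cone -/

namespace Cone

open DiscForms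

variable {N : ℕ} {q κ : ℝ} {hq : 0 < q} {n : ℕ}

lemma ofDisc_coneToDisc_mem_invariants (a : Cone N q κ) :
    ofDisc q κ (coneToDisc N κ hq a) ∈ invariants κ hq N 0 :=
  ofDisc_mem_invariants (coneToDisc_mem_weight_zero hq a)

/-- The `n`-forms of the quantum cone, as a subspace of the forms of the quantum disc. -/
def forms (κ : ℝ) (hq : 0 < q) (N n : ℕ) : Submodule ℂ (DiscForms q κ) :=
  (coneCalculus N κ hq).forms n

lemma forms_le_invariants : forms κ hq N n ≤ invariants κ hq N n := by
  refine Submodule.span_le.2 ?_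
  rintro _ ⟨a, l, rfl, rfl⟩
  refine zero_add l.length ▸ mul_mem_invariants (ofDisc_coneToDisc_mem_invariants a) ?_
  induction l with
  | nil =>
    have h := ofDisc_coneToDisc_mem_invariants (hq := hq) (1 : Cone N q κ)
    rwa [map_one, map_one] at h
  | cons b l ih =>
    rw [List.map_cons, List.prod_cons, List.length_cons, add_comm]
    exact mul_mem_invariants (d_mem_invariants (ofDisc_coneToDisc_mem_invariants b)) ih

variable (κ hq) in
/-- The restriction of the calculus over the quantum disc to the quantum cone, as a differential
calculus. -/
def calculus (hN : 0 < N) : DifferentialCalculus (Cone N q κ) where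
  toCalculusData := coneCalculus N κ hq
  ι_injective := (ofDisc_injective hq).comp (coneToDisc_injective hq hN)
  independent := iSupIndep_invariants.mono fun _ => forms_le_invariants
  leibniz _ _ _ hω η _ := d_mul_of_mem_invariants (forms_le_invariants hω) η
  d_d _ ω _ := DiscForms.d_d hq ω

variable (hN : 0 < N)

lemma calculus_isConnected (hκ : κ ≠ 0) : (calculus κ hq hN).IsConnected := by
  refine fun a => ⟨fun h => ?_, ?_⟩
  · obtain ⟨c, hc⟩ := exists_eq_algebraMap_of_d_eq_zero hq hκ h
    refine ⟨c, coneToDisc_injective hq hN ?_⟩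
    rw [map_smul, map_one, ← Algebra.algebraMap_eq_smul_one]
    exact hc
  · rintro ⟨c, rfl⟩
    rw [map_smul, map_smul, DifferentialCalculus.d_ι_one, smul_zero]

include hN

section Bimodule

variable {f : Disc q κ} {ω : DiscForms q κ}

lemma ofDisc_mul_mem_forms (hf : f ∈ Disc.weight q κ N 0)
    (hω : ω ∈ forms κ hq N n) : ofDisc q κ f * ω ∈ forms κ hq N n := by
  rw [← range_coneToDisc hq hN] at hf
  obtain ⟨a, rfl⟩ := hf
  exact (calculus κ hq hN).forms_ι_mul a hω

lemma mul_ofDisc_mem_forms (hf : f ∈ Disc.weight q κ N 0)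
    (hω : ω ∈ forms κ hq N n) : ω * ofDisc q κ f ∈ forms κ hq N n := by
  rw [← range_coneToDisc hq hN] at hf
  obtain ⟨a, rfl⟩ := hf
  exact (calculus κ hq hN).forms_mul_ι a hω

lemma mul_mem_forms {m : ℕ} {η : DiscForms q κ} (hω : ω ∈ forms κ hq N m)
    (hη : η ∈ forms κ hq N n) : ω * η ∈ forms κ hq N (m + n) :=
  (calculus κ hq hN).mul_mem_forms hω hη

lemma d_ofDisc_mem_forms (hf : f ∈ Disc.weight q κ N 0) :
    d κ hq (ofDisc q κ f) ∈ forms κ hq N 1 := by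
  rw [← range_coneToDisc hq hN] at hf
  obtain ⟨a, rfl⟩ := hf
  exact (calculus κ hq hN).d_ι_mem_forms a

end Bimodule

lemma oneForm_normalElt_mul_zs_mem_forms :
    oneForm (Disc.normalElt q κ * Disc.zs q κ, 0) ∈ forms κ hq N 1 := by
  have hx : Disc.x q κ ∈ Disc.weight q κ N 0 := by simpa using Disc.aeval_x_mem_weight X
  have hx' : Disc.zs q κ * Disc.z q κ ∈ Disc.weight q κ N 0 := by
    rw [Disc.zs_mul_z_eq_aeval hq]
    exact Disc.aeval_x_mem_weight _
  have hc : 1 + (q : ℂ) ≠ 0 := by exact_mod_cast (add_pos one_pos hq).ne'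
  rw [← Submodule.smul_mem_iff _ hc, ← d_x_mul_sub_x_mul_d_x hq]
  exact sub_mem (mul_ofDisc_mem_forms hN hx' (d_ofDisc_mem_forms hN hx))
    (ofDisc_mul_mem_forms hN hx (d_ofDisc_mem_forms hN hx))

lemma oneForm_normalElt_mul_z_mem_forms :
    oneForm (0, Disc.normalElt q κ * Disc.z q κ) ∈ forms κ hq N 1 := by
  have hx : Disc.x q κ ∈ Disc.weight q κ N 0 := by simpa using Disc.aeval_x_mem_weight X
  have hx' : Disc.zs q κ * Disc.z q κ ∈ Disc.weight q κ N 0 := by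
    rw [Disc.zs_mul_z_eq_aeval hq]
    exact Disc.aeval_x_mem_weight _
  have hc : (q : ℂ)⁻¹ * (1 + (q : ℂ)⁻¹) ≠ 0 := by
    exact_mod_cast (mul_pos (inv_pos.2 hq) (add_pos one_pos (inv_pos.2 hq))).ne'
  rw [← Submodule.smul_mem_iff _ hc, ← mul_d_x_sub_d_x_mul hq]
  exact sub_mem (ofDisc_mul_mem_forms hN hx' (d_ofDisc_mem_forms hN hx))
    (mul_ofDisc_mem_forms hN hx (d_ofDisc_mem_forms hN hx))

lemma oneForm_z_pow_mem_forms :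
    oneForm (Disc.z q κ ^ (N - 1), 0) ∈ forms κ hq N 1 := by
  obtain ⟨c, hc, h⟩ := exists_d_z_pow hq (κ := κ) hN
  rw [← Submodule.smul_mem_iff _ hc, ← h, ← coneToDisc_b hq]
  exact (calculus κ hq hN).d_ι_mem_forms (b N q κ)

lemma oneForm_zs_pow_mem_forms :
    oneForm (0, Disc.zs q κ ^ (N - 1)) ∈ forms κ hq N 1 := by
  obtain ⟨c, hc, h⟩ := exists_d_zs_pow hq (κ := κ) hN
  rw [← Submodule.smul_mem_iff _ hc, ← h, ← coneToDisc_bs hq]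
  exact (calculus κ hq hN).d_ι_mem_forms (bs N q κ)

variable (hκ : κ ≠ 0)

include hκ

lemma oneForm_mem_forms {f g : Disc q κ} (hf : f ∈ Disc.weight q κ N (-1))
    (hg : g ∈ Disc.weight q κ N 1) : oneForm (f, g) ∈ forms κ hq N 1 := by
  obtain ⟨f₁, hf₁, f₂, hf₂, h⟩ := Disc.exists_normalElt_mul_zs_mul_add_z_pow_mul hq hκ hN
  obtain ⟨g₁, hg₁, g₂, hg₂, h'⟩ := Disc.exists_normalElt_mul_z_mul_add_zs_pow_mul hq hκ hN
  have hfg : oneForm (f, g) =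
      oneForm (Disc.normalElt q κ * Disc.zs q κ, 0) * ofDisc q κ (f₁ * f) +
        oneForm (Disc.z q κ ^ (N - 1), 0) * ofDisc q κ (f₂ * f) +
      (oneForm (0, Disc.normalElt q κ * Disc.z q κ) * ofDisc q κ (g₁ * g) +
        oneForm (0, Disc.zs q κ ^ (N - 1)) * ofDisc q κ (g₂ * g)) := by
    simp only [oneForm_mul_ofDisc, ← map_add, Prod.mk_add_mk, zero_mul, add_zero, zero_add,
      ← mul_assoc, ← add_mul, h, h', one_mul]
  rw [hfg]
  exact add_mem
    (add_mem
      (mul_ofDisc_mem_forms hN (Disc.mul_mem_weight hf₁ hf (add_neg_cancel 1))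
        (oneForm_normalElt_mul_zs_mem_forms hN))
      (mul_ofDisc_mem_forms hN (Disc.mul_mem_weight hf₂ hf (add_neg_cancel 1))
        (oneForm_z_pow_mem_forms hN)))
    (add_mem
      (mul_ofDisc_mem_forms hN (Disc.mul_mem_weight hg₁ hg (neg_add_cancel 1))
        (oneForm_normalElt_mul_z_mem_forms hN))
      (mul_ofDisc_mem_forms hN (Disc.mul_mem_weight hg₂ hg (neg_add_cancel 1))
        (oneForm_zs_pow_mem_forms hN)))

lemma forms_one : forms κ hq N 1 = invariants κ hq N 1 := by
  refine le_antisymm forms_le_invariants ?_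
  rw [invariants_one, Submodule.map_le_iff_le_comap]
  exact fun θ hθ => oneForm_mem_forms hN hκ hθ.1 hθ.2

lemma twoForm_mem_forms {f : Disc q κ}
    (hf : f ∈ Disc.weight q κ N (-1) * Disc.weight q κ N 1) : twoForm f ∈ forms κ hq N 2 := by
  induction hf using Submodule.mul_induction_on' with
  | mem_mul_mem f hf g hg =>
    have hfg : twoForm (f * g) = oneForm ((Disc.twist κ hq).symm f, 0) * oneForm (0, g) := by
      simp [oneForm_mul_oneForm _ _ _ _ hq]
    have hf' : oneForm ((Disc.twist κ hq).symm f, 0) ∈ forms κ hq N 1 :=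
      oneForm_mem_forms hN hκ (Disc.twist_symm_mem_weight hq hf) (zero_mem _)
    have hg' : oneForm (0, g) ∈ forms κ hq N 1 := oneForm_mem_forms hN hκ (zero_mem _) hg
    rw [hfg]
    have h := mul_mem_forms hN hf' hg'
    exact h
  | add f _ g _ hf hg => rw [map_add]; exact add_mem hf hg

lemma forms_two : forms κ hq N 2 = invariants κ hq N 2 := by
  refine le_antisymm forms_le_invariants ?_
  rw [invariants_two, Submodule.map_le_iff_le_comap]
  intro f hf
  rw [Submodule.mem_comap, ← one_mul f, ← twoForm_mul_ofDisc]
  exact mul_ofDisc_mem_forms hN hf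
    (twoForm_mem_forms hN hκ (Disc.one_mem_weight_neg_one_mul_weight_one hq hκ hN))

lemma calculus_hasDimension_two : (calculus κ hq hN).HasDimension 2 := by
  refine ⟨?_, fun n hn => ?_⟩
  · have : Nontrivial (Disc q κ) := Disc.nontrivial hq.ne'
    exact (Submodule.ne_bot_iff _).2 ⟨twoForm 1,
      twoForm_mem_forms hN hκ (Disc.one_mem_weight_neg_one_mul_weight_one hq hκ hN),
      (map_ne_zero_iff _ (twoForm_injective hq)).2 one_ne_zero⟩
  · exact eq_bot_iff.2 (forms_le_invariants.trans (invariants_eq_bot κ hq N hn).le)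

end Cone

/-! ### Integrability from volume forms -/

namespace DifferentialCalculus

variable {A : Type} [Ring A] [Algebra ℂ A] {Γ : DifferentialCalculus A} {k m n : ℕ}

lemma exists_eq_ι {ω : Γ.E} (hω : ω ∈ Γ.forms 0) : ∃ a, ω = Γ.ι a := by
  suffices h : Γ.forms 0 ≤ LinearMap.range Γ.ι.toLinearMap by
    obtain ⟨a, ha⟩ := h hω
    exact ⟨a, ha.symm⟩
  refine Submodule.span_le.2 ?_
  rintro _ ⟨a, l, hl, rfl⟩
  rw [List.length_eq_zero_iff.1 hl]
  exact ⟨a, (mul_one _).symm⟩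

variable (Γ n) in
/-- A volume form on a calculus, given by its coefficient functional `Ωⁿ ≃ A`, a right module
isomorphism which is left linear up to the modular automorphism `twist`. The functional is extended
arbitrarily to all forms, so that products of forms need no transport between degrees. -/
structure VolumeForm where
  coeff : Γ.E →ₗ[ℂ] A
  twist : A ≃ₐ[ℂ] A
  bijective : Function.Bijective (coeff.domRestrict (Γ.forms n))
  coeff_mul_ι : ∀ ω ∈ Γ.forms n, ∀ a, coeff (ω * Γ.ι a) = coeff ω * a
  coeff_ι_mul : ∀ ω ∈ Γ.forms n, ∀ a, coeff (Γ.ι a * ω) = twist a * coeff ω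

namespace VolumeForm

section Pairing

variable (V : Γ.VolumeForm n) (h : k + m = n)

lemma mul_mem_forms (h : k + m = n) (ω : Γ.forms k) (η : Γ.forms m) :
    (ω * η : Γ.E) ∈ Γ.forms n :=
  h ▸ Γ.mul_mem_forms ω.2 η.2

/-- The map `ω ↦ (η ↦ ± ∫ ω ∧ η)` from `k`-forms to integral `(n - k)`-forms. The signs make these
maps for varying `k` intertwine `d` with the divergence. -/
def pairing : Γ.forms k →ₗ[ℂ] Γ.integralForms m :=
  LinearMap.codRestrict (Γ.integralForms m)
    ((-1 : ℂ) ^ ((n + 1) * k) •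
      ((LinearMap.mul ℂ Γ.E).compr₂ V.coeff).domRestrict₁₂ (Γ.forms k) (Γ.forms m))
    fun ω η a => by
      change (-1 : ℂ) ^ ((n + 1) * k) • V.coeff (ω * (η * Γ.ι a)) =
        (-1 : ℂ) ^ ((n + 1) * k) • V.coeff (ω * η) * a
      rw [← mul_assoc, V.coeff_mul_ι _ (mul_mem_forms h ω η), smul_mul_assoc]

lemma pairing_apply (ω : Γ.forms k) (η : Γ.forms m) :
    (V.pairing h ω : Γ.forms m →ₗ[ℂ] A) η =
      (-1 : ℂ) ^ ((n + 1) * k) • V.coeff (ω * η) :=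
  rfl

lemma pairing_lsmul_rsmul (a b : A) (ω : Γ.forms k) :
    V.pairing h (lsmul a (rsmul ω b)) = integralBismul (V.twist a) (V.pairing h ω) b := by
  refine Subtype.ext (LinearMap.ext fun η => ?_)
  change (-1 : ℂ) ^ ((n + 1) * k) • V.coeff (Γ.ι a * (ω * Γ.ι b) * η) =
    V.twist a * (-1 : ℂ) ^ ((n + 1) * k) • V.coeff (ω * (Γ.ι b * η))
  rw [mul_smul_comm, mul_assoc, mul_assoc,
    ← V.coeff_ι_mul (ω * (Γ.ι b * η)) (mul_mem_forms h ω (lsmul b η))]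

lemma coeff_eq_zero_iff {ω : Γ.E} (hω : ω ∈ Γ.forms n) : V.coeff ω = 0 ↔ ω = 0 := by
  refine ⟨fun h0 => ?_, fun h0 => by rw [h0, map_zero]⟩
  exact congrArg Subtype.val (V.bijective.1 (a₁ := ⟨ω, hω⟩) (a₂ := 0) (h0.trans (map_zero _).symm))

lemma pairing_injective_iff : Function.Injective (V.pairing h) ↔
    ∀ ω ∈ Γ.forms k, (∀ η ∈ Γ.forms m, ω * η = 0) → ω = 0 := by
  have hker (ω : Γ.forms k) :
      V.pairing h ω = 0 ↔ ∀ η ∈ Γ.forms m, (ω : Γ.E) * η = 0 := by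
    rw [Subtype.ext_iff, LinearMap.ext_iff, Subtype.forall]
    refine forall₂_congr fun η hη => ?_
    rw [pairing_apply, ZeroMemClass.coe_zero, LinearMap.zero_apply,
      smul_eq_zero_iff_right (pow_ne_zero _ (neg_ne_zero.2 one_ne_zero)),
      V.coeff_eq_zero_iff (mul_mem_forms h ω ⟨η, hη⟩)]
  rw [injective_iff_map_eq_zero, Subtype.forall]
  refine forall₂_congr fun ω hω => ?_
  rw [hker, Submodule.mk_eq_zero]

lemma pairing_surjective_iff : Function.Surjective (V.pairing h) ↔
    ∀ φ : Γ.integralForms m, ∃ ω ∈ Γ.forms k, ∀ η : Γ.forms m, V.coeff (ω * η) = φ.1 η := by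
  have hε : (-1 : ℂ) ^ ((n + 1) * k) * (-1 : ℂ) ^ ((n + 1) * k) = 1 := by
    rw [← mul_pow, neg_one_mul, neg_neg, one_pow]
  refine forall_congr' fun φ => ⟨?_, ?_⟩
  · rintro ⟨ω, rfl⟩
    refine ⟨_, ((-1 : ℂ) ^ ((n + 1) * k) • ω).2, fun η => ?_⟩
    rw [pairing_apply, Submodule.coe_smul, smul_mul_assoc, map_smul]
  · rintro ⟨ω, hω, h'⟩
    refine ⟨(-1 : ℂ) ^ ((n + 1) * k) • ⟨ω, hω⟩, Subtype.ext (LinearMap.ext fun η => ?_)⟩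
    rw [pairing_apply, Submodule.coe_smul, smul_mul_assoc, map_smul, smul_smul, hε, one_smul, h']

lemma exists_coeff_eq_one : ∃ v ∈ Γ.forms n, V.coeff v = 1 := by
  obtain ⟨v, hv⟩ := V.bijective.2 1
  exact ⟨v, v.2, hv⟩

lemma pairing_zero_left_bijective : Function.Bijective (V.pairing (zero_add n)) := by
  obtain ⟨v, hv, hv1⟩ := V.exists_coeff_eq_one
  rw [Function.Bijective, pairing_injective_iff, pairing_surjective_iff]
  refine ⟨fun ω hω h0 => ?_, fun φ => ?_⟩
  · obtain ⟨a, rfl⟩ := exists_eq_ι hω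
    have ha : V.twist a = 0 := by
      rw [← mul_one (V.twist a), ← hv1, ← V.coeff_ι_mul v hv, h0 v hv, map_zero]
    rw [(map_eq_zero_iff V.twist V.twist.injective).1 ha, map_zero]
  · refine ⟨Γ.ι (V.twist.symm (φ.1 ⟨v, hv⟩)), Γ.ι_mem_forms _, fun η => ?_⟩
    have hη : rsmul ⟨v, hv⟩ (V.coeff η) = η :=
      V.bijective.1 ((V.coeff_mul_ι v hv _).trans (by rw [hv1, one_mul]; rfl))
    rw [V.coeff_ι_mul _ η.2, AlgEquiv.apply_symm_apply, ← φ.2, hη]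

lemma pairing_zero_right_bijective : Function.Bijective (V.pairing (add_zero n)) := by
  have h1 : (1 : Γ.E) ∈ Γ.forms 0 := map_one Γ.ι ▸ Γ.ι_mem_forms 1
  rw [Function.Bijective, pairing_injective_iff, pairing_surjective_iff]
  refine ⟨fun ω _ h0 => ?_, fun φ => ?_⟩
  · rw [← mul_one ω, h0 1 h1]
  · obtain ⟨ω, hω⟩ := V.bijective.2 (φ.1 ⟨1, h1⟩)
    refine ⟨ω, ω.2, fun η => ?_⟩
    obtain ⟨a, ha⟩ := exists_eq_ι η.2
    have hη : η = rsmul ⟨1, h1⟩ a := Subtype.ext (ha.trans (one_mul _).symm)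
    rw [ha, V.coeff_mul_ι _ ω.2, hη, φ.2, ← hω, LinearMap.domRestrict_apply]

lemma integralAct_pairing {l : ℕ} (h : k + (m + l) = n) (h' : k + m + l = n) (ω : Γ.forms k)
    (η : Γ.forms m) : integralAct (V.pairing h ω) η =
      (-1 : ℂ) ^ ((n + 1) * m) • V.pairing h' (wedge ω η) := by
  refine Subtype.ext (LinearMap.ext fun ξ => ?_)
  change (-1 : ℂ) ^ ((n + 1) * k) • V.coeff (ω * (η * ξ)) =
    (-1 : ℂ) ^ ((n + 1) * m) • (-1 : ℂ) ^ ((n + 1) * (k + m)) • V.coeff (ω * η * ξ)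
  rw [smul_smul, ← pow_add, mul_assoc]
  congr 1
  refine neg_one_pow_congr ?_
  simp only [Nat.even_add, Nat.even_mul, Nat.not_even_one, iff_false]
  tauto

end Pairing

section Divergence

variable {V : Γ.VolumeForm (n + 1)} (hV : Function.Bijective (V.pairing (k := n) (m := 1) rfl))

/-- The divergence `± ∫ ω ∧ - ↦ ∫ dω` on integral one-forms. -/
def divergence : Γ.Divergence where
  toLinearMap := V.coeff ∘ₗ Γ.d ∘ₗ (Γ.forms n).subtype ∘ₗ (LinearEquiv.ofBijective _ hV).symm
  leibniz φ a := by
    obtain ⟨ω, rfl⟩ := hV.2 φ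
    have hω : integralBismul 1 (V.pairing rfl ω) a = V.pairing rfl (rsmul ω a) := by
      rw [← map_one V.twist, ← pairing_lsmul_rsmul]
      congr 1
      exact Subtype.ext ((congrArg (· * _) (map_one Γ.ι)).trans (one_mul _))
    have hsign : (-1 : ℂ) ^ ((n + 1 + 1) * n) = (-1) ^ n := by
      refine neg_one_pow_congr ?_
      simp only [Nat.even_add, Nat.even_mul, Nat.not_even_one, iff_false]
      tauto
    have hinv (η : Γ.forms n) :
        (LinearEquiv.ofBijective _ hV).symm (V.pairing (k := n) (m := 1) rfl η) = η :=
      (LinearEquiv.ofBijective _ hV).symm_apply_apply η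
    simp only [LinearMap.comp_apply, LinearEquiv.coe_coe, Submodule.subtype_apply]
    rw [hω, hinv, hinv, pairing_apply, hsign, ← V.coeff_mul_ι _ (Γ.d_mem_forms ω.2), ← map_smul,
      ← map_add]
    exact congrArg V.coeff (Γ.leibniz n 0 _ ω.2 _ (Γ.ι_mem_forms a))

lemma divergence_pairing (ω : Γ.forms n) :
    (divergence hV).toLinearMap (V.pairing rfl ω) = V.coeff (Γ.d ω) :=
  congrArg (fun η : Γ.forms n => V.coeff (Γ.d η))
    ((LinearEquiv.ofBijective _ hV).symm_apply_apply ω)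

lemma pairing_dForm (h : k + 1 + m = n + 1) (h' : k + (m + 1) = n + 1) (ω : Γ.forms k) :
    V.pairing h (dForm ω) = (divergence hV).extend m (V.pairing h' ω) := by
  obtain rfl : k + m = n := by omega
  refine Subtype.ext (LinearMap.ext fun η => ?_)
  change (-1 : ℂ) ^ ((k + m + 1 + 1) * (k + 1)) • V.coeff (Γ.d ω * η) =
    (divergence hV).toLinearMap (integralAct (V.pairing h' ω) η) +
      (-1 : ℂ) ^ (m + 1) • (-1 : ℂ) ^ ((k + m + 1 + 1) * k) • V.coeff (ω * Γ.d η)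
  have hd : Γ.d (ω * η) = Γ.d ω * η + (-1 : ℂ) ^ k • (ω * Γ.d η) := Γ.leibniz k m _ ω.2 _ η.2
  have hsign : (-1 : ℂ) ^ ((k + m + 1 + 1) * (k + 1)) = (-1) ^ ((k + m + 1 + 1) * m) := by
    refine neg_one_pow_congr ?_
    simp only [Nat.even_add, Nat.even_mul, Nat.not_even_one, iff_false]
    tauto
  have hsign' : (-1 : ℂ) ^ (m + 1) * (-1) ^ ((k + m + 1 + 1) * k) =
      -((-1) ^ ((k + m + 1 + 1) * m) * (-1) ^ k) := by
    rw [← neg_one_mul (_ * _), ← pow_add, ← pow_add, ← pow_succ']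
    refine neg_one_pow_congr ?_
    simp only [Nat.even_add, Nat.even_mul, Nat.not_even_one, iff_false]
    tauto
  rw [V.integralAct_pairing h' rfl, map_smul, divergence_pairing]
  change _ = _ • V.coeff (Γ.d (ω * η)) + _
  rw [hd, map_add, map_smul, smul_add, smul_smul, smul_smul, hsign, hsign', neg_smul,
    add_neg_cancel_right]

lemma divergence_isFlat (hdim : Γ.HasDimension (n + 1))
    (hV' : ∀ k m (h : k + m = n + 1), Function.Surjective (V.pairing h)) :
    (divergence hV).IsFlat := by
  intro φ
  obtain _ | n := n
  · have : Subsingleton (Γ.forms 2) :=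
      Submodule.subsingleton_iff_eq_bot.2 (hdim.2 2 one_lt_two)
    have hφ : φ = 0 :=
      Subtype.ext (LinearMap.ext fun η => by rw [Subsingleton.elim η 0, map_zero, map_zero])
    have h0 : (divergence hV).extend 1 0 = 0 := by
      refine Subtype.ext (LinearMap.ext fun ω => ?_)
      change (divergence hV).toLinearMap 0 + (-1 : ℂ) ^ 2 • (0 : A) = 0
      rw [map_zero, smul_zero, add_zero]
    rw [hφ, h0, map_zero]
  · obtain ⟨ω, rfl⟩ := hV' n 2 rfl φ
    rw [← pairing_dForm hV rfl, divergence_pairing]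
    exact (congrArg V.coeff (Γ.d_d n ω ω.2)).trans (map_zero _)

end Divergence

end VolumeForm

theorem isIntegrable_of_pairing_bijective (hdim : Γ.HasDimension (n + 1)) (V : Γ.VolumeForm (n + 1))
    (hV : ∀ k m (h : k + m = n + 1), Function.Bijective (V.pairing h)) :
    Γ.IsIntegrable (n + 1) :=
  ⟨hdim, VolumeForm.divergence (hV n 1 rfl), V.twist, fun k m h => .ofBijective _ (hV k m h),
    VolumeForm.divergence_isFlat _ hdim fun k m h => (hV k m h).2,
    fun _ _ h a b ω => V.pairing_lsmul_rsmul h a b ω,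
    fun _ _ h h' ω => VolumeForm.pairing_dForm _ h h' ω⟩

end DifferentialCalculus

/-! ### Integrability of the calculus over the quantum cone -/

section Duality

variable {A B : Type*} [Ring A] [Algebra ℂ A] [Ring B] [Algebra ℂ B]

lemma eq_zero_of_one_mem_mul {V W : Submodule ℂ A} {a : A} (h1 : 1 ∈ V * W)
    (h : ∀ v ∈ V, a * v = 0) : a = 0 := by
  suffices ∀ t ∈ V * W, a * t = 0 by simpa using this 1 h1
  intro t ht
  induction ht using Submodule.mul_induction_on' with
  | mem_mul_mem v hv w _ => rw [← mul_assoc, h v hv, zero_mul]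
  | add t _ t' _ ht ht' => rw [mul_add, ht, ht', add_zero]

/-- If `1 = ∑ vᵢ wᵢ`, then `φ v = (∑ φ(vᵢ) wᵢ) v`. -/
lemma exists_eq_mul_of_one_mem_mul {V W U : Submodule ℂ A} (φ : A →ₗ[ℂ] A) (h1 : 1 ∈ V * W)
    (hφU : ∀ v ∈ V, φ v ∈ U)
    (hφ : ∀ v ∈ V, ∀ w ∈ W, ∀ v' ∈ V, φ (v * (w * v')) = φ v * (w * v')) :
    ∃ a ∈ U * W, ∀ v ∈ V, φ v = a * v := by
  suffices ∀ t ∈ V * W, ∃ a ∈ U * W, ∀ v ∈ V, φ (t * v) = a * v by simpa using this 1 h1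
  intro t ht
  induction ht using Submodule.mul_induction_on' with
  | mem_mul_mem v hv w hw =>
    refine ⟨φ v * w, Submodule.mul_mem_mul (hφU v hv) hw, fun v' hv' => ?_⟩
    rw [mul_assoc, hφ v hv w hw v' hv', mul_assoc]
  | add t _ t' _ ht ht' =>
    obtain ⟨a, ha, h⟩ := ht
    obtain ⟨a', ha', h'⟩ := ht'
    refine ⟨a + a', add_mem ha ha', fun v hv => ?_⟩
    rw [add_mul, map_add, h v hv, h' v hv, add_mul]

/-- The restriction of an automorphism of `A` along an embedding `B → A` with invariant image. -/
def restrictAlgEquiv (F : B →ₐ[ℂ] A) (hF : Function.Injective F) (σ : A ≃ₐ[ℂ] A)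
    (hσ : ∀ a, σ a ∈ F.range ↔ a ∈ F.range) : B ≃ₐ[ℂ] B :=
  have h : F.range.map (σ : A →ₐ[ℂ] A) = F.range := by
    refine SetLike.ext fun a => ⟨?_, fun ha => ?_⟩
    · rintro ⟨b, hb, rfl⟩
      exact (hσ b).2 hb
    · exact ⟨σ.symm a, (hσ _).1 ((σ.apply_symm_apply a).symm ▸ ha), σ.apply_symm_apply a⟩
  ((AlgEquiv.ofInjective F hF).trans (σ.subalgebraMap F.range)).trans
    ((Subalgebra.equivOfEq _ _ h).trans (AlgEquiv.ofInjective F hF).symm)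

lemma map_restrictAlgEquiv (F : B →ₐ[ℂ] A) (hF : Function.Injective F) (σ : A ≃ₐ[ℂ] A)
    (hσ : ∀ a, σ a ∈ F.range ↔ a ∈ F.range) (b : B) :
    F (restrictAlgEquiv F hF σ hσ b) = σ (F b) :=
  congrArg Subtype.val ((AlgEquiv.ofInjective F hF).apply_symm_apply _)

end Duality

namespace Cone

open DiscForms

variable {N : ℕ} {q κ : ℝ} {hq : 0 < q} (hN : 0 < N)

variable (κ hq) in
/-- The automorphism by which functions on the quantum cone commute with the volume form. -/
def modularAut : Cone N q κ ≃ₐ[ℂ] Cone N q κ :=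
  restrictAlgEquiv (coneToDisc N κ hq) (coneToDisc_injective hq hN)
    ((Disc.twist κ hq).trans (Disc.twist κ hq)) fun f => by
      have hrange (g : Disc q κ) : g ∈ (coneToDisc N κ hq).range ↔ g ∈ Disc.weight q κ N 0 := by
        rw [← range_coneToDisc hq hN]
        rfl
      rw [hrange, hrange]
      refine ⟨fun hf => ?_, fun hf => Disc.twist_mem_weight hq (Disc.twist_mem_weight hq hf)⟩
      simpa using Disc.twist_symm_mem_weight hq (Disc.twist_symm_mem_weight hq hf)

lemma coneToDisc_modularAut (a : Cone N q κ) : coneToDisc N κ hq (modularAut κ hq hN a) =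
    Disc.twist κ hq (Disc.twist κ hq (coneToDisc N κ hq a)) :=
  map_restrictAlgEquiv ..

/-- The map `a ↦ dz ∧ dz* a` onto the two-forms of the quantum cone. -/
def mulVol (N : ℕ) (κ : ℝ) (hq : 0 < q) : Cone N q κ →ₗ[ℂ] DiscForms q κ :=
  twoForm ∘ₗ (coneToDisc N κ hq).toLinearMap

lemma mulVol_mul (a b : Cone N q κ) :
    mulVol N κ hq (a * b) = mulVol N κ hq a * ofDisc q κ (coneToDisc N κ hq b) := by
  simp only [mulVol, LinearMap.comp_apply, AlgHom.toLinearMap_apply, map_mul, twoForm_mul_ofDisc]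

lemma mulVol_modularAut_mul (a b : Cone N q κ) : mulVol N κ hq (modularAut κ hq hN a * b) =
    ofDisc q κ (coneToDisc N κ hq a) * mulVol N κ hq b := by
  simp only [mulVol, LinearMap.comp_apply, AlgHom.toLinearMap_apply, map_mul,
    coneToDisc_modularAut, ofDisc_mul_twoForm _ _ hq]

include hN

lemma mulVol_injective : Function.Injective (mulVol N κ hq) :=
  (twoForm_injective hq).comp (coneToDisc_injective hq hN)

variable (κ hq) in
/-- A linear left inverse of `mulVol`, the coefficient of a two-form with respect to `dz ∧ dz*`. -/
def volCoeff : DiscForms q κ →ₗ[ℂ] Cone N q κ :=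
  ((mulVol N κ hq).exists_leftInverse_of_injective
    (LinearMap.ker_eq_bot.2 (mulVol_injective hN))).choose

@[simp]
lemma volCoeff_mulVol (a : Cone N q κ) : volCoeff κ hq hN (mulVol N κ hq a) = a :=
  LinearMap.congr_fun ((mulVol N κ hq).exists_leftInverse_of_injective
    (LinearMap.ker_eq_bot.2 (mulVol_injective hN))).choose_spec a

variable (hκ : κ ≠ 0)

include hκ

lemma mem_forms_two {ω : DiscForms q κ} :
    ω ∈ forms κ hq N 2 ↔ ∃ a, mulVol N κ hq a = ω := by
  rw [forms_two hN hκ, invariants_two, ← range_coneToDisc hq hN, ← LinearMap.range_comp]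
  rfl

variable (hq) in
/-- The volume form `dz ∧ dz*` of the quantum cone. -/
def volumeForm : (calculus κ hq hN).VolumeForm 2 where
  coeff := volCoeff κ hq hN
  twist := modularAut κ hq hN
  bijective := by
    refine ⟨?_, fun a => ⟨⟨_, (mem_forms_two hN hκ).2 ⟨a, rfl⟩⟩, volCoeff_mulVol hN a⟩⟩
    rintro ⟨ω, hω⟩ ⟨η, hη⟩ h
    obtain ⟨a, rfl⟩ := (mem_forms_two hN hκ).1 hω
    obtain ⟨b, rfl⟩ := (mem_forms_two hN hκ).1 hη
    have hab : a = b := (volCoeff_mulVol hN a).symm.trans (h.trans (volCoeff_mulVol hN b))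
    exact Subtype.ext (congrArg (mulVol N κ hq) hab)
  coeff_mul_ι ω hω b := by
    obtain ⟨a, rfl⟩ := (mem_forms_two hN hκ).1 hω
    have h := volCoeff_mulVol (hq := hq) hN (a * b)
    rw [mulVol_mul] at h
    exact h.trans (congrArg (· * b) (volCoeff_mulVol hN a).symm)
  coeff_ι_mul ω hω b := by
    obtain ⟨a, rfl⟩ := (mem_forms_two hN hκ).1 hω
    have h := volCoeff_mulVol (hq := hq) hN (modularAut κ hq hN b * a)
    rw [mulVol_modularAut_mul] at h
    exact h.trans (congrArg (modularAut κ hq hN b * ·) (volCoeff_mulVol hN a).symm)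

lemma mem_forms_one {ω : DiscForms q κ} : ω ∈ forms κ hq N 1 ↔
    ∃ f ∈ Disc.weight q κ N (-1), ∃ g ∈ Disc.weight q κ N 1, oneForm (f, g) = ω := by
  rw [forms_one hN hκ, invariants_one, Submodule.mem_map]
  exact ⟨fun ⟨θ, hθ, h⟩ => ⟨θ.1, hθ.1, θ.2, hθ.2, h⟩,
    fun ⟨f, hf, g, hg, h⟩ => ⟨(f, g), ⟨hf, hg⟩, h⟩⟩

lemma eq_zero_of_forall_mul_eq_zero {ω : DiscForms q κ} (hω : ω ∈ forms κ hq N 1)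
    (h : ∀ η ∈ forms κ hq N 1, ω * η = 0) : ω = 0 := by
  obtain ⟨f, -, g, -, rfl⟩ := (mem_forms_one hN hκ).1 hω
  have hmul {f' g' : Disc q κ} (hf' : f' ∈ Disc.weight q κ N (-1))
      (hg' : g' ∈ Disc.weight q κ N 1) :
      Disc.twist κ hq f * g' - (q : ℂ) • (Disc.twist κ hq g * f') = 0 := by
    rw [← map_eq_zero_iff _ (twoForm_injective hq), ← oneForm_mul_oneForm _ _ _ _ hq]
    exact h _ (oneForm_mem_forms hN hκ hf' hg')
  have hf0 : Disc.twist κ hq f = 0 :=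
    eq_zero_of_one_mem_mul (Disc.one_mem_weight_one_mul_weight_neg_one hq hκ hN) fun g' hg' => by
      simpa using hmul (zero_mem _) hg'
  have hg0 : Disc.twist κ hq g = 0 :=
    eq_zero_of_one_mem_mul (Disc.one_mem_weight_neg_one_mul_weight_one hq hκ hN) fun f' hf' => by
      simpa [hq.ne'] using hmul hf' (zero_mem _)
  rw [EmbeddingLike.map_eq_zero_iff] at hf0 hg0
  rw [hf0, hg0, Prod.mk_zero_zero, map_zero]

omit hκ in
/-- `L` stands for `f ↦ dz f` or `f ↦ dz* f`. -/
lemma exists_coneToDisc_eq_mul {φ : forms κ hq N 1 →ₗ[ℂ] Cone N q κ}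
    (hφ : ∀ (ω η : forms κ hq N 1) (a : Cone N q κ),
      (η : DiscForms q κ) = ω * ofDisc q κ (coneToDisc N κ hq a) → φ η = φ ω * a)
    {k : ℤ} (h1 : 1 ∈ Disc.weight q κ N k * Disc.weight q κ N (-k))
    {L : Disc q κ →ₗ[ℂ] DiscForms q κ} (hL : ∀ f g, L (f * g) = L f * ofDisc q κ g)
    (hLk : ∀ f ∈ Disc.weight q κ N k, L f ∈ forms κ hq N 1) :
    ∃ F ∈ Disc.weight q κ N (-k), ∀ f (hf : f ∈ Disc.weight q κ N k),
      coneToDisc N κ hq (φ ⟨L f, hLk f hf⟩) = F * f := by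
  obtain ⟨ψ, hψ⟩ := LinearMap.exists_extend ((coneToDisc N κ hq).toLinearMap ∘ₗ φ ∘ₗ
    (L.domRestrict (Disc.weight q κ N k)).codRestrict _ fun f => hLk f f.2)
  have hψk (f) (hf : f ∈ Disc.weight q κ N k) :
      ψ f = coneToDisc N κ hq (φ ⟨L f, hLk f hf⟩) := LinearMap.congr_fun hψ ⟨f, hf⟩
  obtain ⟨F, hF, h⟩ := exists_eq_mul_of_one_mem_mul (U := Disc.weight q κ N 0) ψ h1
    (fun f hf => hψk f hf ▸ coneToDisc_mem_weight_zero hq _) fun f hf g hg f' hf' => by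
      have hgf : g * f' ∈ Disc.weight q κ N 0 := Disc.mul_mem_weight hg hf' (neg_add_cancel k)
      have hfgf : f * (g * f') ∈ Disc.weight q κ N k := Disc.mul_mem_weight hf hgf (add_zero k)
      rw [← range_coneToDisc hq hN] at hgf
      obtain ⟨a, ha : coneToDisc N κ hq a = g * f'⟩ := hgf
      have hφa := hφ ⟨L f, hLk f hf⟩ ⟨_, hLk _ hfgf⟩ a (by rw [ha, ← hL])
      rw [hψk _ hfgf, hψk f hf, hφa, map_mul, ha]
  refine ⟨F, ?_, fun f hf => (hψk f hf).symm.trans (h f hf)⟩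
  exact Submodule.mul_le.2 (fun f hf g hg => Disc.mul_mem_weight hf hg (zero_add _)) hF

lemma exists_mul_eq_mulVol {φ : forms κ hq N 1 →ₗ[ℂ] Cone N q κ}
    (hφ : ∀ (ω η : forms κ hq N 1) (a : Cone N q κ),
      (η : DiscForms q κ) = ω * ofDisc q κ (coneToDisc N κ hq a) → φ η = φ ω * a) :
    ∃ ω ∈ forms κ hq N 1, ∀ η : forms κ hq N 1, ω * η = mulVol N κ hq (φ η) := by
  obtain ⟨F, hF, hφF⟩ := exists_coneToDisc_eq_mul hN hφ
    (Disc.one_mem_weight_neg_one_mul_weight_one hq hκ hN)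
    (L := oneForm ∘ₗ LinearMap.inl ℂ _ _)
    (fun f g => by simp [oneForm_mul_ofDisc])
    (fun f hf => oneForm_mem_forms hN hκ hf (zero_mem _))
  obtain ⟨G, hG, hφG⟩ := exists_coneToDisc_eq_mul hN hφ
    (Disc.one_mem_weight_one_mul_weight_neg_one hq hκ hN)
    (L := oneForm ∘ₗ LinearMap.inr ℂ _ _)
    (fun f g => by simp [oneForm_mul_ofDisc])
    (fun g hg => oneForm_mem_forms hN hκ (zero_mem _) hg)
  rw [neg_neg] at hF
  refine ⟨oneForm ((Disc.twist κ hq).symm G, (Disc.twist κ hq).symm (-(q : ℂ)⁻¹ • F)),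
    oneForm_mem_forms hN hκ (Disc.twist_symm_mem_weight hq hG)
      (Disc.twist_symm_mem_weight hq (Submodule.smul_mem _ _ hF)), ?_⟩
  rintro ⟨_, hη⟩
  obtain ⟨f, hf, g, hg, rfl⟩ := (mem_forms_one hN hκ).1 hη
  have hq0 : (q : ℂ) ≠ 0 := by exact_mod_cast hq.ne'
  have hη' : (⟨oneForm (f, g), hη⟩ : forms κ hq N 1) =
      ⟨oneForm (f, 0), oneForm_mem_forms hN hκ hf (zero_mem _)⟩ +
        ⟨oneForm (0, g), oneForm_mem_forms hN hκ (zero_mem _) hg⟩ :=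
    Subtype.ext (by rw [Submodule.coe_add, ← map_add, Prod.mk_add_mk, add_zero, zero_add])
  have hφη : coneToDisc N κ hq (φ ⟨oneForm (f, g), hη⟩) = F * f + G * g := by
    rw [hη', map_add, map_add]
    exact congrArg₂ (· + ·) (hφF f hf) (hφG g hg)
  rw [oneForm_mul_oneForm _ _ _ _ hq, AlgEquiv.apply_symm_apply, AlgEquiv.apply_symm_apply,
    smul_mul_assoc, smul_smul, mul_neg, mul_inv_cancel₀ hq0, neg_one_smul, sub_neg_eq_add, add_comm,
    ← hφη]
  rfl

theorem calculus_isIntegrable : (calculus κ hq hN).IsIntegrable 2 := by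
  refine DifferentialCalculus.isIntegrable_of_pairing_bijective (calculus_hasDimension_two hN hκ)
    (volumeForm hq hN hκ) fun k m h => ?_
  obtain ⟨rfl, rfl⟩ | ⟨rfl, rfl⟩ | ⟨rfl, rfl⟩ :
    (k = 0 ∧ m = 2) ∨ (k = 1 ∧ m = 1) ∨ (k = 2 ∧ m = 0) := by omega
  · exact (volumeForm hq hN hκ).pairing_zero_left_bijective
  · rw [Function.Bijective, DifferentialCalculus.VolumeForm.pairing_injective_iff,
      DifferentialCalculus.VolumeForm.pairing_surjective_iff]
    refine ⟨fun ω hω => eq_zero_of_forall_mul_eq_zero hN hκ hω, fun φ => ?_⟩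
    obtain ⟨ω, hω, hφ⟩ := exists_mul_eq_mulVol hN hκ (φ := φ.1) fun ω η a h =>
      (congrArg φ.1 (Subtype.ext h)).trans (φ.2 ω a)
    exact ⟨ω, hω, fun η => (congrArg (volCoeff κ hq hN) (hφ η)).trans (volCoeff_mulVol hN _)⟩
  · exact (volumeForm hq hN hκ).pairing_zero_right_bijective

end Cone

/-! ### Growth -/

section WordSpan

variable {A : Type} [Ring A] [Algebra ℂ A] {S : Finset A}

lemma wordSpan_mono {m n : ℕ} (h : m ≤ n) : wordSpan S m ≤ wordSpan S n :=
  Submodule.span_mono fun _ ⟨l, hl, hS, hx⟩ => ⟨l, hl.trans h, hS, hx⟩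

lemma one_mem_wordSpan (n : ℕ) : (1 : A) ∈ wordSpan S n :=
  Submodule.subset_span ⟨[], by simp, by simp, by simp⟩

lemma mem_wordSpan_one {x : A} (hx : x ∈ S) : x ∈ wordSpan S 1 :=
  Submodule.subset_span ⟨[x], by simp, by simpa using hx, by simp⟩

instance (n : ℕ) : Module.Finite ℂ (wordSpan S n) := by
  refine Module.Finite.span_of_finite ℂ
    (((List.finite_length_le S n).image fun l => (l.map (↑)).prod).subset ?_)
  rintro _ ⟨l, hl, hS, rfl⟩
  lift l to List S using hS
  exact ⟨l, by simpa using hl, rfl⟩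

lemma mul_mem_wordSpan {m n : ℕ} {x y : A} (hx : x ∈ wordSpan S m) (hy : y ∈ wordSpan S n) :
    x * y ∈ wordSpan S (m + n) := by
  have h : wordSpan S m * wordSpan S n ≤ wordSpan S (m + n) := by
    rw [wordSpan, wordSpan, Submodule.span_mul_span, Submodule.span_le]
    rintro _ ⟨_, ⟨l, hl, hlS, rfl⟩, _, ⟨l', hl', hlS', rfl⟩, rfl⟩
    refine Submodule.subset_span ⟨l ++ l', ?_, ?_, by simp⟩
    · exact List.length_append.trans_le (add_le_add hl hl')
    · exact List.forall_mem_append.2 ⟨hlS, hlS'⟩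
  exact h (Submodule.mul_mem_mul hx hy)

lemma pow_mem_wordSpan {m : ℕ} {x : A} (hx : x ∈ wordSpan S m) (i : ℕ) :
    x ^ i ∈ wordSpan S (m * i) := by
  induction i with
  | zero => simpa using one_mem_wordSpan 0
  | succ i ih => rw [pow_succ, mul_add_one]; exact mul_mem_wordSpan ih hx

lemma exists_mem_wordSpan (hS : Algebra.adjoin ℂ (S : Set A) = ⊤) (x : A) :
    ∃ n, x ∈ wordSpan S n := by
  induction x using induction_of_adjoin_eq_top hS with
  | mem x hx => exact ⟨1, mem_wordSpan_one hx⟩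
  | algebraMap c =>
    rw [Algebra.algebraMap_eq_smul_one]
    exact ⟨0, Submodule.smul_mem _ _ (one_mem_wordSpan 0)⟩
  | add x y hx hy =>
    obtain ⟨m, hm⟩ := hx
    obtain ⟨n, hn⟩ := hy
    exact ⟨m + n, add_mem (wordSpan_mono (by lia) hm) (wordSpan_mono (by lia) hn)⟩
  | mul x y hx hy =>
    obtain ⟨m, hm⟩ := hx
    obtain ⟨n, hn⟩ := hy
    exact ⟨m + n, mul_mem_wordSpan hm hn⟩

lemma wordSpan_le {G : ℕ → Submodule ℂ A} (hG : Monotone G) (h1 : 1 ∈ G 0)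
    (hmul : ∀ n, ∀ s ∈ S, ∀ f ∈ G n, s * f ∈ G (n + 1)) (n : ℕ) : wordSpan S n ≤ G n := by
  have hword (l : List A) (hl : ∀ y ∈ l, y ∈ S) : l.prod ∈ G l.length := by
    induction l with
    | nil => simpa using h1
    | cons y l ih =>
      rw [List.forall_mem_cons] at hl
      exact List.prod_cons (a := y) ▸ hmul _ y hl.1 _ (ih hl.2)
  refine Submodule.span_le.2 ?_
  rintro _ ⟨l, hl, hS, rfl⟩
  exact hG hl (hword l hS)

lemma exists_map_wordSpan_le {B : Type} [Ring B] [Algebra ℂ B] {T : Finset B}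
    (hT : Algebra.adjoin ℂ (T : Set B) = ⊤) (F : A →ₐ[ℂ] B) (S : Finset A) :
    ∃ M : ℕ, ∀ n, (wordSpan S n).map F.toLinearMap ≤ wordSpan T (M * n) := by
  choose g hg using fun x => exists_mem_wordSpan hT (F x)
  refine ⟨S.sup g, fun n => Submodule.map_le_iff_le_comap.2 ?_⟩
  refine wordSpan_le (G := fun n => (wordSpan T (S.sup g * n)).comap F.toLinearMap)
    (fun _ _ h => Submodule.comap_mono (wordSpan_mono (Nat.mul_le_mul_left _ h))) ?_ ?_ n
  · simpa using one_mem_wordSpan 0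
  · intro n s hs f hf
    rw [Submodule.mem_comap, AlgHom.toLinearMap_apply, map_mul, mul_add_one, add_comm]
    exact mul_mem_wordSpan (wordSpan_mono (Finset.le_sup hs) (hg s)) hf

lemma eventually_le_rpow {e : ℝ} (he : 0 < e) (c : ℝ) :
    ∀ᶠ n : ℕ in Filter.atTop, c ≤ (n : ℝ) ^ e :=
  ((tendsto_rpow_atTop he).comp tendsto_natCast_atTop_atTop).eventually_ge_atTop c

lemma growthExponent_le {M d : ℕ}
    (h : ∀ n, Module.finrank ℂ (wordSpan S n) ≤ (M * n + 1) ^ d) : growthExponent S ≤ d := by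
  refine le_of_forall_gt_imp_ge_of_dense fun r hr => ?_
  induction r using ENNReal.recTopCoe with
  | top => exact le_top
  | coe ν =>
    have hν : (d : ℝ) < ν := by exact_mod_cast hr
    refine sInf_le ⟨ν, rfl, ?_⟩
    filter_upwards [eventually_le_rpow (sub_pos.2 hν) ((M + 1) ^ d),
      Filter.eventually_ge_atTop 1] with n hn hn1
    have hn1' : (1 : ℝ) ≤ n := by exact_mod_cast hn1
    calc (Module.finrank ℂ (wordSpan S n) : ℝ)
      _ ≤ (M * n + 1) ^ d := by exact_mod_cast h n
      _ ≤ ((M + 1) * n) ^ d := by gcongr; linarith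
      _ = (M + 1) ^ d * (n : ℝ) ^ d := mul_pow ..
      _ ≤ (n : ℝ) ^ ((ν : ℝ) - d) * (n : ℝ) ^ d := by gcongr
      _ = (n : ℝ) ^ (ν : ℝ) := by
        rw [← Real.rpow_natCast, ← Real.rpow_add (by linarith), sub_add_cancel]

lemma le_growthExponent {M d : ℕ} (hM : 0 < M)
    (h : ∀ n, n ^ d ≤ Module.finrank ℂ (wordSpan S (M * n))) : d ≤ growthExponent S := by
  refine le_sInf ?_
  rintro _ ⟨ν, rfl, hν⟩
  by_contra hlt
  have hlt' : (ν : ℝ) < d := by exact_mod_cast not_le.1 hlt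
  have hmul : Filter.Tendsto (fun n : ℕ => M * n) Filter.atTop Filter.atTop :=
    Filter.tendsto_id.const_mul_atTop' hM
  obtain ⟨n, hle, hlarge, hn⟩ := ((hmul.eventually hν).and
    ((eventually_le_rpow (sub_pos.2 hlt') ((M : ℝ) ^ (ν : ℝ) + 1)).and
      (Filter.eventually_ge_atTop 1))).exists
  have hn0 : (0 : ℝ) < n := by exact_mod_cast hn
  have hbound : (n : ℝ) ^ ((d : ℝ) - ν) * (n : ℝ) ^ (ν : ℝ) ≤ M ^ (ν : ℝ) * (n : ℝ) ^ (ν : ℝ) :=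
    calc (n : ℝ) ^ ((d : ℝ) - ν) * (n : ℝ) ^ (ν : ℝ)
      _ = (n : ℝ) ^ d := by rw [← Real.rpow_add hn0, sub_add_cancel, Real.rpow_natCast]
      _ ≤ Module.finrank ℂ (wordSpan S (M * n)) := by exact_mod_cast h n
      _ ≤ ((M * n : ℕ) : ℝ) ^ (ν : ℝ) := hle
      _ = M ^ (ν : ℝ) * (n : ℝ) ^ (ν : ℝ) := by
        rw [Nat.cast_mul, Real.mul_rpow (by positivity) hn0.le]
  linarith [le_of_mul_le_mul_right hbound (Real.rpow_pos_of_pos hn0 _)]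

lemma sq_le_finrank_wordSpan {m : ℕ} {x y : A}
    (hxy : LinearIndependent ℂ fun p : ℕ × ℕ => x ^ p.1 * y ^ p.2)
    (hx : x ∈ wordSpan S m) (hy : y ∈ wordSpan S m) (n : ℕ) :
    n ^ 2 ≤ Module.finrank ℂ (wordSpan S ((m + m) * n)) := by
  have hmem (p : Fin n × Fin n) : x ^ (p.1 : ℕ) * y ^ (p.2 : ℕ) ∈ wordSpan S ((m + m) * n) := by
    refine wordSpan_mono ?_ (mul_mem_wordSpan (pow_mem_wordSpan hx p.1) (pow_mem_wordSpan hy p.2))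
    rw [add_mul]
    gcongr <;> exact Fin.is_le'
  have hli : LinearIndependent ℂ fun p : Fin n × Fin n => (⟨_, hmem p⟩ : wordSpan S _) :=
    (hxy.comp (Prod.map Fin.val Fin.val) (Fin.val_injective.prodMap Fin.val_injective)).of_comp
      (Submodule.subtype _)
  simpa [sq] using hli.fintype_card_le_finrank

lemma two_le_growthExponent (hS : Algebra.adjoin ℂ (S : Set A) = ⊤) {x y : A}
    (hxy : LinearIndependent ℂ fun p : ℕ × ℕ => x ^ p.1 * y ^ p.2) : 2 ≤ growthExponent S := by
  obtain ⟨k, hx⟩ := exists_mem_wordSpan hS x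
  obtain ⟨l, hy⟩ := exists_mem_wordSpan hS y
  let m := k + l + 1
  exact_mod_cast le_growthExponent (M := m + m) (d := 2) (by lia) (sq_le_finrank_wordSpan hxy
    (wordSpan_mono (by lia) hx) (wordSpan_mono (by lia) hy))

end WordSpan

namespace Disc

variable {q κ : ℝ}

variable (q κ) in
/-- The generating set `{z, z*}` of the quantum disc. -/
def gens : Finset (Disc q κ) := (Set.toFinite {z q κ, zs q κ}).toFinset

lemma adjoin_gens : Algebra.adjoin ℂ (gens q κ : Set (Disc q κ)) = ⊤ := by
  simp only [gens, Set.Finite.coe_toFinset, adjoin_eq_top]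

variable (q κ) in
/-- The span of the monomials `z^i z*^j` with `i, j ≤ n`: a filtration of the quantum disc in
which the dimensions are visibly quadratic. -/
def monomialSpan (n : ℕ) : Submodule ℂ (Disc q κ) :=
  Submodule.span ℂ (Set.range fun p : Fin (n + 1) × Fin (n + 1) =>
    z q κ ^ (p.1 : ℕ) * zs q κ ^ (p.2 : ℕ))

instance (n : ℕ) : Module.Finite ℂ (monomialSpan q κ n) :=
  Module.Finite.span_of_finite ℂ (Set.finite_range _)

lemma finrank_monomialSpan_le (n : ℕ) :
    Module.finrank ℂ (monomialSpan q κ n) ≤ (n + 1) ^ 2 := by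
  refine (finrank_range_le_card _).trans_eq ?_
  simp [sq]

lemma mem_monomialSpan {n i j : ℕ} (hi : i ≤ n) (hj : j ≤ n) :
    z q κ ^ i * zs q κ ^ j ∈ monomialSpan q κ n :=
  Submodule.subset_span ⟨(⟨i, by lia⟩, ⟨j, by lia⟩), rfl⟩

lemma monomialSpan_mono : Monotone (monomialSpan q κ) := by
  intro m n h
  refine Submodule.span_le.2 ?_
  rintro _ ⟨⟨⟨i, hi⟩, ⟨j, hj⟩⟩, rfl⟩
  exact mem_monomialSpan (by lia) (by lia)

lemma zs_mul_z_pow (hq : 0 < q) (i : ℕ) : zs q κ * z q κ ^ (i + 1) =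
    (q : ℂ) ^ (i + 1) • (z q κ ^ (i + 1) * zs q κ) +
      ((κ * qInt q (i + 1) : ℝ) : ℂ) • z q κ ^ i := by
  rw [pow_succ', ← mul_assoc, ← shift_one κ hq, shift_mul_z_pow κ hq, shift, mul_add,
    Algebra.algebraMap_eq_smul_one, mul_smul_comm, mul_smul_comm, mul_one, ← mul_assoc, ← pow_succ,
    ← pow_succ', add_comm 1 (i : ℤ)]
  norm_cast

lemma mul_mem_monomialSpan (hq : 0 < q) (n : ℕ) (s : Disc q κ) (hs : s ∈ gens q κ) (f : Disc q κ)
    (hf : f ∈ monomialSpan q κ n) : s * f ∈ monomialSpan q κ (n + 1) := by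
  refine (Submodule.span_le (p := (monomialSpan q κ (n + 1)).comap (LinearMap.mulLeft ℂ s))).2
    ?_ hf
  rintro _ ⟨⟨⟨i, hi⟩, ⟨j, hj⟩⟩, rfl⟩
  rw [SetLike.mem_coe, Submodule.mem_comap, LinearMap.mulLeft_apply, ← mul_assoc]
  obtain rfl | rfl : s = z q κ ∨ s = zs q κ := by simpa [gens] using hs
  · rw [← pow_succ']
    exact mem_monomialSpan (by lia) (by lia)
  cases i with
  | zero =>
    rw [pow_zero, mul_one, ← pow_succ', ← one_mul (zs q κ ^ (j + 1)), ← pow_zero (z q κ)]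
    exact mem_monomialSpan (by lia) (by lia)
  | succ i =>
    rw [zs_mul_z_pow hq, add_mul, smul_mul_assoc, smul_mul_assoc, mul_assoc, ← pow_succ']
    exact add_mem (Submodule.smul_mem _ _ (mem_monomialSpan (by lia) (by lia)))
      (Submodule.smul_mem _ _ (mem_monomialSpan (by lia) (by lia)))

lemma wordSpan_gens_le (hq : 0 < q) : ∀ n, wordSpan (gens q κ) n ≤ monomialSpan q κ n :=
  wordSpan_le monomialSpan_mono (by simpa using mem_monomialSpan (i := 0) (j := 0) le_rfl le_rfl)
    (mul_mem_monomialSpan hq)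

end Disc

namespace Cone

variable {N : ℕ} {q κ : ℝ}

lemma linearIndependent_a_pow_mul_b_pow (hq : 0 < q) (hN : 0 < N) :
    LinearIndependent ℂ fun p : ℕ × ℕ => a N q κ ^ p.1 * b N q κ ^ p.2 := by
  have hsingle : LinearIndependent ℂ fun p : (_ : ℤ) × ℕ =>
      (Finsupp.single p.1 (basisMonomials ℂ p.2) : ℤ →₀ ℂ[X]) :=
    Finsupp.linearIndependent_single (f := fun _ => basisMonomials ℂ)
      fun _ => (basisMonomials ℂ).linearIndependent
  have hinj : Function.Injective fun p : ℕ × ℕ => (⟨p.2, p.1⟩ : (_ : ℤ) × ℕ) := by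
    rintro ⟨i, k⟩ ⟨i', k'⟩ h
    simp_all
  convert! (hsingle.map' (nf N q κ) (LinearMap.ker_eq_bot.2 (nf_injective hq hN))).comp _ hinj
    using 2 with p
  simp [aeval_monomial, signedPow_natCast]

lemma growthExponent_le_two (hq : 0 < q) (hN : 0 < N) (S : Finset (Cone N q κ)) :
    growthExponent S ≤ 2 := by
  obtain ⟨M, hM⟩ := exists_map_wordSpan_le Disc.adjoin_gens (coneToDisc N κ hq) S
  refine mod_cast growthExponent_le (M := M) (d := 2) fun n => ?_
  calc Module.finrank ℂ (wordSpan S n)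
    _ = Module.finrank ℂ ((wordSpan S n).map (coneToDisc N κ hq).toLinearMap) :=
      (Submodule.equivMapOfInjective _ (coneToDisc_injective hq hN) _).finrank_eq
    _ ≤ Module.finrank ℂ (Disc.monomialSpan q κ (M * n)) :=
      Submodule.finrank_mono ((hM n).trans (Disc.wordSpan_gens_le hq _))
    _ ≤ (M * n + 1) ^ 2 := Disc.finrank_monomialSpan_le _

theorem isAffineOfGKDim (hq : 0 < q) (hN : 0 < N) : IsAffineOfGKDim (Cone N q κ) 2 :=
  ⟨⟨Subalgebra.fg_def.2 ⟨_, Set.toFinite _, adjoin_eq_top N q κ⟩⟩, fun S hS =>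
    (growthExponent_le_two hq hN S).antisymm
      (two_le_growthExponent hS (linearIndependent_a_pow_mul_b_pow hq hN))⟩

end Cone

end QuantumCone

end

theorem theorem4p1 (N : ℕ) (hN : 0 < N) (q κ : ℝ) (hq : 0 < q) (hκ : κ ≠ 0) :
    (∃ Γ : QuantumCone.DifferentialCalculus (QuantumCone.Cone N q κ),
      Γ.toCalculusData = QuantumCone.coneCalculus N κ hq ∧
      Γ.HasDimension 2 ∧ Γ.IsConnected ∧ Γ.IsIntegrable 2) ∧
    QuantumCone.IsAffineOfGKDim (QuantumCone.Cone N q κ) 2 ∧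
    QuantumCone.IsDifferentiallySmooth (QuantumCone.Cone N q κ) := by
  have hdim := QuantumCone.Cone.calculus_hasDimension_two (hq := hq) hN hκ
  have hcon := QuantumCone.Cone.calculus_isConnected (hq := hq) hN hκ
  have hint := QuantumCone.Cone.calculus_isIntegrable (hq := hq) hN hκ
  have hGK : QuantumCone.IsAffineOfGKDim (QuantumCone.Cone N q κ) 2 :=
    QuantumCone.Cone.isAffineOfGKDim hq hN
  exact ⟨⟨_, rfl, hdim, hcon, hint⟩, hGK, 2, mod_cast hGK, _, hdim, hcon, hint⟩
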